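/- Let $X$ be a non-empty compact complex manifold of dimension $n$, and let $Z$ be a polynomial central charge on $X$ with fixed representative data: a stability vector $\rho=(\rho_0,\dots,\rho_n)\in(\mathbb C^*)^{n+1}$ with $\operatorname{Im}\rho_n>0$ and $\operatorname{Im}(\rho_d/\rho_{d+1})>0$ for $0\le d<n$, a Kähler form $\omega$, and a closed real inhomogeneous form $\tilde U=1+\tilde N$ with $\tilde N$ of positive degree. Let $(E,h)\to X$ be a smooth Hermitian vector bundle of rank $\operatorname{rk}E$, and let $\mathcal A(h)$ be the space of Chern connections on $(E,h)$, i.e. of $h$-unitary connections $A$ with $F_A^{0,2}=0$. For a connection $\nabla$ on $E$ with curvature $F$ let $$\tilde Z(\nabla)=\Big[\Big(\sum_{d=0}^n\rho_d\,\omega^d\Big)\wedge\exp\Big(\tfrac{i}{2\pi}F\Big)\wedge\tilde U\Big]_{2n}\in\Omega^{2n}(X,\operatorname{End}E)$$ be the component of top degree. Let $Z(E)=\int_X\big(\sum_d\rho_d[\omega]^d\big)\cdot\mathrm{Ch}(E)\cdot[\tilde U]$, let $\varphi(E)=\arg Z(E)\in(-\pi,\pi]$ (and $\varphi(E)=\pi$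 if $Z(E)=0$), and let $\operatorname{vol}X=\int_X\omega^n/n!$. For an endomorphism $T$ write $\operatorname{Re}T=\frac12(T+T^*)$, $\operatorname{Im}T=\frac1{2i}(T-T^*)$, $|T|^2=\operatorname{tr}(TT^*)$. For $A\in\mathcal A(h)$ write $\tilde Z(A)=\zeta(A)\,\omega^n/n!$ and define $$Z\mathrm{YM}(A)=\int_X|\zeta(A)|^2\,\frac{\omega^n}{n!},\qquad b(E)=\frac{\big(\operatorname{Re}(e^{-i\varphi(E)}Z(E))\big)^2}{\operatorname{rk}E\cdot\operatorname{vol}X}$$ (with $b(E)=0$ if $\operatorname{rk}E=0$). Then: 1. $b(E)$ is topological: $\int_X\operatorname{tr}\tilde Z(\nabla)=Z(E)$ for every smooth connection $\nabla$ on $E$. 2. $Z\mathrm{YM}(A)\ge b(E)$ for every $A\in\mathcal A(h)$. 3. For every $A\in\mathcal A(h)$: $A$ is an absolute minimum of $Z\mathrm{YM}$ on $\mathcal A(h)$ with minimum value equal to the topological bound $b(E)$ if and only if $A$ is $Z$-critical, $\operatorname{Im}(e^{-i\varphi(E)}\tilde Z(A))=0$, and there is a constant $\lambda\in\mathbb R$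 with $$\operatorname{Re}(e^{-i\varphi(E)}\tilde Z(A))=\lambda\,\mathrm{id}_E\otimes\omega^n.$$ In particular, if some connection in $\mathcal A(h)$ attains the bound, then $A\in\mathcal A(h)$ is an absolute minimum of $Z\mathrm{YM}$ if and only if these two equations hold. 4. If $A\in\mathcal A(h)$ is $Z$-almost calibrated, i.e. the form $\operatorname{Re}\operatorname{tr}(e^{-i\varphi(E)}\tilde Z(A))$ of top degree is positive on $X$, and $\operatorname{Re}(e^{-i\varphi(E)}\tilde Z(A))=\lambda\,\mathrm{id}_E\otimes\omega^n$, then $\lambda>0$. -/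

import Mathlib

open scoped Manifold ContDiff ComplexStarModule

noncomputable section

namespace ZYM

/-! ### Multilinear algebra: forms on `ℂⁿ` and their wedge product -/

/-- The model space `ℂⁿ` of an `n`-dimensional complex manifold. -/
abbrev Model (n : ℕ) : Type := EuclideanSpace ℂ (Fin n)

/-- Alternating real-multilinear `k`-forms on `ℂⁿ` with values in `W`. -/
abbrev Alt (n k : ℕ) (W : Type*) [NormedAddCommGroup W] [NormedSpace ℝ W] : Type _ :=
  Model n [⋀^Fin k]→L[ℝ] W

/-- The real basis `(e₁, i e₁, …, eₙ, i eₙ)` of `ℂⁿ`; it is positively oriented. -/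
def realBasis (n : ℕ) : Module.Basis (Fin (2 * n)) ℝ (Model n) :=
  (Complex.basisOneI.smulTower' (EuclideanSpace.basisFun (Fin n) ℂ).toBasis).reindex
    (finProdFinEquiv.trans (finCongr (mul_comm n 2)))

section Wedge

variable {n : ℕ} {W : Type*} [NormedRing W] [NormedAlgebra ℝ W]

/-- The wedge product of algebra-valued forms (sum over shuffles, values multiplied in `W`). -/
def wedge {p q m : ℕ} (a : Alt n p W) (b : Alt n q W) (h : p + q = m) : Alt n m W :=
  { ((LinearMap.mul' ℝ W).compAlternatingMap
      (a.toAlternatingMap.domCoprod b.toAlternatingMap)).domDomCongr (finSumFinEquiv.trans (finCongr h)) with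
    cont := by
      change Continuous fun v : Fin m → Model n =>
        LinearMap.mul' ℝ W ((∑ σ, AlternatingMap.domCoprod.summand a.toAlternatingMap
          b.toAlternatingMap σ) (fun i => v (finCongr h (finSumFinEquiv i))))
      simp only [sum_apply, map_sum]
      refine continuous_finsetSum _ fun σ _ => ?_
      induction σ using Quotient.inductionOn' with
      | h σ =>
        simp only [AlternatingMap.domCoprod.summand_mk'', _root_.smul_apply,
          MultilinearMap.domDomCongr_apply, MultilinearMap.domCoprod_apply]
        have hc : Continuous fun v : Fin m → Model n =>
            Equiv.Perm.sign σ • (a (fun i => v (finCongr h (finSumFinEquiv (σ (Sum.inl i))))) *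
              b (fun i => v (finCongr h (finSumFinEquiv (σ (Sum.inr i)))))) := by
          refine Continuous.const_smul (Continuous.mul ?_ ?_) _
          · exact a.cont.comp (by fun_prop)
          · exact b.cont.comp (by fun_prop)
        convert hc using 2 with v
        rw [LinearMap.map_smul_of_tower, LinearMap.mul'_apply]
        rfl }

/-- Inhomogeneous forms: a form of every degree `k`. -/
abbrev Forms (n : ℕ) (W : Type*) [NormedAddCommGroup W] [NormedSpace ℝ W] : Type _ :=
  ∀ k : ℕ, Alt n k W

/-- The wedge product of inhomogeneous forms. -/
def Forms.mul (a b : Forms n W) : Forms n W := fun m =>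
  ∑ pq ∈ (Finset.HasAntidiagonal.antidiagonal m).attach,
    wedge (a pq.1.1) (b pq.1.2) (Finset.HasAntidiagonal.mem_antidiagonal.1 pq.2)

/-- The constant `1` as an inhomogeneous form. -/
def Forms.one : Forms n W :=
  Pi.single 0 (ContinuousAlternatingMap.constOfIsEmpty ℝ (Model n) (Fin 0) (1 : W))

/-- Wedge powers of inhomogeneous forms. -/
def Forms.pow (a : Forms n W) : ℕ → Forms n W
  | 0 => Forms.one
  | k + 1 => Forms.mul (Forms.pow a k) a

end Wedge

/-- A `2`-form regarded as an inhomogeneous form. -/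
def ofTwo {n : ℕ} {W : Type*} [NormedAddCommGroup W] [NormedSpace ℝ W] (a : Alt n 2 W) :
    Forms n W := Pi.single 2 a

/-- The fibre `ℂʳ` of a bundle of rank `r`, with its standard Hermitian inner product. -/
abbrev Fib (r : ℕ) : Type := EuclideanSpace ℂ (Fin r)

/-- Endomorphisms of `ℂʳ`; `star` is the adjoint. -/
abbrev EndFib (r : ℕ) : Type := Fib r →L[ℂ] Fib r

/-- The trace of an endomorphism, as a real-linear map. -/
def traceL (r : ℕ) : EndFib r →L[ℝ] ℂ :=
  LinearMap.toContinuousLinearMap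
    (((LinearMap.trace ℂ (Fib r)).restrictScalars ℝ).comp
      ((ContinuousLinearMap.coeLM ℂ : EndFib r →ₗ[ℂ] (Fib r →ₗ[ℂ] Fib r)).restrictScalars ℝ))

/-- A real form `γ` regarded as the endomorphism-valued form `γ ⊗ id`. -/
def tensorId {n k : ℕ} (r : ℕ) (a : Alt n k ℝ) : Alt n k (EndFib r) :=
  ((ContinuousLinearMap.id ℝ ℝ).smulRight (1 : EndFib r)).compContinuousAlternatingMap a

/-! ### Differential forms on a complex manifold

`TangentSpace 𝓘(ℝ, Model n) x` is, by Mathlib's definition, the model space `Model n`: a tangent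
vector at `x` is identified with its coordinates in the preferred chart at `x`.  The charts are
holomorphic, so multiplication by `i` on `Model n` is the complex structure of `T_x X`. -/

section Manifold

variable {n : ℕ} {X : Type*} [TopologicalSpace X] [ChartedSpace (Model n) X]

/-- A (not necessarily smooth) `W`-valued differential `k`-form on `X`: at each `x` an alternating
form on `T_x X`. -/
abbrev DForm (n : ℕ) (X : Type*) (k : ℕ) (W : Type*) [NormedAddCommGroup W] [NormedSpace ℝ W] :
    Type _ := X → Alt n k W

variable {k : ℕ} {W : Type*} [NormedAddCommGroup W] [NormedSpace ℝ W]

/-- The coordinate expression of a form in the chart at `x₀`, that is, its pullback under the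
inverse of that chart (meaningful on the target of the chart). -/
def inChart (x₀ : X) (η : DForm n X k W) : Model n → Alt n k W := fun y =>
  let D : Model n →L[ℝ] Model n :=
    mfderiv 𝓘(ℝ, Model n) 𝓘(ℝ, Model n) (chartAt (Model n) x₀).symm y
  (η ((chartAt (Model n) x₀).symm y)).compContinuousLinearMap D

/-- Smoothness of a form on a set `S`. -/
def SmoothOn (η : DForm n X k W) (S : Set X) : Prop :=
  ∀ x₀ : X, ContDiffOn ℝ ∞ (inChart x₀ η)
    ((chartAt (Model n) x₀).target ∩ (chartAt (Model n) x₀).symm ⁻¹' S)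

/-- The exterior derivative of a form, computed at `x` in the chart at `x`. -/
def dForm (η : DForm n X k W) : DForm n X (k + 1) W := fun x =>
  extDeriv (inChart x η) (chartAt (Model n) x x)

/-- A complex manifold is a smooth real manifold. -/
theorem isManifold_real (n : ℕ) (X : Type*) [TopologicalSpace X] [ChartedSpace (Model n) X]
    [IsManifold 𝓘(ℂ, Model n) ω X] : IsManifold 𝓘(ℝ, Model n) ∞ X := by
  refine isManifold_of_contDiffOn 𝓘(ℝ, Model n) ∞ X fun e e' he he' => ?_
  have h : ContDiffOn ℂ ω (𝓘(ℂ, Model n) ∘ (e.symm ≫ₕ e') ∘ 𝓘(ℂ, Model n).symm)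
      (𝓘(ℂ, Model n).symm ⁻¹' (e.symm ≫ₕ e').source ∩ Set.range 𝓘(ℂ, Model n)) :=
    ((contDiffGroupoid ω 𝓘(ℂ, Model n)).compatible he he').1
  exact (h.restrict_scalars ℝ).of_le le_top

/-- A smooth partition of unity subordinate to the domains of the preferred charts. -/
def chartPartition (n : ℕ) (X : Type*) [TopologicalSpace X] [ChartedSpace (Model n) X]
    [IsManifold 𝓘(ℂ, Model n) ω X] [CompactSpace X] [T2Space X] :
    SmoothPartitionOfUnity X 𝓘(ℝ, Model n) X Set.univ :=
  haveI := isManifold_real n X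
  (SmoothPartitionOfUnity.exists_isSubordinate_chartAt_source 𝓘(ℝ, Model n) X).choose

/-- The integral `∫_X η` of a form of top degree over the compact complex manifold `X`, with its
complex orientation: `∑ₐ ∫ χₐ η` for a partition of unity `χ` subordinate to the charts, each term
being the Lebesgue integral in the chart of the coefficient of `χₐ η` with respect to the oriented
basis `realBasis n`. -/
def integral [IsManifold 𝓘(ℂ, Model n) ω X] [CompactSpace X] [T2Space X]
    (η : DForm n X (2 * n) W) : W :=
  ∑ᶠ a : X, ∫ y in (chartAt (Model n) a).target,
    chartPartition n X a ((chartAt (Model n) a).symm y) • inChart a η y (realBasis n)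
      ∂(realBasis n).addHaar

/-- A Kähler form: a smooth closed real `2`-form of type `(1,1)` that is positive,
`ω(u, iu) > 0` for `u ≠ 0`. -/
structure KahlerForm (n : ℕ) (X : Type*) [TopologicalSpace X] [ChartedSpace (Model n) X] where
  form : DForm n X 2 ℝ
  smooth : SmoothOn form Set.univ
  closed : dForm form = 0
  type_one_one : ∀ x (u v : Model n), form x ![Complex.I • u, Complex.I • v] = form x ![u, v]
  pos : ∀ x (u : Model n), u ≠ 0 → 0 < form x ![u, Complex.I • u]

/-- The wedge power `ω^k`, a form of degree `2k`. -/
def KahlerForm.pow (K : KahlerForm n X) (k : ℕ) : DForm n X (2 * k) ℝ := fun x =>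
  Forms.pow (ofTwo (K.form x)) k (2 * k)

/-- The volume form `ω^n / n!`. -/
def KahlerForm.volForm (K : KahlerForm n X) : DForm n X (2 * n) ℝ := fun x =>
  ((n.factorial : ℝ)⁻¹) • K.pow n x

/-- The volume `∫_X ω^n / n!`. -/
def KahlerForm.vol [IsManifold 𝓘(ℂ, Model n) ω X] [CompactSpace X] [T2Space X]
    (K : KahlerForm n X) : ℝ :=
  integral K.volForm

/-- A polynomial central charge on `X` together with representative data: a stability vector
`ρ = (ρ₀, …, ρₙ)`, a Kähler form `ω`, and a closed real inhomogeneous form `U = 1 + N`, with `N` of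
positive degree, representing a unipotent class. -/
structure CentralCharge (n : ℕ) (X : Type*) [TopologicalSpace X] [ChartedSpace (Model n) X] where
  rho : Fin (n + 1) → ℂ
  rho_ne_zero : ∀ d, rho d ≠ 0
  rho_last : 0 < (rho (Fin.last n)).im
  rho_quotient : ∀ d : Fin n, 0 < (rho d.castSucc / rho d.succ).im
  omega : KahlerForm n X
  U : ∀ k : ℕ, DForm n X k ℝ
  U_smooth : ∀ k, SmoothOn (U k) Set.univ
  U_closed : ∀ k, dForm (U k) = 0
  U_zero : ∀ x v, U 0 x v = 1

/-! ### Hermitian vector bundles and connections -/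

/-- A smooth Hermitian vector bundle of rank `r` over `X`, given in local unitary frames: a Mathlib
vector bundle core with fibre `ℂʳ` whose transition functions are smooth and unitary.  The fibre at
`x` is `ℂʳ`, via the frame with index `indexAt x`, and carries the standard inner product. -/
structure HermitianBundle (n r : ℕ) (X : Type*) [TopologicalSpace X] [ChartedSpace (Model n) X]
    (ι : Type*) extends VectorBundleCore ℂ X (Fib r) ι where
  smooth_coordChange : ∀ i j, ContMDiffOn 𝓘(ℝ, Model n) 𝓘(ℝ, EndFib r) ∞ (coordChange i j)
    (baseSet i ∩ baseSet j)
  unitary_coordChange : ∀ i j, ∀ x ∈ baseSet i ∩ baseSet j, coordChange i j x ∈ unitary (EndFib r)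

variable {r : ℕ} {ι : Type*}

/-- A smooth connection on `E`, given by its connection forms `Aᵢ` in the local frames
(`∇ = d + Aᵢ` over `baseSet i`), which satisfy `Aⱼ g + dg = g Aᵢ` for the transition function
`g = gᵢⱼ` from frame `i` to frame `j`. -/
structure Connection (E : HermitianBundle n r X ι) where
  form : ι → DForm n X 1 (EndFib r)
  smooth : ∀ i, SmoothOn (form i) (E.baseSet i)
  gauge : ∀ i j, ∀ x ∈ E.baseSet i ∩ E.baseSet j, ∀ v : Model n,
    let dg : Model n →L[ℝ] EndFib r :=
      mfderiv 𝓘(ℝ, Model n) 𝓘(ℝ, EndFib r) (E.coordChange i j) x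
    form j x (fun _ => v) * E.coordChange i j x + dg v = E.coordChange i j x * form i x (fun _ => v)

/-- The curvature `F = dA + A ∧ A` at `x`, an `End(E_x)`-valued `2`-form on `T_x X`. -/
def Connection.curvature {E : HermitianBundle n r X ι} (D : Connection E) :
    DForm n X 2 (EndFib r) := fun x =>
  dForm (D.form (E.indexAt x)) x + wedge (D.form (E.indexAt x) x) (D.form (E.indexAt x) x) rfl

/-- The space `𝒜(h)` of Chern connections on the Hermitian bundle `E`: unitary connections that
are integrable, `F^{0,2} = 0`; the latter is expressed by evaluating (the complex-bilinear
extension of) `F` on the vectors `u + i J u`, `v + i J v` of type `(0,1)`. -/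
structure ChernConnection (E : HermitianBundle n r X ι) extends Connection E where
  unitary : ∀ i, ∀ x ∈ E.baseSet i, ∀ v : Fin 1 → Model n,
    star (form i x v) = -form i x v
  integrable : ∀ x (u v : Model n),
    toConnection.curvature x ![u, v]
      - toConnection.curvature x ![Complex.I • u, Complex.I • v]
      + Complex.I • (toConnection.curvature x ![Complex.I • u, v]
        + toConnection.curvature x ![u, Complex.I • v]) = 0

/-- The Chern--Weil form `exp(i F / 2π)` at `x` (the terms of degree `> 2n` vanish). -/
def Connection.chernForm {E : HermitianBundle n r X ι} (D : Connection E) (x : X) :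
    Forms n (EndFib r) :=
  ∑ j ∈ Finset.range (n + 1), ((j.factorial : ℂ)⁻¹) •
    Forms.pow (ofTwo ((Complex.I / (2 * (Real.pi : ℂ))) • D.curvature x)) j

namespace CentralCharge

variable (Z : CentralCharge n X) {E : HermitianBundle n r X ι}

/-- The inhomogeneous `End E`-valued form `(∑_d ρ_d ω^d) ∧ exp(i F / 2π) ∧ U`. -/
def density (D : Connection E) (x : X) : Forms n (EndFib r) :=
  Forms.mul
    (Forms.mul
      (∑ d : Fin (n + 1), Z.rho d • Forms.pow (ofTwo (tensorId r (Z.omega.form x))) (d : ℕ))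
      (D.chernForm x))
    (fun k => tensorId r (Z.U k x))

/-- `Z̃(∇)`: the component of degree `2n` of the density. -/
def tilde (D : Connection E) : DForm n X (2 * n) (EndFib r) := fun x => Z.density D x (2 * n)

/-- The scalar form `tr Z̃(∇)`. -/
def trTilde (D : Connection E) : DForm n X (2 * n) ℂ := fun x =>
  (traceL r).compContinuousAlternatingMap (Z.tilde D x)

/-- The endomorphism `ζ` with `Z̃(∇) = ζ ω^n / n!`, that is, the quotient of the two forms of top
degree. -/
def zeta (D : Connection E) (x : X) : EndFib r :=
  (Z.omega.volForm x (realBasis n))⁻¹ • Z.tilde D x (realBasis n)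

/-- `|T|² = tr (T T*)`. -/
def normSqEnd {r : ℕ} (T : EndFib r) : ℝ := (traceL r (T * star T)).re

variable [IsManifold 𝓘(ℂ, Model n) ω X] [CompactSpace X] [T2Space X]

open Classical in
/-- The topological number `Z(E) = ∫_X (∑_d ρ_d [ω]^d) · Ch(E) · U`, the Chern character being
represented by the Chern--Weil form of some connection on `E`; the value does not depend on which
(and every bundle has a connection). -/
def charge (E : HermitianBundle n r X ι) : ℂ :=
  if h : Nonempty (Connection E) then integral (Z.trTilde h.some) else 0

open Classical in
/-- The phase `φ(E) = arg Z(E) ∈ (-π, π]`, with `φ(E) = π` if `Z(E) = 0`. -/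
def phase (E : HermitianBundle n r X ι) : ℝ :=
  if Z.charge E = 0 then Real.pi else (Z.charge E).arg

/-- The unit complex number `e^{-iφ(E)}`. -/
def rot (E : HermitianBundle n r X ι) : ℂ := Complex.exp (-(Complex.I * (Z.phase E : ℂ)))

/-- The `Z`-critical equation `Im(e^{-iφ(E)} Z̃(A)) = 0`. -/
def IsCritical (A : ChernConnection E) : Prop :=
  ∀ x v, ℑ (Z.rot E • Z.tilde A.toConnection x v) = 0

/-- The equation `Re(e^{-iφ(E)} Z̃(A)) = lam · id_E ⊗ ω^n`. -/
def RealPartEq (A : ChernConnection E) (lam : ℝ) : Prop :=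
  ∀ x v, (ℜ (Z.rot E • Z.tilde A.toConnection x v) : EndFib r)
    = (lam * Z.omega.pow n x v) • (1 : EndFib r)

/-- `A` is `Z`-almost calibrated: the top-degree form `Re tr(e^{-iφ(E)} Z̃(A))` is positive. -/
def IsAlmostCalibrated (A : ChernConnection E) : Prop :=
  ∀ x, 0 < (Z.rot E * Z.trTilde A.toConnection x (realBasis n)).re

/-- The `Z`-Yang--Mills functional `∫_X |ζ(A)|² ω^n / n!`. -/
def yangMills (A : ChernConnection E) : ℝ :=
  integral fun x => normSqEnd (Z.zeta A.toConnection x) • Z.omega.volForm x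

/-- The topological bound `Re(e^{-iφ(E)} Z(E))² / (rk E · vol X)`. -/
def bound (E : HermitianBundle n r X ι) : ℝ :=
  (Z.rot E * Z.charge E).re ^ 2 / (r * Z.omega.vol)

/-- `A` is an (absolute) minimum of the `Z`-Yang--Mills functional on `𝒜(h)`. -/
def IsMinimum (A : ChernConnection E) : Prop :=
  ∀ B : ChernConnection E, Z.yangMills A ≤ Z.yangMills B

end CentralCharge

end Manifold

end ZYM

end

noncomputable section

namespace ZYM


/-! ### Contraction of wedge products -/

/-! The bound comes from completing a square. Put c = Re(e^{-iφ}Z(E)) / (rk E · vol X). As e^{-iφ}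
has modulus one, |e^{-iφ}ζ − c·id|² = |ζ|² − 2c Re tr(e^{-iφ}ζ) + c² rk E at every point. Integrated
against the volume form, with ∫ tr Z̃(A) = Z(E), the right side becomes ZYM(A) − b(E); this is
`integral_sq_eq`. The volume form is positive, so ZYM(A) ≥ b(E). The integrand is continuous, so
equality means e^{-iφ}ζ = c·id at every point (`yangMills_eq_bound_iff`). Splitting an endomorphism
into real and imaginary parts turns this into the two equations, with λ = c/n! because ω^n is n!
times the volume form; conversely, tracing and integrating the equations forces this constant
(`isCritical_and_realPartEq_iff`). For an almost calibrated A, the sign of λ is read off from the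
trace at a single point.

What remains is that ∫ tr Z̃(∇) does not depend on ∇, and most of the work goes there. The curvature
of the path A + ta is F + tB + t²C, and the t-derivative of tr(γ ∧ p(F_t) ∧ U) is exact: by the
Bianchi identity and the Leibniz rule, every term containing the connection form assembles into a
graded commutator, which the trace kills (`d_insertForm`). The integrand is a polynomial in t, so a
quadrature rule exact in the relevant degrees replaces the integral over t, and the Chern–Simons
form is a finite sum (`pow_sub_pow_eq_quadrature`, `cwForm_sub_eq_d_csForm`). The transition
functions conjugate both the curvature and the difference of two connections, so the local
Chern–Simons forms glue to a global one (`exists_transgression`), and Stokes' theorem concludes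
(`integral_dForm`).

Two geometric facts support this. Transition maps of a complex manifold have Jacobian |det|² > 0, so
integrals over charts agree with their orientation. The top power of a positive (1,1)-form is
positive (`kahler_pow_pos`), seen on a basis adapted to the form. On the algebraic side,
inhomogeneous forms with values in an algebra are a ring, and contraction with a vector is an
antiderivation. A form is determined by its degree-zero part and its contractions, so associativity,
graded commutation and the Leibniz rule all follow by induction on the degree. -/

/-- Summation over permutations of `Fin (m + 1)` according to the preimage of `0`. -/
theorem sum_perm_succ {M : Type*} [AddCommMonoid M] {m : ℕ}
    (f : Equiv.Perm (Fin (m + 1)) → M) :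
    ∑ σ, f σ = ∑ i : Fin (m + 1), ∑ e : Equiv.Perm (Fin m),
      f (Equiv.Perm.decomposeFin.symm (0, e) * i.cycleRange) := by
  rw [← Fintype.sum_prod_type' (f := fun (i : Fin (m + 1)) (e : Equiv.Perm (Fin m)) =>
    f (Equiv.Perm.decomposeFin.symm (0, e) * i.cycleRange))]
  symm
  refine Fintype.sum_bijective
    (fun x : Fin (m + 1) × Equiv.Perm (Fin m) =>
      Equiv.Perm.decomposeFin.symm (0, x.2) * x.1.cycleRange) ?_ _ _ (fun _ => rfl)
  rw [Fintype.bijective_iff_injective_and_card]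
  refine ⟨?_, by simp [Fintype.card_perm, Nat.factorial_succ]⟩
  rintro ⟨i, e⟩ ⟨j, e'⟩ h
  simp only at h
  have h1 : ∀ (i : Fin (m + 1)) (e : Equiv.Perm (Fin m)),
      (Equiv.Perm.decomposeFin.symm (0, e) * i.cycleRange) i = 0 := by
    intro i e
    simp [Equiv.Perm.mul_apply]
  have hij : i = j := by
    apply (Equiv.Perm.decomposeFin.symm (0, e) * i.cycleRange).injective
    rw [h1 i e, h, h1 j e']
  subst hij
  have h2 := Equiv.Perm.decomposeFin.symm.injective (mul_right_cancel h)
  simp only [Prod.mk.injEq, true_and] at h2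
  rw [h2]

theorem cons_comp_decomposeFin_mul_cycleRange {α : Type*} {m : ℕ} (u : α) (w : Fin m → α)
    (i : Fin (m + 1)) (e : Equiv.Perm (Fin m)) (j : Fin (m + 1)) :
    (Fin.cons u w : Fin (m + 1) → α) ((Equiv.Perm.decomposeFin.symm (0, e) * i.cycleRange) j) =
      (i.insertNth u (w ∘ e) : Fin (m + 1) → α) j := by
  rw [← Fin.cons_comp_cycleRange, Function.comp_apply, Equiv.Perm.mul_apply]
  generalize i.cycleRange j = k
  cases k using Fin.cases <;> simp

theorem sign_decomposeFin_mul_cycleRange {m : ℕ} (i : Fin (m + 1)) (e : Equiv.Perm (Fin m)) :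
    Equiv.Perm.sign (Equiv.Perm.decomposeFin.symm (0, e) * i.cycleRange) =
      (-1) ^ (i : ℕ) * Equiv.Perm.sign e := by
  simp [mul_comm]

/-! ### The wedge product as a sum over all permutations -/

section WedgeSum

variable {n : ℕ} {W : Type*} [NormedRing W] [NormedAlgebra ℝ W]

/-- The left and the right block of a tuple of vectors. -/
abbrev leftPart {α : Type*} {p q m : ℕ} (h : p + q = m) (w : Fin m → α) : Fin p → α :=
  fun i => w (Fin.cast h (Fin.castAdd q i))

abbrev rightPart {α : Type*} {p q m : ℕ} (h : p + q = m) (w : Fin m → α) : Fin q → α :=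
  fun i => w (Fin.cast h (Fin.natAdd p i))

/-- The antisymmetrised product of two forms, summed over all permutations. -/
def wedgeSum {p q m : ℕ} (a : Alt n p W) (b : Alt n q W) (h : p + q = m) (w : Fin m → Model n) : W :=
  ∑ σ : Equiv.Perm (Fin m), (Equiv.Perm.sign σ : ℤ) •
    (a (leftPart h (w ∘ σ)) * b (rightPart h (w ∘ σ)))

/-- Each shuffle is a coset of S_p × S_q, and its p! q! members contribute equal terms because both
factors alternate. The factor is invertible over ℝ, so identities for `wedge` can be checked on a
sum over permutations, without quotients. -/
theorem wedgeSum_eq {p q m : ℕ} (a : Alt n p W) (b : Alt n q W) (h : p + q = m)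
    (w : Fin m → Model n) :
    wedgeSum a b h w = (p.factorial * q.factorial) • wedge a b h w := by
  subst h
  have key := MultilinearMap.domCoprod_alternization_eq a.toAlternatingMap b.toAlternatingMap
  simp only [Fintype.card_fin] at key
  have key2 := congrArg (fun T => LinearMap.mul' ℝ W (T (w ∘ finSumFinEquiv))) key
  simp only [AlternatingMap.smul_apply, map_nsmul] at key2
  have hw : wedge a b rfl w = LinearMap.mul' ℝ W
      ((a.toAlternatingMap.domCoprod b.toAlternatingMap) (w ∘ finSumFinEquiv)) := rfl
  rw [hw, ← key2, MultilinearMap.alternatization_apply, map_sum]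
  unfold wedgeSum
  refine Fintype.sum_equiv (finSumFinEquiv.permCongr.symm) _ _ fun σ => ?_
  have hs : Equiv.Perm.sign (finSumFinEquiv.permCongr.symm σ) = Equiv.Perm.sign σ := by
    rw [show finSumFinEquiv.permCongr.symm = (finSumFinEquiv (m := p) (n := q)).symm.permCongr from rfl,
      Equiv.Perm.sign_permCongr]
  rw [hs, Units.smul_def, map_zsmul, MultilinearMap.domDomCongr_apply,
    MultilinearMap.domCoprod_apply, LinearMap.mul'_apply]
  simp [Function.comp_def, Equiv.permCongr]
  rfl

/-- The permutations are sorted by the slot i in which u lands. Bringing that slot to the front is a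
cycle of sign (-1)^i, and e permutes the remaining vectors. -/
theorem wedgeSum_cons {p q m : ℕ} (a : Alt n p W) (b : Alt n q W) (h : p + q = m + 1)
    (u : Model n) (w : Fin m → Model n) :
    wedgeSum a b h (Fin.cons u w) = ∑ i : Fin (m + 1), ∑ e : Equiv.Perm (Fin m),
      ((-1) ^ (i : ℕ) * (Equiv.Perm.sign e : ℤ)) •
        (a (leftPart h (i.insertNth u (w ∘ e))) * b (rightPart h (i.insertNth u (w ∘ e)))) := by
  unfold wedgeSum
  rw [sum_perm_succ]
  refine Finset.sum_congr rfl fun i _ => Finset.sum_congr rfl fun e _ => ?_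
  rw [sign_decomposeFin_mul_cycleRange]
  have : (Fin.cons u w : Fin (m + 1) → Model n) ∘
      (Equiv.Perm.decomposeFin.symm (0, e) * i.cycleRange) = i.insertNth u (w ∘ e) :=
    funext fun j => cons_comp_decomposeFin_mul_cycleRange u w i e j
  rw [this]
  simp

/-- A slot belongs either to the first p places or to the last q. This lemma and the next three
record that u enters only the block containing its slot and leaves the other block unchanged. -/
theorem leftPart_insertNth_left {α : Type*} {p q m : ℕ} (h : p + q = m) (h' : p + 1 + q = m + 1)
    (i : Fin (p + 1)) (u : α) (w : Fin m → α) :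
    leftPart h' ((Fin.cast h' (Fin.castAdd q i)).insertNth u w) =
      (i.insertNth u (leftPart h w) : Fin (p + 1) → α) := by
  subst h
  funext j
  cases j using i.succAboveCases with
  | x => simp [leftPart]
  | p j =>
    have : Fin.cast h' (Fin.castAdd q (i.succAbove j)) =
        (Fin.cast h' (Fin.castAdd q i)).succAbove (Fin.castAdd q j) := by
      ext
      simp [Fin.succAbove, Fin.lt_def]
      split_ifs <;> simp
    simp only [leftPart, Fin.insertNth_apply_succAbove]
    rw [this, Fin.insertNth_apply_succAbove]
    rfl

theorem rightPart_insertNth_left {α : Type*} {p q m : ℕ} (h : p + q = m) (h' : p + 1 + q = m + 1)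
    (i : Fin (p + 1)) (u : α) (w : Fin m → α) :
    rightPart h' ((Fin.cast h' (Fin.castAdd q i)).insertNth u w) = rightPart h w := by
  subst h
  funext j
  have : Fin.cast h' (Fin.natAdd (p + 1) j) =
      (Fin.cast h' (Fin.castAdd q i)).succAbove (Fin.natAdd p j) := by
    ext
    have := i.2
    simp [Fin.succAbove, Fin.lt_def]
    split_ifs <;> simp <;> omega
  simp only [rightPart]
  rw [this, Fin.insertNth_apply_succAbove]
  rfl

theorem rightPart_insertNth_right {α : Type*} {p q m : ℕ} (h : p + q = m)
    (h' : p + (q + 1) = m + 1) (i : Fin (q + 1)) (u : α) (w : Fin m → α) :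
    rightPart h' ((Fin.cast h' (Fin.natAdd p i)).insertNth u w) =
      (i.insertNth u (rightPart h w) : Fin (q + 1) → α) := by
  subst h
  funext j
  cases j using i.succAboveCases with
  | x => simp [rightPart]
  | p j =>
    have : Fin.cast h' (Fin.natAdd p (i.succAbove j)) =
        (Fin.cast h' (Fin.natAdd p i)).succAbove (Fin.natAdd p j) := by
      ext
      simp [Fin.succAbove, Fin.lt_def]
      split_ifs <;> simp; omega
    simp only [rightPart, Fin.insertNth_apply_succAbove]
    rw [this, Fin.insertNth_apply_succAbove]
    rfl

theorem leftPart_insertNth_right {α : Type*} {p q m : ℕ} (h : p + q = m)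
    (h' : p + (q + 1) = m + 1) (i : Fin (q + 1)) (u : α) (w : Fin m → α) :
    leftPart h' ((Fin.cast h' (Fin.natAdd p i)).insertNth u w) = leftPart h w := by
  subst h
  funext j
  have : Fin.cast h' (Fin.castAdd (q + 1) j) =
      (Fin.cast h' (Fin.natAdd p i)).succAbove (Fin.castAdd q j) := by
    ext
    have := j.2
    simp [Fin.succAbove, Fin.lt_def]
    split_ifs <;> simp <;> omega
  simp only [leftPart]
  rw [this, Fin.insertNth_apply_succAbove]
  rfl

end WedgeSum


/-! ### Contraction as an antiderivation of the wedge product; bilinearity and naturality -/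

section WedgeContract

variable {n : ℕ} {W : Type*} [NormedRing W] [NormedAlgebra ℝ W]

theorem sum_fin_blocks {M : Type*} [AddCommMonoid M] {p q m : ℕ} (h : p + q = m) (F : Fin m → M) :
    ∑ i, F i = ∑ i : Fin p, F (Fin.cast h (Fin.castAdd q i)) +
      ∑ i : Fin q, F (Fin.cast h (Fin.natAdd p i)) := by
  subst h
  exact Fin.sum_univ_add F

/-- Moving u from slot i to the front of `a` costs a second sign (-1)^i, which cancels the first.
All p + 1 slots therefore contribute the same sum. -/
theorem wedgeSum_left_block {p q m : ℕ} (a : Alt n (p + 1) W) (b : Alt n q W)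
    (h : p + q = m) (h' : p + 1 + q = m + 1) (u : Model n) (w : Fin m → Model n) :
    ∑ i : Fin (p + 1), ∑ e : Equiv.Perm (Fin m),
      ((-1) ^ ((Fin.cast h' (Fin.castAdd q i) : Fin (m + 1)) : ℕ) * (Equiv.Perm.sign e : ℤ)) •
        (a (leftPart h' ((Fin.cast h' (Fin.castAdd q i)).insertNth u (w ∘ e))) *
          b (rightPart h' ((Fin.cast h' (Fin.castAdd q i)).insertNth u (w ∘ e)))) =
      (p + 1) • wedgeSum (a.curryLeft u) b h w := by
  rw [← Fin.sum_const, wedgeSum]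
  refine Finset.sum_congr rfl fun i _ => Finset.sum_congr rfl fun e _ => ?_
  rw [leftPart_insertNth_left h h', rightPart_insertNth_left h h',
    ContinuousAlternatingMap.map_insertNth, smul_mul_assoc, smul_smul, mul_right_comm]
  simp [← pow_add, ← two_mul]

/-- Slot i of the right block is slot p + i of the whole tuple. Moving u to the front of `b` cancels
only (-1)^i, and the sign (-1)^p of passing over the left block survives. -/
theorem wedgeSum_right_block {p q m : ℕ} (a : Alt n p W) (b : Alt n (q + 1) W)
    (h : p + q = m) (h' : p + (q + 1) = m + 1) (u : Model n) (w : Fin m → Model n) :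
    ∑ i : Fin (q + 1), ∑ e : Equiv.Perm (Fin m),
      ((-1) ^ ((Fin.cast h' (Fin.natAdd p i) : Fin (m + 1)) : ℕ) * (Equiv.Perm.sign e : ℤ)) •
        (a (leftPart h' ((Fin.cast h' (Fin.natAdd p i)).insertNth u (w ∘ e))) *
          b (rightPart h' ((Fin.cast h' (Fin.natAdd p i)).insertNth u (w ∘ e)))) =
      (q + 1) • ((-1 : ℤ) ^ p • wedgeSum a (b.curryLeft u) h w) := by
  rw [← Fin.sum_const, wedgeSum, Finset.smul_sum]
  refine Finset.sum_congr rfl fun i _ => Finset.sum_congr rfl fun e _ => ?_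
  rw [rightPart_insertNth_right h h', leftPart_insertNth_right h h',
    ContinuousAlternatingMap.map_insertNth, mul_smul_comm, smul_smul, smul_smul, mul_right_comm]
  congr 1
  have : (-1 : ℤ) ^ (i : ℕ) * (-1) ^ (i : ℕ) = 1 := by simp [← pow_add, ← two_mul]
  simp only [Fin.val_cast, Fin.val_natAdd, pow_add]
  linear_combination ((-1 : ℤ) ^ p * (Equiv.Perm.sign e : ℤ)) * this

/-- The vector u goes either into `a` or into `b`, and the factors p + 1 and q + 1 of the two blocks
are absorbed by the factorials. When one factor has degree zero the corresponding term is absent;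
the next two lemmas treat these cases. -/
theorem curryLeft_wedge_succ_succ {p q m : ℕ} (a : Alt n (p + 1) W) (b : Alt n (q + 1) W)
    (h : p + 1 + (q + 1) = m + 1) (h₁ : p + (q + 1) = m) (h₂ : p + 1 + q = m) (u : Model n) :
    (wedge a b h).curryLeft u =
      wedge (a.curryLeft u) b h₁ + (-1 : ℤ) ^ (p + 1) • wedge a (b.curryLeft u) h₂ := by
  ext w
  have key : wedgeSum a b h (Fin.cons u w) = _ :=
    (wedgeSum_cons a b h u w).trans (sum_fin_blocks h _)
  rw [wedgeSum_left_block a b h₁ h, wedgeSum_right_block a b h₂ h, wedgeSum_eq, wedgeSum_eq,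
    wedgeSum_eq] at key
  have hne : (((p + 1).factorial * (q + 1).factorial : ℕ) : ℝ) ≠ 0 := by positivity
  apply smul_right_injective W hne
  simp only [ContinuousAlternatingMap.curryLeft_apply_apply, ContinuousAlternatingMap.add_apply,
    ContinuousAlternatingMap.smul_apply]
  simp only [Nat.cast_smul_eq_nsmul]
  refine key.trans ?_
  rw [smul_add, Nat.factorial_succ p, Nat.factorial_succ q]
  congr 1
  · rw [smul_smul]; congr 1; ring
  · rw [smul_comm ((-1 : ℤ) ^ (p + 1)), smul_smul]; congr 1; ring

theorem curryLeft_wedge_zero_right {p m : ℕ} (a : Alt n (p + 1) W) (b : Alt n 0 W)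
    (h : p + 1 + 0 = m + 1) (h₁ : p + 0 = m) (u : Model n) :
    (wedge a b h).curryLeft u = wedge (a.curryLeft u) b h₁ := by
  ext w
  have key : wedgeSum a b h (Fin.cons u w) = _ :=
    (wedgeSum_cons a b h u w).trans (sum_fin_blocks h _)
  rw [wedgeSum_left_block a b h₁ h, wedgeSum_eq, wedgeSum_eq, Finset.univ_eq_empty,
    Finset.sum_empty, add_zero] at key
  have hne : (((p + 1).factorial * (0).factorial : ℕ) : ℝ) ≠ 0 := by positivity
  apply smul_right_injective W hne
  simp only [ContinuousAlternatingMap.curryLeft_apply_apply, Nat.cast_smul_eq_nsmul]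
  refine key.trans ?_
  rw [Nat.factorial_succ p, smul_smul]; congr 1; ring

theorem curryLeft_wedge_zero_left {q m : ℕ} (a : Alt n 0 W) (b : Alt n (q + 1) W)
    (h : 0 + (q + 1) = m + 1) (h₂ : 0 + q = m) (u : Model n) :
    (wedge a b h).curryLeft u = wedge a (b.curryLeft u) h₂ := by
  ext w
  have key : wedgeSum a b h (Fin.cons u w) = _ :=
    (wedgeSum_cons a b h u w).trans (sum_fin_blocks h _)
  rw [wedgeSum_right_block a b h₂ h, wedgeSum_eq, wedgeSum_eq, Finset.univ_eq_empty,
    Finset.sum_empty, zero_add] at key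
  have hne : (((0).factorial * (q + 1).factorial : ℕ) : ℝ) ≠ 0 := by positivity
  apply smul_right_injective W hne
  simp only [ContinuousAlternatingMap.curryLeft_apply_apply, Nat.cast_smul_eq_nsmul]
  refine key.trans ?_
  rw [Nat.factorial_succ q, pow_zero, one_smul, smul_smul]; congr 1; ring

theorem wedge_zero_zero (a b : Alt n 0 W) (h : 0 + 0 = 0) (v : Fin 0 → Model n) :
    wedge a b h v = a v * b v := by
  have key := wedgeSum_eq a b h v
  simp only [wedgeSum, Nat.factorial, mul_one, one_smul] at key
  rw [← key]
  simp [Subsingleton.elim (leftPart h _) v, Subsingleton.elim (rightPart h _) v]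

theorem wedge_add_left {p q m : ℕ} (a a' : Alt n p W) (b : Alt n q W) (h : p + q = m) :
    wedge (a + a') b h = wedge a b h + wedge a' b h := by
  ext w
  have hne : ((p.factorial * q.factorial : ℕ) : ℝ) ≠ 0 := by positivity
  apply smul_right_injective W hne
  simp only [ContinuousAlternatingMap.add_apply, Nat.cast_smul_eq_nsmul, smul_add, ← wedgeSum_eq]
  simp [wedgeSum, add_mul, Finset.sum_add_distrib]

theorem wedge_add_right {p q m : ℕ} (a : Alt n p W) (b b' : Alt n q W) (h : p + q = m) :
    wedge a (b + b') h = wedge a b h + wedge a b' h := by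
  ext w
  have hne : ((p.factorial * q.factorial : ℕ) : ℝ) ≠ 0 := by positivity
  apply smul_right_injective W hne
  simp only [ContinuousAlternatingMap.add_apply, Nat.cast_smul_eq_nsmul, smul_add, ← wedgeSum_eq]
  simp [wedgeSum, Finset.sum_add_distrib, mul_add]

section Smul

variable {S : Type*} [Monoid S] [DistribMulAction S W] [ContinuousConstSMul S W]
  [SMulCommClass ℝ S W]

theorem wedge_smul_left [IsScalarTower S W W] {p q m : ℕ} (c : S) (a : Alt n p W) (b : Alt n q W)
    (h : p + q = m) : wedge (c • a) b h = c • wedge a b h := by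
  ext w
  have hne : ((p.factorial * q.factorial : ℕ) : ℝ) ≠ 0 := by positivity
  apply smul_right_injective W hne
  simp only [ContinuousAlternatingMap.smul_apply]
  rw [smul_comm]
  simp only [Nat.cast_smul_eq_nsmul, ← wedgeSum_eq]
  simp only [wedgeSum, ContinuousAlternatingMap.smul_apply, smul_mul_assoc, Finset.smul_sum]
  refine Finset.sum_congr rfl fun σ _ => smul_comm _ _ _

theorem wedge_smul_right [SMulCommClass S W W] {p q m : ℕ} (c : S) (a : Alt n p W) (b : Alt n q W)
    (h : p + q = m) : wedge a (c • b) h = c • wedge a b h := by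
  ext w
  have hne : ((p.factorial * q.factorial : ℕ) : ℝ) ≠ 0 := by positivity
  apply smul_right_injective W hne
  simp only [ContinuousAlternatingMap.smul_apply]
  rw [smul_comm]
  simp only [Nat.cast_smul_eq_nsmul, ← wedgeSum_eq]
  simp only [wedgeSum, ContinuousAlternatingMap.smul_apply, mul_smul_comm, Finset.smul_sum]
  refine Finset.sum_congr rfl fun σ _ => smul_comm _ _ _

end Smul

theorem wedge_compContinuousLinearMap {p q m : ℕ} (a : Alt n p W) (b : Alt n q W) (h : p + q = m)
    (L : Model n →L[ℝ] Model n) :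
    (wedge a b h).compContinuousLinearMap L =
      wedge (a.compContinuousLinearMap L) (b.compContinuousLinearMap L) h := by
  ext w
  have hne : ((p.factorial * q.factorial : ℕ) : ℝ) ≠ 0 := by positivity
  apply smul_right_injective W hne
  simp only [ContinuousAlternatingMap.compContinuousLinearMap_apply, Nat.cast_smul_eq_nsmul,
    ← wedgeSum_eq]
  rfl

end WedgeContract


/-! ### The graded ring of inhomogeneous forms -/

namespace Forms

variable {n : ℕ}

section Module

variable {W : Type*} [NormedAddCommGroup W] [NormedSpace ℝ W]

instance : AddCommGroup (Forms n W) := Pi.addCommGroup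
instance : AddCommMonoid (Forms n W) := Pi.addCommMonoid
instance : Add (Forms n W) := Pi.instAdd
instance : Zero (Forms n W) := Pi.instZero
instance : Neg (Forms n W) := Pi.instNeg
instance : Sub (Forms n W) := Pi.instSub
instance : Module ℝ (Forms n W) := Pi.module _ _ _

/-- Contraction of an inhomogeneous form with a vector. -/
def contract (u : Model n) : Forms n W →ₗ[ℝ] Forms n W where
  toFun a := fun k => (a (k + 1)).curryLeft u
  map_add' _ _ := rfl
  map_smul' _ _ := rfl

theorem contract_apply (u : Model n) (a : Forms n W) (k : ℕ) :
    contract u a k = (a (k + 1)).curryLeft u := rfl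

/-- The grading involution, `(-1)ᵏ` on forms of degree `k`. -/
def sgn : Forms n W →ₗ[ℝ] Forms n W where
  toFun a := fun k => (-1 : ℤ) ^ k • a k
  map_add' a b := by funext k; exact smul_add _ _ _
  map_smul' c a := by funext k; exact smul_comm ((-1 : ℤ) ^ k) c (a k)

theorem sgn_apply (a : Forms n W) (k : ℕ) : sgn a k = (-1 : ℤ) ^ k • a k := rfl

@[simp] theorem sgn_sgn (a : Forms n W) : sgn (sgn a) = a := by
  funext k
  rw [sgn_apply, sgn_apply, smul_smul, ← pow_add, ← two_mul, pow_mul]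
  simp

theorem contract_sgn (u : Model n) (a : Forms n W) : contract u (sgn a) = -sgn (contract u a) := by
  funext k
  change ((-1 : ℤ) ^ (k + 1) • a (k + 1)).curryLeft u = -((-1 : ℤ) ^ k • (a (k + 1)).curryLeft u)
  ext v
  simp [pow_succ]

theorem apply_succ (a : Forms n W) (k : ℕ) (v : Fin (k + 1) → Model n) :
    a (k + 1) v = contract (v 0) a k (Fin.tail v) := by
  change _ = a (k + 1) (Fin.cons (v 0) (Fin.tail v))
  rw [Fin.cons_self_tail]

/-- Every argument tuple of positive length has a first vector. With a check in degree zero, this is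
the induction principle behind the identities for inhomogeneous forms. -/
theorem ext_contract {a b : Forms n W} {k : ℕ} (h : ∀ u, contract u a k = contract u b k) :
    a (k + 1) = b (k + 1) := by
  ext v
  rw [apply_succ, apply_succ, h]

/-- A constant as a form of degree zero. -/
def ofConst (n : ℕ) (w : W) : Forms n W :=
  Pi.single 0 (ContinuousAlternatingMap.constOfIsEmpty ℝ (Model n) (Fin 0) w)

@[simp] theorem contract_ofConst (u : Model n) (w : W) : contract u (ofConst n w) = 0 := by
  funext k
  rw [contract_apply, ofConst, Pi.single_eq_of_ne (by omega)]
  rfl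

@[simp] theorem sgn_ofConst (w : W) : sgn (ofConst n w) = ofConst n w := by
  funext k
  rw [sgn_apply]
  cases k with
  | zero => simp
  | succ k => rw [ofConst, Pi.single_eq_of_ne (by omega), smul_zero]

/-- A homogeneous form as an inhomogeneous form. -/
abbrev ofDeg (k : ℕ) (a : Alt n k W) : Forms n W := Pi.single k a

@[simp] theorem ofDeg_same (k : ℕ) (a : Alt n k W) : ofDeg k a k = a := Pi.single_eq_same _ _

theorem ofDeg_of_ne {j k : ℕ} (h : j ≠ k) (a : Alt n k W) : ofDeg k a j = 0 :=
  Pi.single_eq_of_ne h _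

theorem sgn_ofDeg (k : ℕ) (a : Alt n k W) : sgn (ofDeg k a) = (-1 : ℤ) ^ k • ofDeg k a := by
  funext j
  rw [sgn_apply]
  by_cases h : j = k
  · subst h; simp
  · simp [ofDeg_of_ne h]

theorem contract_ofDeg_succ (u : Model n) (k : ℕ) (a : Alt n (k + 1) W) :
    contract u (ofDeg (k + 1) a) = ofDeg k (a.curryLeft u) := by
  funext j
  rw [contract_apply]
  by_cases h : j = k
  · subst h; simp
  · rw [ofDeg_of_ne h, ofDeg_of_ne (by omega)]; rfl

theorem contract_ofDeg_one (u : Model n) (a : Alt n 1 W) :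
    contract u (ofDeg 1 a) = ofConst n (a fun _ => u) := by
  rw [contract_ofDeg_succ, ofConst, ofDeg]
  congr 1
  ext v
  rw [ContinuousAlternatingMap.curryLeft_apply_apply]
  simp only [ContinuousAlternatingMap.constOfIsEmpty]
  change a _ = a _
  congr 1
  funext i
  rw [Subsingleton.elim i 0]; rfl

end Module

section Mul

variable {W : Type*} [NormedRing W] [NormedAlgebra ℝ W]

/-- `wedge` with the degree condition checked inside. -/
def wedgeD {p q : ℕ} (m : ℕ) (a : Alt n p W) (b : Alt n q W) : Alt n m W :=
  if h : p + q = m then wedge a b h else 0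

theorem mul_eq_sum (a b : Forms n W) (m : ℕ) :
    Forms.mul a b m = ∑ pq ∈ Finset.HasAntidiagonal.antidiagonal m, wedgeD m (a pq.1) (b pq.2) := by
  rw [← Finset.sum_attach]
  refine Finset.sum_congr rfl fun pq _ => ?_
  rw [wedgeD, dif_pos]

theorem mul_zero_apply (a b : Forms n W) (v : Fin 0 → Model n) :
    Forms.mul a b 0 v = a 0 v * b 0 v := by
  rw [mul_eq_sum]
  simp [wedgeD, wedge_zero_zero]

/-- Summation of the antiderivation rule over all bidegrees, with `sgn` collecting the signs (-1)^p.
At the two ends of the antidiagonal a factor has degree zero and only one of the two terms occurs.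
-/
theorem contract_mul' (u : Model n) (a b : Forms n W) :
    contract u (Forms.mul a b) =
      Forms.mul (contract u a) b + Forms.mul (sgn a) (contract u b) := by
  funext m
  have hc : ∀ p q, p + 1 + (q + 1) = m + 1 →
      (wedgeD (m + 1) (a (p + 1)) (b (q + 1))).curryLeft u =
        wedgeD m (contract u a p) (b (q + 1)) +
          wedgeD m (sgn a (p + 1)) (contract u b q) := by
    intro p q h
    simp only [wedgeD]
    rw [dif_pos h, dif_pos (by omega), dif_pos (by omega),
      curryLeft_wedge_succ_succ _ _ h (by omega) (by omega), sgn_apply, wedge_smul_left]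
    rfl
  have h0 : (wedgeD (m + 1) (a 0) (b (m + 1))).curryLeft u =
      wedgeD m (sgn a 0) (contract u b m) := by
    simp only [wedgeD]
    rw [dif_pos (show 0 + (m + 1) = m + 1 by omega), dif_pos (show 0 + m = m by omega),
      curryLeft_wedge_zero_left (a 0) (b (m + 1)) _ (by omega : 0 + m = m),
      sgn_apply, pow_zero, one_smul]
    rfl
  have h1 : (wedgeD (m + 1) (a (m + 1)) (b 0)).curryLeft u =
      wedgeD m (contract u a m) (b 0) := by
    rw [wedgeD, wedgeD]
    rw [dif_pos (show m + 1 + 0 = m + 1 by omega), dif_pos (show m + 0 = m by omega),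
      curryLeft_wedge_zero_right (a (m + 1)) (b 0) _ (by omega : m + 0 = m)]
    rfl
  have hsum : contract u (Forms.mul a b) m =
      ∑ pq ∈ Finset.HasAntidiagonal.antidiagonal (m + 1),
        (wedgeD (m + 1) (a pq.1) (b pq.2)).curryLeft u := by
    rw [contract_apply, mul_eq_sum]
    ext v
    simp [ContinuousAlternatingMap.sum_apply]
  rw [hsum, Pi.add_apply, mul_eq_sum, mul_eq_sum, Finset.Nat.sum_antidiagonal_succ]
  simp only [h0]
  cases m with
  | zero => simp only [Finset.Nat.antidiagonal_zero, Finset.sum_singleton]; rw [h1, add_comm]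
  | succ m =>
    rw [Finset.Nat.sum_antidiagonal_succ', Finset.Nat.sum_antidiagonal_succ', h1,
      Finset.Nat.sum_antidiagonal_succ]
    rw [Finset.sum_congr rfl fun pq hpq => hc pq.1 pq.2
      (by rw [Finset.HasAntidiagonal.mem_antidiagonal] at hpq; omega), Finset.sum_add_distrib]
    abel

theorem sgn_mul' (a b : Forms n W) : sgn (Forms.mul a b) = Forms.mul (sgn a) (sgn b) := by
  funext m
  rw [sgn_apply, mul_eq_sum, mul_eq_sum, Finset.smul_sum]
  refine Finset.sum_congr rfl fun pq h => ?_
  rw [Finset.HasAntidiagonal.mem_antidiagonal] at h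
  rw [wedgeD, wedgeD, dif_pos h, dif_pos h, sgn_apply, sgn_apply, wedge_smul_left,
    wedge_smul_right, smul_smul, ← pow_add, h]

theorem add_mul' (a b c : Forms n W) :
    Forms.mul (a + b) c = Forms.mul a c + Forms.mul b c := by
  funext m
  rw [Pi.add_apply, mul_eq_sum, mul_eq_sum, mul_eq_sum, ← Finset.sum_add_distrib]
  refine Finset.sum_congr rfl fun pq h => ?_
  rw [Finset.HasAntidiagonal.mem_antidiagonal] at h
  simp only [wedgeD, dif_pos h, Pi.add_apply, wedge_add_left]

theorem mul_add' (a b c : Forms n W) :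
    Forms.mul a (b + c) = Forms.mul a b + Forms.mul a c := by
  funext m
  rw [Pi.add_apply, mul_eq_sum, mul_eq_sum, mul_eq_sum, ← Finset.sum_add_distrib]
  refine Finset.sum_congr rfl fun pq h => ?_
  rw [Finset.HasAntidiagonal.mem_antidiagonal] at h
  simp only [wedgeD, dif_pos h, Pi.add_apply, wedge_add_right]

theorem zero_mul' (a : Forms n W) : Forms.mul 0 a = 0 := by
  have := add_mul' 0 0 a
  rw [add_zero] at this
  exact left_eq_add.1 this

theorem mul_zero' (a : Forms n W) : Forms.mul a 0 = 0 := by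
  have := mul_add' a 0 0
  rw [add_zero] at this
  exact left_eq_add.1 this

/-- In degree zero this is associativity of the algebra. In higher degree, both sides contract to
the same three triple products of lower degree, so no combinatorics of threefold shuffles is needed.
-/
theorem mul_assoc' (a b c : Forms n W) :
    Forms.mul (Forms.mul a b) c = Forms.mul a (Forms.mul b c) := by
  funext k
  induction k generalizing a b c with
  | zero =>
    ext v
    simp only [mul_zero_apply, mul_assoc]
  | succ k ih =>
    refine ext_contract fun u => ?_
    simp only [contract_mul', sgn_mul', add_mul', mul_add', Pi.add_apply, ih, add_assoc]

theorem ofConst_mul' (w : W) (a : Forms n W) (k : ℕ) (v : Fin k → Model n) :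
    Forms.mul (ofConst n w) a k v = w * a k v := by
  induction k generalizing a with
  | zero =>
    rw [mul_zero_apply, ofConst, Pi.single_eq_same]; rfl
  | succ k ih =>
    rw [apply_succ, apply_succ a, contract_mul', contract_ofConst, zero_mul', zero_add,
      sgn_ofConst, ih]

theorem mul_ofConst' (w : W) (a : Forms n W) (k : ℕ) (v : Fin k → Model n) :
    Forms.mul a (ofConst n w) k v = a k v * w := by
  induction k generalizing a with
  | zero =>
    rw [mul_zero_apply, ofConst, Pi.single_eq_same]; rfl
  | succ k ih =>
    rw [apply_succ, apply_succ a, contract_mul', contract_ofConst, mul_zero', add_zero, ih]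

/-- Inhomogeneous forms with values in an algebra are a ring under the wedge product. -/
instance instRing : Ring (Forms n W) :=
  { (inferInstance : AddCommGroup (Forms n W)) with
    mul := Forms.mul
    one := Forms.one
    mul_assoc := mul_assoc'
    left_distrib := mul_add'
    right_distrib := add_mul'
    zero_mul := zero_mul'
    mul_zero := mul_zero'
    one_mul := fun a => by
      funext k; ext v; exact (ofConst_mul' 1 a k v).trans (one_mul _)
    mul_one := fun a => by
      funext k; ext v; exact (mul_ofConst' 1 a k v).trans (mul_one _) }

instance : Mul (Forms n W) := instRing.toMul
instance : One (Forms n W) := instRing.toOne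
instance : Monoid (Forms n W) := instRing.toMonoid
instance : Semiring (Forms n W) := instRing.toSemiring
instance : NonUnitalNonAssocSemiring (Forms n W) :=
  instRing.toSemiring.toNonAssocSemiring.toNonUnitalNonAssocSemiring
instance : NonAssocSemiring (Forms n W) := instRing.toSemiring.toNonAssocSemiring
instance : Distrib (Forms n W) := instRing.toDistrib

theorem mul_def (a b : Forms n W) : Forms.mul a b = a * b := rfl

theorem one_def : (Forms.one : Forms n W) = 1 := rfl

theorem pow_def (a : Forms n W) (k : ℕ) : Forms.pow a k = a ^ k := by
  induction k with
  | zero => exact (pow_zero a).symm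
  | succ k ih => rw [pow_succ, ← ih]; rfl

theorem mul_apply_zero (a b : Forms n W) (v : Fin 0 → Model n) :
    (a * b) 0 v = a 0 v * b 0 v := mul_zero_apply a b v

theorem contract_mul (u : Model n) (a b : Forms n W) :
    contract u (a * b) = contract u a * b + sgn a * contract u b := contract_mul' u a b

@[simp] theorem sgn_mul (a b : Forms n W) : sgn (a * b) = sgn a * sgn b := sgn_mul' a b

@[simp] theorem sgn_one : sgn (1 : Forms n W) = 1 := sgn_ofConst 1

@[simp] theorem sgn_pow (a : Forms n W) (k : ℕ) : sgn (a ^ k) = sgn a ^ k := by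
  induction k with
  | zero => simp
  | succ k ih => rw [pow_succ, pow_succ, sgn_mul, ih]

@[simp] theorem ofConst_mul_apply (w : W) (a : Forms n W) (k : ℕ) (v : Fin k → Model n) :
    (ofConst n w * a) k v = w * a k v := ofConst_mul' w a k v

@[simp] theorem mul_ofConst_apply (w : W) (a : Forms n W) (k : ℕ) (v : Fin k → Model n) :
    (a * ofConst n w) k v = a k v * w := mul_ofConst' w a k v

section Smul

variable {S : Type*} [Monoid S] [DistribMulAction S W] [ContinuousConstSMul S W]
  [SMulCommClass ℝ S W]

instance instIsScalarTower [IsScalarTower S W W] : IsScalarTower S (Forms n W) (Forms n W) where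
  smul_assoc c a b := by
    funext m
    change Forms.mul (c • a) b m = c • Forms.mul a b m
    rw [mul_eq_sum, mul_eq_sum, Finset.smul_sum]
    refine Finset.sum_congr rfl fun pq h => ?_
    rw [Finset.HasAntidiagonal.mem_antidiagonal] at h
    simp only [wedgeD, dif_pos h, Pi.smul_apply, wedge_smul_left]

instance instSMulCommClass [SMulCommClass S W W] : SMulCommClass S (Forms n W) (Forms n W) where
  smul_comm c a b := by
    funext m
    change c • Forms.mul a b m = Forms.mul a (c • b) m
    rw [mul_eq_sum, mul_eq_sum, Finset.smul_sum]
    refine Finset.sum_congr rfl fun pq h => ?_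
    rw [Finset.HasAntidiagonal.mem_antidiagonal] at h
    simp only [wedgeD, dif_pos h, Pi.smul_apply, wedge_smul_right]

end Smul

/-! ### Maps of coefficients and of arguments -/

/-- Pullback of forms under a linear map. -/
def pull (L : Model n →L[ℝ] Model n) : Forms n W →+* Forms n W where
  toFun a := fun k => (a k).compContinuousLinearMap L
  map_zero' := by funext k; rfl
  map_add' _ _ := by funext k; rfl
  map_one' := by
    funext k
    cases k with
    | zero => rfl
    | succ k =>
      change ((ofConst n (1 : W)) (k + 1)).compContinuousLinearMap L = (ofConst n (1 : W)) (k + 1)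
      rw [ofConst, Pi.single_eq_of_ne (by omega)]; rfl
  map_mul' a b := by
    funext m
    change (Forms.mul a b m).compContinuousLinearMap L = Forms.mul _ _ m
    rw [mul_eq_sum, mul_eq_sum]
    have : ∀ (s : Finset (ℕ × ℕ)) (F : ℕ × ℕ → Alt n m W),
        (∑ i ∈ s, F i).compContinuousLinearMap L = ∑ i ∈ s, (F i).compContinuousLinearMap L :=
      fun s F => map_sum (ContinuousAlternatingMap.compContinuousLinearMapₗ L) F s
    rw [this]
    refine Finset.sum_congr rfl fun pq h => ?_
    rw [Finset.HasAntidiagonal.mem_antidiagonal] at h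
    simp only [wedgeD, dif_pos h, wedge_compContinuousLinearMap]

end Mul

end Forms

namespace Forms

variable {n : ℕ}

section Map

variable {W V : Type*} [NormedRing W] [NormedAlgebra ℝ W] [NormedAddCommGroup V] [NormedSpace ℝ V]

/-- Application of a linear map to the values of a form. -/
def mapL {W : Type*} [NormedAddCommGroup W] [NormedSpace ℝ W] (f : W →L[ℝ] V) :
    Forms n W →ₗ[ℝ] Forms n V where
  toFun a := fun k => f.compContinuousAlternatingMap (a k)
  map_add' a b := by
    funext k; ext v; exact map_add f _ _
  map_smul' c a := by
    funext k; ext v; exact map_smul f _ _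

@[simp] theorem mapL_apply {W : Type*} [NormedAddCommGroup W] [NormedSpace ℝ W] (f : W →L[ℝ] V)
    (a : Forms n W) (k : ℕ) (v : Fin k → Model n) : mapL f a k v = f (a k v) := rfl

/-- Graded commutation with a one-form, after application of a map under which the coefficients
commute. -/
theorem mapL_ofDeg_one_mul (f : W →L[ℝ] V) {S : Set W} (hS : ∀ w, ∀ z ∈ S, f (w * z) = f (z * w))
    (α : Alt n 1 W) (η : Forms n W) (hη : ∀ k v, η k v ∈ S) :
    mapL f (ofDeg 1 α * η) = mapL f (sgn η * ofDeg 1 α) := by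
  funext k
  ext v
  rw [mapL_apply, mapL_apply]
  induction k generalizing η with
  | zero =>
    rw [mul_apply_zero, mul_apply_zero, ofDeg_of_ne (by omega)]
    simp
  | succ k ih =>
    rw [apply_succ, apply_succ (sgn η * _), contract_mul, contract_mul, contract_sgn, sgn_sgn,
      contract_ofDeg_one, sgn_ofDeg]
    -- The values of a contraction of η are again values of η, so they stay in S and the induction
    -- hypothesis applies.
    have h1 := ih (contract (v 0) η) (fun k v' => hη _ _) (Fin.tail v)
    have h2 := hS (α fun _ => v 0) (η k (Fin.tail v)) (hη _ _)
    simp only [pow_one, neg_one_smul, neg_mul, Pi.add_apply, Pi.neg_apply,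
      ContinuousAlternatingMap.add_apply, ContinuousAlternatingMap.neg_apply, map_add, map_neg,
      ofConst_mul_apply, mul_ofConst_apply, h1, h2]
    abel

theorem mapL_ofConst_mul (f : W →L[ℝ] V) (hf : ∀ w z, f (w * z) = f (z * w)) (w : W)
    (η : Forms n W) : mapL f (ofConst n w * η) = mapL f (η * ofConst n w) := by
  funext k
  ext v
  simp [hf]

/-- A form with central values commutes with one-forms in the graded sense. -/
theorem ofDeg_one_mul_of_central (α : Alt n 1 W) (η : Forms n W)
    (hη : ∀ k v w, w * η k v = η k v * w) : ofDeg 1 α * η = sgn η * ofDeg 1 α :=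
  mapL_ofDeg_one_mul (ContinuousLinearMap.id ℝ W) (S := {z | ∀ w, w * z = z * w})
    (fun w _ hz => hz w) α η (fun k v w => hη k v w)

theorem ofConst_mul_of_central (w : W) (η : Forms n W)
    (hη : ∀ k v w, w * η k v = η k v * w) : ofConst n w * η = η * ofConst n w := by
  funext k
  ext v
  simp [hη]

end Map

/-! ### Antisymmetrisation -/

section Alt

variable {W : Type*} [NormedAddCommGroup W] [NormedSpace ℝ W]

/-- The antisymmetrisation of a linear family of forms (the symbol of the exterior derivative). -/
def alt : (Model n →ₗ[ℝ] Forms n W) →ₗ[ℝ] Forms n W where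
  toFun L := fun k => match k with
    | 0 => 0
    | k + 1 => ContinuousAlternatingMap.alternatizeUncurryFin
        (LinearMap.toContinuousLinearMap ((LinearMap.proj k).comp L))
  map_add' L M := by
    funext k
    cases k with
    | zero => exact (add_zero _).symm
    | succ k =>
      simp only [Pi.add_apply, LinearMap.comp_add, map_add,
        ContinuousAlternatingMap.alternatizeUncurryFin_add]
  map_smul' c L := by
    funext k
    cases k with
    | zero => exact (smul_zero c).symm
    | succ k =>
      simp only [Pi.smul_apply, LinearMap.comp_smul, map_smul, RingHom.id_apply,
        ContinuousAlternatingMap.alternatizeUncurryFin_smul]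

@[simp] theorem alt_zero_apply (L : Model n →ₗ[ℝ] Forms n W) : alt L 0 = 0 := rfl

theorem alt_succ_apply (L : Model n →ₗ[ℝ] Forms n W) (k : ℕ) (v : Fin (k + 1) → Model n) :
    alt L (k + 1) v = ∑ i : Fin (k + 1), (-1 : ℤ) ^ (i : ℕ) • L (v i) k (i.removeNth v) := by
  change ContinuousAlternatingMap.alternatizeUncurryFin _ v = _
  rw [ContinuousAlternatingMap.alternatizeUncurryFin_apply]
  rfl

/-- The summand with index 0 is L u; in the others u remains the first argument while the index
drops by one, which changes the sign. This is the algebraic form of ι_u d + d ι_u = ∂_u for constant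
u. -/
theorem contract_alt (u : Model n) (L : Model n →ₗ[ℝ] Forms n W) :
    contract u (alt L) = L u - alt ((contract u).comp L) := by
  funext k
  ext v
  have h : contract u (alt L) k v = alt L (k + 1) (Fin.cons u v) := rfl
  rw [h, alt_succ_apply, Fin.sum_univ_succ, Pi.sub_apply, ContinuousAlternatingMap.sub_apply,
    sub_eq_add_neg]
  congr 1
  · simp
  · cases k with
    | zero => simp
    | succ k =>
      rw [alt_succ_apply, ← Finset.sum_neg_distrib]
      refine Finset.sum_congr rfl fun i _ => ?_
      have : i.succ.removeNth (Fin.cons u v : Fin (k + 2) → Model n) =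
          (Fin.cons u (i.removeNth v) : Fin (k + 1) → Model n) := by
        funext j
        cases j using Fin.cases <;> simp [Fin.removeNth]
      rw [this, Fin.cons_succ, Fin.val_succ, pow_succ, mul_neg_one, neg_smul]
      rfl

theorem sgn_alt (L : Model n →ₗ[ℝ] Forms n W) : sgn (alt L) = -alt (sgn.comp L) := by
  funext k
  cases k with
  | zero => simp [sgn_apply]
  | succ k =>
    ext v
    rw [sgn_apply, ContinuousAlternatingMap.smul_apply, alt_succ_apply, Pi.neg_apply,
      ContinuousAlternatingMap.neg_apply, alt_succ_apply, Finset.smul_sum,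
      ← Finset.sum_neg_distrib]
    refine Finset.sum_congr rfl fun i _ => ?_
    rw [LinearMap.comp_apply, sgn_apply, ContinuousAlternatingMap.smul_apply, smul_smul, smul_smul,
      ← neg_smul]
    congr 1
    ring

end Alt

/-! ### The Leibniz rule at the level of symbols -/

section AltMul

variable {W : Type*} [NormedRing W] [NormedAlgebra ℝ W]

/-- Multiplication by a form on the right, as a linear map. -/
def mulRightL (b : Forms n W) : Forms n W →ₗ[ℝ] Forms n W where
  toFun a := a * b
  map_add' x y := add_mul x y b
  map_smul' c x := smul_mul_assoc c x b

/-- Multiplication by a form on the left, as a linear map. -/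
def mulLeftL (a : Forms n W) : Forms n W →ₗ[ℝ] Forms n W where
  toFun b := a * b
  map_add' x y := mul_add a x y
  map_smul' c x := mul_smul_comm c a x

/-- Both sides obey the same recursion under contraction, so induction on the degree applies. This
is the part of the Leibniz rule in which the derivative falls on the left factor. -/
theorem alt_mulRight (L : Model n →ₗ[ℝ] Forms n W) (b : Forms n W) :
    alt ((mulRightL b).comp L) = alt L * b := by
  funext k
  induction k generalizing L b with
  | zero => ext v; rw [mul_apply_zero]; simp
  | succ k ih =>
    refine ext_contract fun u => ?_
    have h : (contract u).comp ((mulRightL b).comp L) =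
        (mulRightL b).comp ((contract u).comp L) + (mulRightL (contract u b)).comp (sgn.comp L) := by
      ext1 v
      exact contract_mul u (L v) b
    rw [contract_alt, contract_mul, h, map_add, contract_alt, sgn_alt, sub_mul, neg_mul]
    simp only [Pi.sub_apply, Pi.add_apply, Pi.neg_apply, ih]
    simp only [LinearMap.comp_apply, mulRightL, LinearMap.coe_mk, AddHom.coe_mk]
    abel

/-- The companion for a derivative falling on the right factor: the one-form slot created by `alt`
has to pass `a`, whence `sgn a`. -/
theorem alt_mulLeft (a : Forms n W) (M : Model n →ₗ[ℝ] Forms n W) :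
    alt ((mulLeftL a).comp M) = sgn a * alt M := by
  funext k
  induction k generalizing a M with
  | zero => ext v; rw [mul_apply_zero]; simp
  | succ k ih =>
    refine ext_contract fun u => ?_
    have h : (contract u).comp ((mulLeftL a).comp M) =
        (mulLeftL (contract u a)).comp M + (mulLeftL (sgn a)).comp ((contract u).comp M) := by
      ext1 v
      exact contract_mul u a (M v)
    rw [contract_alt, contract_mul, h, map_add, contract_alt, contract_sgn, sgn_sgn, mul_sub,
      neg_mul]
    simp only [Pi.sub_apply, Pi.add_apply, Pi.neg_apply, ih, sgn_sgn]
    simp only [LinearMap.comp_apply, mulLeftL, LinearMap.coe_mk, AddHom.coe_mk]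
    abel

end AltMul

end Forms


/-! ### Exterior calculus on open subsets of `ℂⁿ` -/

section WedgeCLM

variable {n : ℕ} {W : Type*} [NormedRing W] [NormedAlgebra ℝ W]

/-- A crude count over the m! permutations. It serves only to make the wedge product a continuous
bilinear map, hence smooth. -/
theorem norm_wedge_apply_le {p q m : ℕ} (a : Alt n p W) (b : Alt n q W) (h : p + q = m)
    (w : Fin m → Model n) :
    ‖wedge a b h w‖ ≤ (m.factorial : ℝ) * ‖a‖ * ‖b‖ * ∏ i, ‖w i‖ := by
  have h1 : ‖wedgeSum a b h w‖ ≤ (m.factorial : ℝ) * (‖a‖ * ‖b‖ * ∏ i, ‖w i‖) := by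
    have hcard : (m.factorial : ℝ) = (Finset.univ : Finset (Equiv.Perm (Fin m))).card := by
      rw [Finset.card_univ, Fintype.card_perm, Fintype.card_fin]
    rw [hcard, ← nsmul_eq_mul]
    refine (norm_sum_le _ _).trans (Finset.sum_le_card_nsmul _ _ _ fun σ _ => ?_)
    have hσ : ‖(Equiv.Perm.sign σ : ℤ) •
        (a (leftPart h (w ∘ σ)) * b (rightPart h (w ∘ σ)))‖ =
        ‖a (leftPart h (w ∘ σ)) * b (rightPart h (w ∘ σ))‖ :=
      norm_isUnit_zsmul _ (Equiv.Perm.sign σ).isUnit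
    rw [hσ]
    have hprod : ∏ i, ‖w i‖ = (∏ i, ‖leftPart h (w ∘ σ) i‖) * ∏ i, ‖rightPart h (w ∘ σ) i‖ := by
      rw [← Equiv.prod_comp σ]
      subst h
      exact Fin.prod_univ_add _
    rw [hprod]
    calc _ ≤ ‖a (leftPart h (w ∘ σ))‖ * ‖b (rightPart h (w ∘ σ))‖ := norm_mul_le _ _
      _ ≤ (‖a‖ * ∏ i, ‖leftPart h (w ∘ σ) i‖) * (‖b‖ * ∏ i, ‖rightPart h (w ∘ σ) i‖) := by
        gcongr
        · exact a.le_opNorm _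
        · exact b.le_opNorm _
      _ = _ := by ring
  have h2 : ‖wedge a b h w‖ ≤ ‖wedgeSum a b h w‖ := by
    rw [wedgeSum_eq, ← Nat.cast_smul_eq_nsmul ℝ, norm_smul]
    refine le_mul_of_one_le_left (norm_nonneg _) ?_
    rw [Real.norm_natCast]
    exact_mod_cast Nat.one_le_iff_ne_zero.2 (by positivity)
  calc _ ≤ _ := h2.trans h1
    _ = _ := by ring

/-- The wedge product as a continuous bilinear map. -/
def wedgeCLM {p q m : ℕ} (h : p + q = m) : Alt n p W →L[ℝ] Alt n q W →L[ℝ] Alt n m W :=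
  LinearMap.mkContinuous₂
    { toFun := fun a =>
        { toFun := fun b => wedge a b h
          map_add' := fun b b' => wedge_add_right a b b' h
          map_smul' := fun c b => wedge_smul_right c a b h }
      map_add' := fun a a' => LinearMap.ext fun b => wedge_add_left a a' b h
      map_smul' := fun c a => LinearMap.ext fun b => wedge_smul_left c a b h }
    (m.factorial : ℝ) fun a b =>
      ContinuousAlternatingMap.opNorm_le_bound _ (by positivity) (norm_wedge_apply_le a b h)

/-- `Forms.wedgeD` as a continuous bilinear map. -/
def wedgeDCLM (p q m : ℕ) : Alt n p W →L[ℝ] Alt n q W →L[ℝ] Alt n m W :=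
  if h : p + q = m then wedgeCLM h else 0

theorem wedgeDCLM_apply {p q : ℕ} (m : ℕ) (a : Alt n p W) (b : Alt n q W) :
    wedgeDCLM p q m a b = Forms.wedgeD m a b := by
  unfold wedgeDCLM Forms.wedgeD
  split_ifs <;> rfl

end WedgeCLM

namespace Forms

variable {n : ℕ} {W V : Type*}

section Basic

variable [NormedAddCommGroup W] [NormedSpace ℝ W] [NormedAddCommGroup V] [NormedSpace ℝ V]

/-- Smoothness of a family of inhomogeneous forms on a set. -/
def Smooth (O : Set (Model n)) (η : Model n → Forms n W) : Prop :=
  ∀ k, ContDiffOn ℝ ∞ (fun y => η y k) O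

/-- Differentiability of a family of inhomogeneous forms at a point. -/
def DiffAt (η : Model n → Forms n W) (y : Model n) : Prop :=
  ∀ k, DifferentiableAt ℝ (fun y => η y k) y

/-- The directional derivatives of a family of inhomogeneous forms. -/
def deriv (η : Model n → Forms n W) (y : Model n) : Model n →ₗ[ℝ] Forms n W :=
  LinearMap.pi fun k => (fderiv ℝ (fun y => η y k) y : Model n →ₗ[ℝ] Alt n k W)

theorem deriv_apply (η : Model n → Forms n W) (y v : Model n) (k : ℕ) :
    deriv η y v k = fderiv ℝ (fun y => η y k) y v := rfl

/-- The exterior derivative of inhomogeneous forms. -/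
def d (η : Model n → Forms n W) (y : Model n) : Forms n W := alt (deriv η y)

@[simp] theorem d_apply_zero (η : Model n → Forms n W) (y : Model n) : d η y 0 = 0 := rfl

theorem d_apply_succ (η : Model n → Forms n W) (y : Model n) (k : ℕ) :
    d η y (k + 1) = extDeriv (fun y => η y k) y := rfl

theorem Smooth.diffAt {O : Set (Model n)} {η : Model n → Forms n W} (h : Smooth O η)
    (hO : IsOpen O) {y : Model n} (hy : y ∈ O) : DiffAt η y := fun k =>
  ((h k).contDiffAt (hO.mem_nhds hy)).differentiableAt (by simp)

theorem Smooth.mono {O O' : Set (Model n)} {η : Model n → Forms n W} (h : Smooth O η)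
    (hO : O' ⊆ O) : Smooth O' η := fun k => (h k).mono hO

theorem Smooth.congr {O : Set (Model n)} {η θ : Model n → Forms n W} (h : Smooth O η)
    (hO : ∀ y ∈ O, θ y = η y) : Smooth O θ := fun k =>
  (h k).congr fun y hy => by rw [hO y hy]

theorem Smooth.add {O : Set (Model n)} {η θ : Model n → Forms n W} (h : Smooth O η)
    (h' : Smooth O θ) : Smooth O (fun y => η y + θ y) := fun k => (h k).add (h' k)

theorem Smooth.sum {ι : Type*} {O : Set (Model n)} (s : Finset ι) {η : ι → Model n → Forms n W}
    (h : ∀ i ∈ s, Smooth O (η i)) : Smooth O (fun y => ∑ i ∈ s, η i y) := fun k => by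
  simp only [Finset.sum_apply]
  exact ContDiffOn.sum fun i hi => h i hi k

theorem Smooth.const_smul {𝕜 : Type*} [NormedField 𝕜] [NormedSpace 𝕜 W] [SMulCommClass ℝ 𝕜 W]
    {O : Set (Model n)} {η : Model n → Forms n W} (h : Smooth O η) (c : 𝕜) :
    Smooth O (fun y => c • η y) := fun k => (h k).const_smul c

theorem smooth_const (O : Set (Model n)) (a : Forms n W) : Smooth O (fun _ => a) :=
  fun _ => contDiffOn_const

theorem Smooth.ofDeg {O : Set (Model n)} {k : ℕ} {η : Model n → Alt n k W}
    (h : ContDiffOn ℝ ∞ η O) : Smooth O (fun y => ofDeg k (η y)) := fun j => by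
  by_cases hj : j = k
  · subst hj; simpa using h
  · simp only [ofDeg_of_ne hj]; exact contDiffOn_const

/-- Application of a continuous linear map to the values, as a continuous linear map. -/
theorem Smooth.mapL {O : Set (Model n)} {η : Model n → Forms n W} (h : Smooth O η)
    (f : W →L[ℝ] V) : Smooth O (fun y => mapL f (η y)) := fun k =>
  (ContinuousLinearMap.contDiff
    (ContinuousLinearMap.compContinuousAlternatingMapCLM ℝ (Model n) W V (Fin k) f)).comp_contDiffOn
      (h k)

theorem Smooth.d {O : Set (Model n)} (hO : IsOpen O) {η : Model n → Forms n W} (h : Smooth O η) :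
    Smooth O (d η) := fun k => by
  cases k with
  | zero => exact contDiffOn_const
  | succ k =>
    exact (ContinuousAlternatingMap.alternatizeUncurryFinCLM ℝ (Model n) W).contDiff.comp_contDiffOn
      ((h k).fderiv_of_isOpen (m := ∞) hO (by simp))

theorem d_congr {η θ : Model n → Forms n W} {y : Model n} (h : ∀ᶠ z in nhds y, η z = θ z) :
    d η y = d θ y := by
  unfold d deriv
  congr 2
  funext k
  rw [Filter.EventuallyEq.fderiv_eq]
  filter_upwards [h] with z hz
  rw [hz]

theorem d_add {η θ : Model n → Forms n W} {y : Model n} (h : DiffAt η y) (h' : DiffAt θ y) :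
    d (fun y => η y + θ y) y = d η y + d θ y := by
  rw [d, d, d, ← map_add]
  congr 1
  ext1 v
  funext k
  exact congrArg (· v) (fderiv_add (h k) (h' k))

theorem d_sum {ι : Type*} (s : Finset ι) {η : ι → Model n → Forms n W} {y : Model n}
    (h : ∀ i ∈ s, DiffAt (η i) y) : d (fun y => ∑ i ∈ s, η i y) y = ∑ i ∈ s, d (η i) y := by
  simp only [d]
  rw [← map_sum]
  congr 1
  ext1 v
  funext k
  simp only [LinearMap.sum_apply, Finset.sum_apply, deriv_apply]
  rw [fderiv_fun_sum fun i hi => h i hi k, _root_.sum_apply]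

theorem d_const (a : Forms n W) (y : Model n) : d (fun _ => a) y = 0 := by
  have : deriv (fun _ => a) y = 0 := by
    ext1 v
    funext k
    rw [deriv_apply, fderiv_fun_const]
    rfl
  rw [d, this, map_zero]

theorem d_const_smul {𝕜 : Type*} [NormedField 𝕜] [NormedSpace 𝕜 W] [SMulCommClass ℝ 𝕜 W]
    {η : Model n → Forms n W} {y : Model n} (h : DiffAt η y) (c : 𝕜) :
    d (fun y => c • η y) y = c • d η y := by
  funext k
  cases k with
  | zero => exact (smul_zero c).symm
  | succ k =>
    ext v
    rw [d, alt_succ_apply, Pi.smul_apply, ContinuousAlternatingMap.smul_apply, d, alt_succ_apply,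
      Finset.smul_sum]
    refine Finset.sum_congr rfl fun i _ => ?_
    rw [smul_comm c]
    congr 1
    rw [deriv_apply, deriv_apply]
    simp only [Pi.smul_apply]
    rw [fderiv_fun_const_smul (h k)]
    rfl

theorem d_mapL {η : Model n → Forms n W} {y : Model n} (h : DiffAt η y) (f : W →L[ℝ] V) :
    d (fun y => Forms.mapL f (η y)) y = Forms.mapL f (d η y) := by
  funext k
  cases k with
  | zero => ext v; simp
  | succ k =>
    ext v
    rw [d, alt_succ_apply, mapL_apply, d, alt_succ_apply, map_sum]
    refine Finset.sum_congr rfl fun i _ => ?_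
    rw [map_zsmul]
    congr 1
    rw [deriv_apply, deriv_apply]
    have := (((ContinuousLinearMap.compContinuousAlternatingMapCLM ℝ (Model n) W V
      (Fin k) f).hasFDerivAt).comp y (h k).hasFDerivAt).fderiv
    exact congrArg (fun T => T (v i) (i.removeNth v)) this

theorem d_d {O : Set (Model n)} (hO : IsOpen O) {η : Model n → Forms n W} (h : Smooth O η)
    {y : Model n} (hy : y ∈ O) : d (d η) y = 0 := by
  funext k
  match k with
  | 0 => rfl
  | 1 =>
    change extDeriv (fun y => d η y 0) y = 0
    simp only [d_apply_zero, extDeriv, fderiv_fun_const]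
    exact map_zero (ContinuousAlternatingMap.alternatizeUncurryFinCLM ℝ (Model n) W)
  | k + 2 =>
    exact extDeriv_extDeriv_apply ((h k).contDiffAt (hO.mem_nhds hy)) (r := ∞) (by
      rw [minSmoothness_of_isRCLikeNormedField]; exact WithTop.coe_le_coe.2 le_top)

theorem d_ofDeg {k : ℕ} (η : Model n → Alt n k W) (y : Model n) :
    d (fun y => Forms.ofDeg k (η y)) y = Forms.ofDeg (k + 1) (extDeriv η y) := by
  funext j
  cases j with
  | zero => rw [d_apply_zero, ofDeg_of_ne (by omega)]
  | succ j =>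
    rw [d_apply_succ]
    by_cases hj : j = k
    · subst hj; simp only [ofDeg_same]
    · rw [ofDeg_of_ne (by omega)]
      simp only [ofDeg_of_ne hj, extDeriv, fderiv_fun_const]
      exact map_zero (ContinuousAlternatingMap.alternatizeUncurryFinCLM ℝ (Model n) W)

end Basic

section Mul

variable [NormedRing W] [NormedAlgebra ℝ W]

theorem Smooth.mul {O : Set (Model n)} {a b : Model n → Forms n W} (ha : Smooth O a)
    (hb : Smooth O b) : Smooth O (fun y => a y * b y) := fun m => by
  have : (fun y => (a y * b y) m) = fun y =>
      ∑ pq ∈ Finset.HasAntidiagonal.antidiagonal m, wedgeDCLM pq.1 pq.2 m (a y pq.1) (b y pq.2) :=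
    funext fun y => mul_eq_sum (a y) (b y) m |>.trans <| by simp only [wedgeDCLM_apply]
  rw [this]
  refine ContDiffOn.sum fun pq _ => ?_
  have h0 : ContDiff ℝ ∞ (fun x : Alt n pq.1 W => wedgeDCLM (n := n) (W := W) pq.1 pq.2 m x) :=
    by fun_prop
  have hc : ContDiffOn ℝ ∞ (fun y => wedgeDCLM (n := n) (W := W) pq.1 pq.2 m (a y pq.1)) O :=
    h0.comp_contDiffOn (ha pq.1)
  exact hc.clm_apply (hb pq.2)

theorem Smooth.pow {O : Set (Model n)} {a : Model n → Forms n W} (ha : Smooth O a) (k : ℕ) :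
    Smooth O (fun y => a y ^ k) := by
  induction k with
  | zero => simp only [pow_zero]; exact smooth_const O 1
  | succ k ih => simp only [pow_succ]; exact ih.mul ha

/-- In each degree the product is a finite sum of continuous bilinear maps, so this is the product
rule for bilinear maps. Antisymmetrising it gives `d_mul`. -/
theorem deriv_mul {a b : Model n → Forms n W} {y : Model n} (ha : DiffAt a y) (hb : DiffAt b y) :
    deriv (fun y => a y * b y) y =
      (mulRightL (b y)).comp (deriv a y) + (mulLeftL (a y)).comp (deriv b y) := by
  ext1 v
  funext m
  have : (fun y => (a y * b y) m) = fun y =>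
      ∑ pq ∈ Finset.HasAntidiagonal.antidiagonal m, wedgeDCLM pq.1 pq.2 m (a y pq.1) (b y pq.2) :=
    funext fun y => mul_eq_sum (a y) (b y) m |>.trans <| by simp only [wedgeDCLM_apply]
  have hd := HasFDerivAt.fun_sum (u := Finset.HasAntidiagonal.antidiagonal m)
    (fun pq _ => (wedgeDCLM (n := n) (W := W) pq.1 pq.2 m).hasFDerivAt_of_bilinear
      (ha pq.1).hasFDerivAt (hb pq.2).hasFDerivAt)
  rw [deriv_apply, this, hd.fderiv]
  change _ = (deriv a y v * b y) m + (a y * deriv b y v) m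
  rw [show (deriv a y v * b y) m = _ from mul_eq_sum _ _ m,
    show (a y * deriv b y v) m = _ from mul_eq_sum _ _ m, ← Finset.sum_add_distrib,
    _root_.sum_apply]
  refine Finset.sum_congr rfl fun pq _ => ?_
  simp only [← wedgeDCLM_apply, deriv_apply]
  simp [add_comm]

/-- The graded Leibniz rule. -/
theorem d_mul {a b : Model n → Forms n W} {y : Model n} (ha : DiffAt a y) (hb : DiffAt b y) :
    d (fun y => a y * b y) y = d a y * b y + sgn (a y) * d b y := by
  rw [d, deriv_mul ha hb, map_add, alt_mulRight, alt_mulLeft]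
  rfl

end Mul

end Forms


/-! ### An exact quadrature for polynomial families -/

/-- Nodes and weights that integrate polynomials of degree `< N` over `[0, 1]`. -/
theorem exists_quadrature (N : ℕ) :
    ∃ q t : Fin N → ℝ, ∀ k < N, ((k : ℝ) + 1) * ∑ i, q i * t i ^ k = 1 := by
  -- The nodes only have to be distinct. They may lie outside [0, 1], since the affine path of
  -- connections is defined for every real parameter.
  let t : Fin N → ℝ := fun i => (i : ℕ)
  have ht : Function.Injective t := fun i j h => Fin.ext (Nat.cast_injective (R := ℝ) h)
  have hdet : IsUnit (Matrix.vandermonde t).det :=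
    isUnit_iff_ne_zero.2 (Matrix.det_vandermonde_ne_zero_iff.2 ht)
  let b : Fin N → ℝ := fun k => ((k : ℕ) + 1 : ℝ)⁻¹
  -- The weights solve the Vandermonde system whose right-hand side consists of the moments 1/(k +
  -- 1) of [0, 1].
  refine ⟨Matrix.vecMul b (Matrix.vandermonde t)⁻¹, t, fun k hk => ?_⟩
  have h : Matrix.vecMul (Matrix.vecMul b (Matrix.vandermonde t)⁻¹) (Matrix.vandermonde t) = b := by
    rw [Matrix.vecMul_vecMul, Matrix.nonsing_inv_mul _ hdet, Matrix.vecMul_one]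
  have hk' := congrFun h ⟨k, hk⟩
  simp only [Matrix.vecMul, dotProduct, Matrix.vandermonde_apply] at hk'
  rw [show ∑ i, Matrix.vecMul b (Matrix.vandermonde t)⁻¹ i * t i ^ k = b ⟨k, hk⟩ from hk']
  exact mul_inv_cancel₀ (by positivity)

section Quadrature

variable {R : Type*} [Ring R]

open Polynomial in
-- The coefficients do not commute, so the position of the differentiated factor must be kept. It
-- becomes the position of the one-form in the Chern–Simons form.
theorem derivative_pow_eq_sum (P : R[X]) (j : ℕ) :
    derivative (P ^ j) = ∑ l ∈ Finset.range j, P ^ l * derivative P * P ^ (j - 1 - l) := by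
  induction j with
  | zero => simp
  | succ j ih =>
    rw [pow_succ, derivative_mul, ih, Finset.sum_range_succ, Finset.sum_mul]
    congr 1
    · refine Finset.sum_congr rfl fun l hl => ?_
      rw [Finset.mem_range] at hl
      rw [mul_assoc, ← pow_succ]
      congr 2
      omega
    · simp

variable [Algebra ℝ R]

/-- Evaluation of a polynomial at a real number. -/
def evalReal (t : ℝ) : Polynomial R →+* R :=
  Polynomial.eval₂RingHom' (RingHom.id R) (algebraMap ℝ R t) fun a => (Algebra.commutes t a).symm

theorem evalReal_eq_sum (t : ℝ) (p : Polynomial R) {N : ℕ} (h : p.natDegree < N) :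
    evalReal t p = ∑ k ∈ Finset.range N, t ^ k • p.coeff k := by
  change Polynomial.eval₂ (RingHom.id R) (algebraMap ℝ R t) p = _
  rw [Polynomial.eval₂_eq_sum_range' _ h]
  refine Finset.sum_congr rfl fun k _ => ?_
  rw [RingHom.id_apply, ← map_pow, Algebra.smul_def, Algebra.commutes]

/-- The fundamental theorem of calculus for polynomials: the coefficient of degree k + 1 acquires
the factor k + 1 under differentiation, and the quadrature moment 1/(k + 1) removes it. -/
theorem evalReal_one_sub_evalReal_zero {N : ℕ} {q t : Fin N → ℝ}
    (hq : ∀ k < N, ((k : ℝ) + 1) * ∑ i, q i * t i ^ k = 1) (p : Polynomial R)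
    (hp : p.natDegree < N) :
    evalReal 1 p - evalReal 0 p = ∑ i, q i • evalReal (t i) (Polynomial.derivative p) := by
  obtain ⟨M, rfl⟩ : ∃ M, N = M + 1 := ⟨N - 1, by omega⟩
  have hp' : (Polynomial.derivative p).natDegree < M + 1 :=
    lt_of_le_of_lt (Polynomial.natDegree_derivative_le p) (by omega)
  simp only [evalReal_eq_sum _ _ hp', Finset.smul_sum, smul_smul, evalReal_eq_sum _ _ hp]
  rw [Finset.sum_comm, Finset.sum_range_succ', Finset.sum_range_succ' (n := M), Finset.sum_range_succ]
  simp only [one_pow, one_smul, pow_zero, ne_eq, Nat.add_eq_zero_iff, one_ne_zero, and_false,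
    not_false_eq_true, zero_pow, zero_smul, Finset.sum_const_zero, zero_add, add_sub_cancel_right]
  have hM : (Polynomial.derivative p).coeff M = 0 := by
    rw [Polynomial.coeff_derivative, Polynomial.coeff_eq_zero_of_natDegree_lt hp, zero_mul]
  simp only [hM, smul_zero, Finset.sum_const_zero, add_zero]
  refine Finset.sum_congr rfl fun k hk => ?_
  rw [Finset.mem_range] at hk
  rw [← Finset.sum_smul, Polynomial.coeff_derivative]
  have h1 : p.coeff (k + 1) * ((k : R) + 1) = ((k : ℝ) + 1) • p.coeff (k + 1) := by
    rw [Algebra.smul_def, Algebra.commutes]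
    simp
  rw [h1, smul_smul, mul_comm, hq k (by omega), one_smul]

/-- The difference of the powers of the end points of a quadratic path, as a finite sum of
derivatives along the path. -/
theorem pow_sub_pow_eq_quadrature {N : ℕ} {q t : Fin N → ℝ}
    (hq : ∀ k < N, ((k : ℝ) + 1) * ∑ i, q i * t i ^ k = 1) (F B C : R) (j : ℕ) (hj : 2 * j < N)
    (Ft Bt : Fin N → R) (hF : ∀ i, Ft i = F + t i • B + (t i) ^ 2 • C)
    (hB : ∀ i, Bt i = B + (2 * t i) • C) :
    (F + B + C) ^ j - F ^ j =
      ∑ i, q i • ∑ l ∈ Finset.range j, Ft i ^ l * Bt i * Ft i ^ (j - 1 - l) := by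
  let P : Polynomial R := Polynomial.C F + Polynomial.C B * Polynomial.X
    + Polynomial.C C * Polynomial.X ^ 2
  have hP : ∀ s, evalReal s P = F + s • B + s ^ 2 • C := by
    intro s
    change Polynomial.eval₂ (RingHom.id R) (algebraMap ℝ R s) P = _
    simp only [P, Polynomial.eval₂_add, Polynomial.eval₂_C, RingHom.id_apply,
      Polynomial.eval₂_mul_X]
    rw [Polynomial.eval₂_mul_noncomm _ _ (fun k => by
      rw [RingHom.id_apply]; exact (Algebra.commutes s _).symm)]
    simp only [Polynomial.eval₂_C, RingHom.id_apply, Polynomial.eval₂_X_pow, Algebra.smul_def,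
      map_pow]
    rw [Algebra.commutes s B, ← map_pow, Algebra.commutes (s ^ 2) C]
  have hP' : ∀ s, evalReal s (Polynomial.derivative P) = B + (2 * s) • C := by
    intro s
    have : Polynomial.derivative P = Polynomial.C B + Polynomial.C (C + C) * Polynomial.X := by
      simp [P]
      rw [add_mul (1 : Polynomial R), one_mul, mul_add, add_mul]
    rw [this]
    change Polynomial.eval₂ (RingHom.id R) (algebraMap ℝ R s) _ = _
    rw [Polynomial.eval₂_add, Polynomial.eval₂_mul_X, Polynomial.eval₂_C, Polynomial.eval₂_C,
      RingHom.id_apply, RingHom.id_apply, ← Algebra.commutes, ← Algebra.smul_def, two_mul,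
      add_smul, smul_add]
  -- The path is quadratic, so its j-th power has degree at most 2j, within the exactness of the
  -- rule.
  have hdeg : (P ^ j).natDegree < N := by
    refine lt_of_le_of_lt ((Polynomial.natDegree_pow_le).trans ?_) hj
    rw [mul_comm 2 j]
    refine Nat.mul_le_mul_left j ?_
    simp only [P]
    compute_degree
  have key := evalReal_one_sub_evalReal_zero hq (P ^ j) hdeg
  rw [derivative_pow_eq_sum] at key
  simp only [map_pow, map_sum, map_mul, hP, hP', ← hF, ← hB] at key
  simpa using key

end Quadrature


/-! ### Local Chern--Weil theory -/

namespace Forms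

variable {n : ℕ} {W V : Type*} [NormedRing W] [NormedAlgebra ℝ W]
  [NormedAddCommGroup V] [NormedSpace ℝ V]

instance : Algebra ℝ (Forms n W) := Algebra.ofModule smul_mul_assoc mul_smul_comm

theorem wedgeD_zero_left {p q : ℕ} (m : ℕ) (b : Alt n q W) : wedgeD m (0 : Alt n p W) b = 0 := by
  rw [← wedgeDCLM_apply, map_zero]; rfl

theorem wedgeD_zero_right {p q : ℕ} (m : ℕ) (a : Alt n p W) : wedgeD m a (0 : Alt n q W) = 0 := by
  rw [← wedgeDCLM_apply, map_zero]

theorem ofDeg_mul_ofDeg {p q m : ℕ} (a : Alt n p W) (b : Alt n q W) (h : p + q = m) :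
    ofDeg p a * ofDeg q b = ofDeg m (wedge a b h) := by
  funext k
  rw [show (ofDeg p a * ofDeg q b) k = _ from mul_eq_sum _ _ k]
  by_cases hk : k = m
  · subst hk
    rw [ofDeg_same, Finset.sum_eq_single (p, q)]
    · simp [wedgeD, h]
    · rintro ⟨p', q'⟩ h1 h2
      rw [Finset.HasAntidiagonal.mem_antidiagonal] at h1
      have : p' ≠ p := by
        rintro rfl
        exact h2 (Prod.ext rfl (by simp only at h1 ⊢; omega))
      simp only [ofDeg_of_ne this, wedgeD_zero_left]
    · intro h1
      exact absurd (Finset.HasAntidiagonal.mem_antidiagonal.2 h) h1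
  · rw [ofDeg_of_ne hk]
    refine Finset.sum_eq_zero ?_
    rintro ⟨p', q'⟩ h1
    rw [Finset.HasAntidiagonal.mem_antidiagonal] at h1
    by_cases hp : p' = p
    · have : q' ≠ q := by
        rintro rfl
        subst hp
        exact hk (h1.symm.trans h)
      simp only [ofDeg_of_ne this, wedgeD_zero_right]
    · simp only [ofDeg_of_ne hp, wedgeD_zero_left]

theorem ofConst_one : ofConst n (1 : W) = 1 := rfl

theorem ofConst_mul_ofConst (w z : W) : ofConst n w * ofConst n z = ofConst n (w * z) := by
  funext k
  ext v
  rw [ofConst_mul_apply]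
  cases k with
  | zero => simp only [ofConst, Pi.single_eq_same]; rfl
  | succ k => simp [ofConst, Pi.single_eq_of_ne]

/-- The values of a trace-like map are invariant under conjugation. -/
theorem mapL_eq_of_semiconj (f : W →L[ℝ] V) (hf : ∀ w z, f (w * z) = f (z * w)) {g g' : W}
    (hg : g * g' = 1) (hg' : g' * g = 1) {x x' : Forms n W}
    (h : SemiconjBy (ofConst n g) x x') : mapL f x' = mapL f x := by
  have h1 : x' = ofConst n g * (x * ofConst n g') := by
    rw [← mul_assoc, h.eq, mul_assoc, ofConst_mul_ofConst, hg, ofConst_one, mul_one]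
  rw [h1, mapL_ofConst_mul f hf, mul_assoc, ofConst_mul_ofConst, hg', ofConst_one, mul_one]

/-! #### Curvature -/

/-- The curvature `dA + A ∧ A` of a matrix of one-forms. -/
def curv (A : Model n → Alt n 1 W) (y : Model n) : Forms n W :=
  d (fun y => ofDeg 1 (A y)) y + ofDeg 1 (A y) * ofDeg 1 (A y)

theorem curv_eq_ofDeg (A : Model n → Alt n 1 W) (y : Model n) :
    curv A y = ofDeg 2 (extDeriv A y + wedge (A y) (A y) rfl) := by
  rw [curv, d_ofDeg, ofDeg_mul_ofDeg _ _ rfl, ← Pi.single_add]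

theorem sgn_ofDeg_one (α : Alt n 1 W) : sgn (ofDeg 1 α) = -ofDeg 1 α := by
  rw [sgn_ofDeg, pow_one, neg_one_smul]

theorem sgn_ofDeg_two (α : Alt n 2 W) : sgn (ofDeg 2 α) = ofDeg 2 α := by
  rw [sgn_ofDeg]; simp

variable {O : Set (Model n)}

theorem Smooth.curv (hO : IsOpen O) {A : Model n → Alt n 1 W} (hA : ContDiffOn ℝ ∞ A O) :
    Smooth O (curv A) :=
  ((Smooth.ofDeg hA).d hO).add ((Smooth.ofDeg hA).mul (Smooth.ofDeg hA))

/-- The Bianchi identity. -/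
theorem d_curv (hO : IsOpen O) {A : Model n → Alt n 1 W} (hA : ContDiffOn ℝ ∞ A O) {y : Model n}
    (hy : y ∈ O) :
    d (Forms.curv A) y = Forms.curv A y * ofDeg 1 (A y) - ofDeg 1 (A y) * Forms.curv A y := by
  have h1 := Smooth.ofDeg hA
  have h2 := (h1.d hO).diffAt hO hy
  have h3 := (h1.mul h1).diffAt hO hy
  have h4 := h1.diffAt hO hy
  have h5 : d (Forms.curv A) y = _ := d_add h2 h3
  rw [h5, d_d hO h1 hy, d_mul h4 h4, sgn_ofDeg_one]
  simp only [Forms.curv]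
  generalize d (fun y => ofDeg 1 (A y)) y = D
  generalize ofDeg 1 (A y) = a
  rw [zero_add, add_mul, mul_add, neg_mul, mul_assoc]
  abel

theorem Smooth.ofConst {g : Model n → W} (hg : ContDiffOn ℝ ∞ g O) :
    Smooth O (fun y => ofConst n (g y)) :=
  Smooth.ofDeg (k := 0) (η := fun y => ContinuousAlternatingMap.constOfIsEmptyLIE ℝ (Model n) W
    (Fin 0) (g y)) <| (ContinuousAlternatingMap.constOfIsEmptyLIE ℝ (Model n) W
      (Fin 0)).toContinuousLinearEquiv.contDiff.comp_contDiffOn hg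

theorem d_ofConst (g : Model n → W) (y : Model n) :
    d (fun y => Forms.ofConst n (g y)) y =
      ofDeg 1 (ContinuousAlternatingMap.ofSubsingleton ℝ (Model n) W 0 (fderiv ℝ g y)) := by
  have := d_ofDeg (fun y => ContinuousAlternatingMap.constOfIsEmpty ℝ (Model n) (Fin 0) (g y)) y
  rw [extDeriv_constOfIsEmpty] at this
  exact this

/-- Gauge covariance of the curvature. -/
theorem curv_gauge (hO : IsOpen O) {A A' : Model n → Alt n 1 W} {g : Model n → W}
    (hA : ContDiffOn ℝ ∞ A O) (hA' : ContDiffOn ℝ ∞ A' O) (hg : ContDiffOn ℝ ∞ g O)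
    (h : ∀ y ∈ O, ∀ v : Model n,
      A' y (fun _ => v) * g y + fderiv ℝ g y v = g y * A y (fun _ => v)) {y : Model n}
    (hy : y ∈ O) :
    SemiconjBy (Forms.ofConst n (g y)) (Forms.curv A y) (Forms.curv A' y) := by
  have hsa := Smooth.ofDeg hA
  have hsa' := Smooth.ofDeg hA'
  have hsg := Smooth.ofConst hg
  have heq : ∀ z ∈ O, ofDeg 1 (A' z) * Forms.ofConst n (g z) + d (fun y => Forms.ofConst n (g y)) z
      = Forms.ofConst n (g z) * ofDeg 1 (A z) := by
    intro z hz
    funext k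
    ext v
    rw [Pi.add_apply, ContinuousAlternatingMap.add_apply, mul_ofConst_apply, ofConst_mul_apply,
      d_ofConst]
    by_cases hk : k = 1
    · subst hk
      simp only [ofDeg_same]
      have hv : v = fun _ => v 0 := funext fun i => by rw [Subsingleton.elim i 0]
      rw [hv]
      exact h z hz (v 0)
    · simp [ofDeg_of_ne hk]
  have hev : ∀ᶠ z in nhds y,
      ofDeg 1 (A' z) * Forms.ofConst n (g z) + d (fun y => Forms.ofConst n (g y)) z
      = Forms.ofConst n (g z) * ofDeg 1 (A z) := Filter.eventually_of_mem (hO.mem_nhds hy) heq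
  -- The gauge relation holds on a neighbourhood, so it may be differentiated. Since d² = 0, the
  -- second derivative of g drops out and a relation between the two exterior derivatives remains.
  have hd := d_congr hev
  rw [d_add ((hsa'.mul hsg).diffAt hO hy) ((hsg.d hO).diffAt hO hy), d_d hO hsg hy,
    d_mul (hsa'.diffAt hO hy) (hsg.diffAt hO hy), d_mul (hsg.diffAt hO hy) (hsa.diffAt hO hy),
    sgn_ofDeg_one, sgn_ofConst] at hd
  have h0 := heq y hy
  unfold SemiconjBy Forms.curv
  generalize d (fun y => ofDeg 1 (A y)) y = D at *
  generalize d (fun y => ofDeg 1 (A' y)) y = D' at *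
  generalize d (fun y => Forms.ofConst n (g y)) y = G at *
  generalize ofDeg 1 (A y) = a at *
  generalize ofDeg 1 (A' y) = a' at *
  generalize Forms.ofConst n (g y) = c at *
  have h1 : c * D = D' * c - a' * G - G * a := by
    rw [eq_sub_iff_add_eq, add_comm, ← hd, neg_mul]; abel
  have h2 : G = c * a - a' * c := by rw [← h0]; abel
  rw [mul_add, h1, add_mul, h2]
  noncomm_ring

/-! #### Transgression -/

/-- The graded commutator with an even form is an ordinary commutator, which is a derivation. A
Bianchi identity for G thus passes to its powers; with a = 0 it says that powers of a closed even
form are closed. -/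
theorem d_pow {G : Model n → Forms n W} {a : Forms n W} (hO : IsOpen O) (hG : Smooth O G)
    {y : Model n} (hy : y ∈ O) (hs : sgn (G y) = G y) (hd : d G y = G y * a - a * G y) (k : ℕ) :
    d (fun y => G y ^ k) y = G y ^ k * a - a * G y ^ k := by
  induction k with
  | zero => simp only [pow_zero, one_mul, mul_one, sub_self]; exact d_const 1 y
  | succ k ih =>
    simp only [pow_succ]
    rw [d_mul ((hG.pow k).diffAt hO hy) (hG.diffAt hO hy), ih, hd, sgn_pow, hs]
    noncomm_ring

/-- The form `f(γ ∧ Gˡ ∧ b ∧ Gᵏ ∧ U)`. -/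
def insertForm (f : W →L[ℝ] V) (γ U G b : Forms n W) (l k : ℕ) : Forms n V :=
  mapL f (γ * (G ^ l * b * G ^ k) * U)

/-- The hypothesis on `d b` says that the covariant derivative of b is B, and G is covariantly
constant. All remaining terms contain α once and add up to its graded commutator with the integrand,
on which f vanishes. -/
theorem d_insertForm (f : W →L[ℝ] V) (hf : ∀ w z, f (w * z) = f (z * w))
    {γ U G b : Model n → Forms n W} (hO : IsOpen O) (hγ : Smooth O γ) (hU : Smooth O U)
    (hG : Smooth O G) (hb : Smooth O b) {y : Model n} (hy : y ∈ O) (α : Alt n 1 W) {B : Forms n W}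
    (hdγ : d γ y = 0) (hsγ : sgn (γ y) = γ y) (hcγ : ∀ k v w, w * γ y k v = γ y k v * w)
    (hdU : d U y = 0) (hcU : ∀ k v w, w * U y k v = U y k v * w)
    (hsG : sgn (G y) = G y) (hdG : d G y = G y * ofDeg 1 α - ofDeg 1 α * G y)
    (hsb : sgn (b y) = -b y) (hdb : d b y = B - ofDeg 1 α * b y - b y * ofDeg 1 α) (l k : ℕ) :
    d (fun y => insertForm f (γ y) (U y) (G y) (b y) l k) y =
      insertForm f (γ y) (U y) (G y) B l k := by
  have hs1 := ((hG.pow l).mul hb)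
  have hs2 := hs1.mul (hG.pow k)
  have hs3 := hγ.mul hs2
  have hη := hs3.mul hU
  have e1 : d (fun y => insertForm f (γ y) (U y) (G y) (b y) l k) y =
      mapL f (d (fun y => γ y * (G y ^ l * b y * G y ^ k) * U y) y) :=
    d_mapL (hη.diffAt hO hy) f
  rw [e1, insertForm]
  have hdl := d_pow hO hG hy hsG hdG l
  have hdk := d_pow hO hG hy hsG hdG k
  rw [d_mul (hs3.diffAt hO hy) (hU.diffAt hO hy), hdU, mul_zero, add_zero,
    d_mul (hγ.diffAt hO hy) (hs2.diffAt hO hy), hdγ, zero_mul, zero_add, hsγ,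
    d_mul (hs1.diffAt hO hy) ((hG.pow k).diffAt hO hy),
    d_mul ((hG.pow l).diffAt hO hy) (hb.diffAt hO hy), hdl, hdk, hdb, sgn_mul, sgn_pow, hsG, hsb]
  have hγα := ofDeg_one_mul_of_central α (γ y) hcγ
  have hUα := ofDeg_one_mul_of_central α (U y) hcU
  rw [hsγ] at hγα
  have htr := mapL_ofDeg_one_mul f (S := Set.univ) (fun w z _ => hf w z) α
    (γ y * (G y ^ l * b y * G y ^ k) * U y) (fun _ _ => Set.mem_univ _)
  simp only [sgn_mul, sgn_pow, hsG, hsb, hsγ] at htr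
  generalize ofDeg 1 α = a at *
  generalize G y ^ l = p at *
  generalize G y ^ k = q at *
  generalize γ y = c at *
  generalize U y = u at *
  generalize b y = β at *
  generalize sgn u = u' at *
  rw [← sub_eq_zero, ← map_sub] at htr ⊢
  rw [← neg_eq_zero, ← map_neg, ← htr]
  congr 1
  -- Moving the one-form across U turns `sgn U` back into U, so no parity assumption on U is needed.
  have e2 : c * (p * -β * q) * u' * a = - (c * (p * β * q) * a * u) := by
    rw [mul_assoc _ u' a, ← hUα]; noncomm_ring
  rw [e2]
  have e3 : a * (c * (p * β * q) * u) = c * (a * (p * β * q) * u) := by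
    rw [← mul_assoc, ← mul_assoc, hγα]; noncomm_ring
  rw [e3]
  noncomm_ring

section Scalars

variable {𝕜 : Type*} [NormedField 𝕜] [NormedSpace 𝕜 W] [SMulCommClass ℝ 𝕜 W]
  [IsScalarTower 𝕜 W W] [SMulCommClass 𝕜 W W]

/-- The Chern--Weil form `f(γ ∧ p(G) ∧ U)`, for a polynomial `p` with coefficients `z`. -/
def cwForm (f : W →L[ℝ] V) (N : ℕ) (z : ℕ → 𝕜) (γ U G : Forms n W) : Forms n V :=
  mapL f (γ * (∑ j ∈ Finset.range N, z j • G ^ j) * U)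

/-- The Chern--Simons form that transgresses `cwForm` along a path, with the integral over the path
replaced by a quadrature. -/
def csForm (f : W →L[ℝ] V) (N : ℕ) (z : ℕ → 𝕜) {M : ℕ} (q : Fin M → ℝ) (γ U b : Forms n W)
    (G : Fin M → Forms n W) : Forms n V :=
  ∑ i, q i • ∑ j ∈ Finset.range N, ∑ l ∈ Finset.range j,
    insertForm f γ U (G i) (z j • b) l (j - 1 - l)

/-- The quadrature identity is applied to each power j < N. Its degree 2j in the path parameter is
below 2N ≤ M, so one rule serves all powers. -/
theorem cwForm_sub_cwForm (f : W →L[ℝ] V) (N : ℕ) (z : ℕ → 𝕜) {M : ℕ} (hM : 2 * N ≤ M) {q t : Fin M → ℝ}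
    (hq : ∀ k < M, ((k : ℝ) + 1) * ∑ i, q i * t i ^ k = 1) (γ U F B C : Forms n W)
    (Ft Bt : Fin M → Forms n W) (hF : ∀ i, Ft i = F + t i • B + (t i) ^ 2 • C)
    (hB : ∀ i, Bt i = B + (2 * t i) • C) :
    cwForm f N z γ U (F + B + C) - cwForm f N z γ U F =
      ∑ i, q i • ∑ j ∈ Finset.range N, ∑ l ∈ Finset.range j,
        insertForm f γ U (Ft i) (z j • Bt i) l (j - 1 - l) := by
  have key : ∀ j ∈ Finset.range N, z j • (F + B + C) ^ j
      - z j • F ^ j = ∑ i, q i • ∑ l ∈ Finset.range j,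
        Ft i ^ l * (z j • Bt i) * Ft i ^ (j - 1 - l) := by
    intro j hj
    rw [Finset.mem_range] at hj
    rw [← smul_sub, pow_sub_pow_eq_quadrature hq F B C j (by omega) Ft Bt hF hB, Finset.smul_sum]
    refine Finset.sum_congr rfl fun i _ => ?_
    have : SMulCommClass 𝕜 ℝ (Forms n W) := SMulCommClass.symm ℝ 𝕜 (Forms n W)
    rw [smul_comm, Finset.smul_sum]
    simp only [mul_smul_comm, smul_mul_assoc]
  rw [cwForm, cwForm, ← map_sub, ← sub_mul, ← mul_sub, ← Finset.sum_sub_distrib,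
    Finset.sum_congr rfl key, Finset.sum_comm]
  simp only [← Finset.smul_sum, map_smul, insertForm, mul_smul_comm (_ : ℝ),
    smul_mul_assoc (_ : ℝ), Finset.mul_sum, Finset.sum_mul, map_sum]

end Scalars

end Forms


/-! ### Forms on a manifold in charts -/

section Charts

variable {n : ℕ} {X : Type*} [TopologicalSpace X] [ChartedSpace (Model n) X]

instance instIsManifoldReal [IsManifold 𝓘(ℂ, Model n) ω X] : IsManifold 𝓘(ℝ, Model n) ∞ X :=
  isManifold_real n X

/-- The derivative of the inverse of a chart. -/
def chartD (x₀ : X) (y : Model n) : Model n →L[ℝ] Model n :=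
  mfderiv 𝓘(ℝ, Model n) 𝓘(ℝ, Model n) (chartAt (Model n) x₀).symm y

/-- The change of charts. -/
def tau (x₀ x₁ : X) (y : Model n) : Model n :=
  chartAt (Model n) x₁ ((chartAt (Model n) x₀).symm y)

variable (n) in
/-- The part of the target of a chart that corresponds to a subset of the manifold. -/
def chartSet (x₀ : X) (S : Set X) : Set (Model n) :=
  (chartAt (Model n) x₀).target ∩ (chartAt (Model n) x₀).symm ⁻¹' S

variable {x₀ x₁ : X} {y : Model n}

theorem isOpen_chartSet (x₀ : X) {S : Set X} (hS : IsOpen S) : IsOpen (chartSet n x₀ S) :=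
  (chartAt (Model n) x₀).isOpen_inter_preimage_symm hS

theorem chartSet_univ (x₀ : X) : chartSet n x₀ Set.univ = (chartAt (Model n) x₀).target := by
  simp [chartSet]

theorem mem_chartSet_self (x : X) {S : Set X} (h : x ∈ S) :
    chartAt (Model n) x x ∈ chartSet n x S :=
  ⟨mem_chart_target _ x, by
    simpa [(chartAt (Model n) x).left_inv (mem_chart_source (Model n) x)] using h⟩

theorem tau_symm (h : y ∈ chartSet n x₀ (chartAt (Model n) x₁).source) :
    (chartAt (Model n) x₁).symm (tau x₀ x₁ y) = (chartAt (Model n) x₀).symm y :=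
  (chartAt (Model n) x₁).left_inv h.2

theorem tau_mem_chartSet {S : Set X} (h : y ∈ chartSet n x₀ (chartAt (Model n) x₁).source)
    (hS : (chartAt (Model n) x₀).symm y ∈ S) : tau x₀ x₁ y ∈ chartSet n x₁ S :=
  ⟨(chartAt (Model n) x₁).map_source h.2, by rw [Set.mem_preimage, tau_symm h]; exact hS⟩

theorem contDiffOn_tau [IsManifold 𝓘(ℝ, Model n) ∞ X] (x₀ x₁ : X) :
    ContDiffOn ℝ ∞ (tau x₀ x₁) (chartSet n x₀ (chartAt (Model n) x₁).source) := by
  have h : ContDiffOn ℝ ∞ (𝓘(ℝ, Model n) ∘ ((chartAt (Model n) x₀).symm ≫ₕ chartAt (Model n) x₁) ∘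
      𝓘(ℝ, Model n).symm) (𝓘(ℝ, Model n).symm ⁻¹'
        ((chartAt (Model n) x₀).symm ≫ₕ chartAt (Model n) x₁).source ∩
          Set.range 𝓘(ℝ, Model n)) :=
    ((contDiffGroupoid ∞ 𝓘(ℝ, Model n)).compatible (chart_mem_atlas _ x₀)
      (chart_mem_atlas _ x₁)).1
  refine h.mono fun y hy => ?_
  simpa [OpenPartialHomeomorph.trans_source, chartSet] using hy

theorem contDiffAt_tau [IsManifold 𝓘(ℝ, Model n) ∞ X]
    (h : y ∈ chartSet n x₀ (chartAt (Model n) x₁).source) : ContDiffAt ℝ ∞ (tau x₀ x₁) y :=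
  (contDiffOn_tau x₀ x₁).contDiffAt
    ((isOpen_chartSet x₀ (chartAt (Model n) x₁).open_source).mem_nhds h)

theorem mdifferentiableAt_chart_symm [IsManifold 𝓘(ℝ, Model n) ∞ X]
    (h : y ∈ (chartAt (Model n) x₀).target) :
    MDifferentiableAt 𝓘(ℝ, Model n) 𝓘(ℝ, Model n) (chartAt (Model n) x₀).symm y :=
  mdifferentiableAt_atlas_symm (chart_mem_atlas _ x₀) h

/-- The chain rule for a change of charts. -/
theorem chartD_eq_comp [IsManifold 𝓘(ℝ, Model n) ∞ X]
    (h : y ∈ chartSet n x₀ (chartAt (Model n) x₁).source) :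
    chartD x₀ y = (chartD x₁ (tau x₀ x₁ y)).comp (fderiv ℝ (tau x₀ x₁) y) := by
  have hev : (chartAt (Model n) x₀).symm =ᶠ[nhds y] (chartAt (Model n) x₁).symm ∘ tau x₀ x₁ := by
    filter_upwards [(isOpen_chartSet x₀ (chartAt (Model n) x₁).open_source).mem_nhds h] with z hz
    exact (tau_symm hz).symm
  unfold chartD
  rw [hev.mfderiv_eq, mfderiv_comp (I' := 𝓘(ℝ, Model n)) y
    (mdifferentiableAt_chart_symm ((chartAt (Model n) x₁).map_source h.2))
    ((contDiffAt_tau h).differentiableAt (by simp)).mdifferentiableAt, mfderiv_eq_fderiv]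
  rfl

/-- The tangent space at x is identified with the model by the chart at x itself. The map read in
these coordinates is the chart after its inverse, the identity near the point. -/
theorem chartD_self [IsManifold 𝓘(ℝ, Model n) ∞ X] (x : X) :
    chartD x (chartAt (Model n) x x) = ContinuousLinearMap.id ℝ (Model n) := by
  have hx := mem_chart_target (Model n) x
  have hs := (chartAt (Model n) x).left_inv (mem_chart_source (Model n) x)
  have h1 := mdifferentiableAt_chart_symm hx
  have hev : (chartAt (Model n) x) ∘ (chartAt (Model n) x).symm
      =ᶠ[nhds (chartAt (Model n) x x)] id := by
    filter_upwards [(chartAt (Model n) x).open_target.mem_nhds hx] with z hz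
    exact (chartAt (Model n) x).right_inv hz
  have e : fderivWithin ℝ (writtenInExtChartAt 𝓘(ℝ, Model n) 𝓘(ℝ, Model n)
      (chartAt (Model n) x x) (chartAt (Model n) x).symm) (Set.range 𝓘(ℝ, Model n))
      (extChartAt 𝓘(ℝ, Model n) (chartAt (Model n) x x) (chartAt (Model n) x x)) =
        ContinuousLinearMap.id ℝ (Model n) := by
    have hw : writtenInExtChartAt 𝓘(ℝ, Model n) 𝓘(ℝ, Model n)
      (chartAt (Model n) x x) (chartAt (Model n) x).symm =
        (chartAt (Model n) x) ∘ (chartAt (Model n) x).symm := by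
      funext z
      simp only [writtenInExtChartAt, hs]
      rfl
    rw [hw, modelWithCornersSelf_coe, Set.range_id, fderivWithin_univ]
    simp only [extChartAt_model_space_eq_id, PartialEquiv.refl_coe, id]
    rw [hev.fderiv_eq, fderiv_id]
  exact h1.mfderiv.trans e

/-- Each fibre is read in the preferred chart of its own base point, so the manifold derivative of
an inverse chart is the ordinary derivative of a transition map, one that depends on y. -/
theorem chartD_eq_fderiv [IsManifold 𝓘(ℝ, Model n) ∞ X] (h : y ∈ (chartAt (Model n) x₀).target) :
    chartD x₀ y = fderiv ℝ (tau x₀ ((chartAt (Model n) x₀).symm y)) y := by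
  have hy : y ∈ chartSet n x₀ (chartAt (Model n) ((chartAt (Model n) x₀).symm y)).source :=
    ⟨h, mem_chart_source _ _⟩
  rw [chartD_eq_comp hy]
  conv_lhs => rw [tau]
  rw [chartD_self]
  rfl

section Forms

variable {W : Type*} [NormedAddCommGroup W] [NormedSpace ℝ W] {k : ℕ}

theorem inChart_apply (x₀ : X) (η : DForm n X k W) (y : Model n) :
    inChart x₀ η y =
      (η ((chartAt (Model n) x₀).symm y)).compContinuousLinearMap (chartD x₀ y) := rfl

theorem inChart_eq_pullback [IsManifold 𝓘(ℝ, Model n) ∞ X] (η : DForm n X k W)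
    (h : y ∈ chartSet n x₀ (chartAt (Model n) x₁).source) :
    inChart x₀ η y =
      (inChart x₁ η (tau x₀ x₁ y)).compContinuousLinearMap (fderiv ℝ (tau x₀ x₁) y) := by
  rw [inChart_apply, inChart_apply, tau_symm h, chartD_eq_comp h]
  rfl

theorem inChart_self [IsManifold 𝓘(ℝ, Model n) ∞ X] (η : DForm n X k W) (x : X) :
    inChart x η (chartAt (Model n) x x) = η x := by
  rw [inChart_apply, chartD_self, (chartAt (Model n) x).left_inv (mem_chart_source (Model n) x)]
  rfl

theorem SmoothOn.contDiffOn {η : DForm n X k W} {S : Set X} (h : SmoothOn η S) (x₀ : X) :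
    ContDiffOn ℝ ∞ (inChart x₀ η) (chartSet n x₀ S) := h x₀

theorem SmoothOn.contDiffAt {η : DForm n X k W} {S : Set X} (h : SmoothOn η S) (hS : IsOpen S)
    (hy : y ∈ chartSet n x₀ S) : ContDiffAt ℝ ∞ (inChart x₀ η) y :=
  (h x₀).contDiffAt ((isOpen_chartSet x₀ hS).mem_nhds hy)

/-- The exterior derivative may be computed in any chart. -/
theorem extDeriv_inChart [IsManifold 𝓘(ℝ, Model n) ∞ X] {η : DForm n X k W} {S : Set X}
    (h : SmoothOn η S) (hS : IsOpen S) (hy : y ∈ chartSet n x₀ S) :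
    extDeriv (inChart x₀ η) y = inChart x₀ (dForm η) y := by
  set x := (chartAt (Model n) x₀).symm y with hx
  have hy' : y ∈ chartSet n x₀ (chartAt (Model n) x).source := ⟨hy.1, mem_chart_source _ _⟩
  have hev : inChart x₀ η =ᶠ[nhds y] fun z =>
      (inChart x η (tau x₀ x z)).compContinuousLinearMap (fderiv ℝ (tau x₀ x) z) := by
    filter_upwards [(isOpen_chartSet x₀ (chartAt (Model n) x).open_source).mem_nhds hy'] with z hz
    exact inChart_eq_pullback η hz
  have hd : DifferentiableAt ℝ (inChart x η) (tau x₀ x y) :=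
    (h.contDiffAt hS (tau_mem_chartSet hy' hy.2)).differentiableAt (by simp)
  rw [hev.extDeriv_eq, extDeriv_pullback hd (contDiffAt_tau hy') (by
    rw [minSmoothness_of_isRCLikeNormedField]; exact WithTop.coe_le_coe.2 le_top),
    inChart_apply, chartD_eq_fderiv hy.1]
  rfl

/-- A field of inhomogeneous forms in a chart. -/
def inCh (x₀ : X) (Φ : X → Forms n W) (y : Model n) : Forms n W := fun k =>
  inChart x₀ (fun x => Φ x k) y

theorem inCh_ofDeg (x₀ : X) (η : DForm n X k W) (y : Model n) :
    inCh x₀ (fun x => Forms.ofDeg k (η x)) y = Forms.ofDeg k (inChart x₀ η y) := by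
  funext j
  rw [inCh, inChart_apply]
  by_cases h : j = k
  · subst h; simp [inChart_apply]
  · rw [Forms.ofDeg_of_ne h, Forms.ofDeg_of_ne h]; rfl

theorem inCh_smul {𝕜 : Type*} [NormedField 𝕜] [NormedSpace 𝕜 W] [SMulCommClass ℝ 𝕜 W] (c : 𝕜)
    (x₀ : X) (Φ : X → Forms n W) (y : Model n) :
    inCh x₀ (fun x => c • Φ x) y = c • inCh x₀ Φ y := rfl

theorem inCh_sum {ι : Type*} (s : Finset ι) (x₀ : X) (Φ : ι → X → Forms n W) (y : Model n) :
    inCh x₀ (fun x => ∑ i ∈ s, Φ i x) y = ∑ i ∈ s, inCh x₀ (Φ i) y := by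
  funext k
  ext v
  simp [inCh, inChart_apply]

theorem dForm_eq_d (Φ : X → Forms n W) (k : ℕ) (x : X) :
    dForm (fun x => Φ x k) x = Forms.d (inCh x Φ) (chartAt (Model n) x x) (k + 1) := rfl

end Forms

section Ring

variable {W : Type*} [NormedRing W] [NormedAlgebra ℝ W]

theorem inCh_eq_pull (x₀ : X) (Φ : X → Forms n W) (y : Model n) :
    inCh x₀ Φ y = Forms.pull (chartD x₀ y) (Φ ((chartAt (Model n) x₀).symm y)) := rfl

theorem inCh_pow (x₀ : X) (Φ : X → Forms n W) (k : ℕ) (y : Model n) :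
    inCh x₀ (fun x => Φ x ^ k) y = inCh x₀ Φ y ^ k := by
  simp only [inCh_eq_pull, map_pow]

end Ring

end Charts

/-! ### Transgression along an affine path of connections, in one frame -/

namespace Forms

variable {n : ℕ} {W V : Type*} [NormedRing W] [NormedAlgebra ℝ W]
  [NormedAddCommGroup V] [NormedSpace ℝ V]
  {𝕜 : Type*} [NormedField 𝕜] [NormedSpace 𝕜 W] [SMulCommClass ℝ 𝕜 W] {O : Set (Model n)}

theorem sgn_smul (c : 𝕜) (a : Forms n W) : sgn (c • a) = c • sgn a := by
  funext k
  exact smul_comm ((-1 : ℤ) ^ k) c (a k)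

theorem Smooth.insertForm {γ U G b : Model n → Forms n W} (hγ : Smooth O γ) (hU : Smooth O U)
    (hG : Smooth O G) (hb : Smooth O b) (f : W →L[ℝ] V) (l k : ℕ) :
    Smooth O (fun y => insertForm f (γ y) (U y) (G y) (b y) l k) :=
  ((hγ.mul (((hG.pow l).mul hb).mul (hG.pow k))).mul hU).mapL f

theorem Smooth.csForm {γ U b : Model n → Forms n W} {M : ℕ} {G : Fin M → Model n → Forms n W}
    (hγ : Smooth O γ) (hU : Smooth O U) (hG : ∀ i, Smooth O (G i)) (hb : Smooth O b)
    (f : W →L[ℝ] V) (N : ℕ) (z : ℕ → 𝕜) (q : Fin M → ℝ) :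
    Smooth O (fun y => csForm f N z q (γ y) (U y) (b y) (fun i => G i y)) :=
  Smooth.sum _ fun i _ => Smooth.const_smul (Smooth.sum _ fun _ _ => Smooth.sum _ fun _ _ =>
    hγ.insertForm hU (hG i) (hb.const_smul _) f _ _) _

theorem curv_add_smul (hO : IsOpen O) {A a : Model n → Alt n 1 W} (hA : ContDiffOn ℝ ∞ A O)
    (ha : ContDiffOn ℝ ∞ a O) {y : Model n} (hy : y ∈ O) (t : ℝ) :
    curv (fun y => A y + t • a y) y = curv A y
      + t • (d (fun y => ofDeg 1 (a y)) y + ofDeg 1 (A y) * ofDeg 1 (a y)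
        + ofDeg 1 (a y) * ofDeg 1 (A y))
      + t ^ 2 • (ofDeg 1 (a y) * ofDeg 1 (a y)) := by
  have h1 : ∀ y, ofDeg 1 (A y + t • a y) = ofDeg 1 (A y) + t • ofDeg 1 (a y) := fun y => by
    rw [ofDeg, Pi.single_add, Pi.single_smul]
  have hA' := (Smooth.ofDeg hA).diffAt hO hy
  have ha' := (Smooth.ofDeg ha).diffAt hO hy
  have hta := ((Smooth.ofDeg ha).const_smul t).diffAt hO hy
  unfold curv
  simp only [h1]
  rw [d_add hA' hta, d_const_smul ha']
  simp only [add_mul, mul_add, smul_mul_assoc, mul_smul_comm, smul_smul, smul_add, pow_two]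
  abel

variable [IsScalarTower 𝕜 W W] [SMulCommClass 𝕜 W W]

/-- Transgression: along a path of connections, Chern--Weil forms change by an exact form. -/
theorem cwForm_sub_eq_d_csForm (f : W →L[ℝ] V) (hf : ∀ w z, f (w * z) = f (z * w))
    (hO : IsOpen O) {γ U : Model n → Forms n W} (hγ : Smooth O γ) (hU : Smooth O U)
    {A a : Model n → Alt n 1 W} (hA : ContDiffOn ℝ ∞ A O) (ha : ContDiffOn ℝ ∞ a O) (c : 𝕜)
    (N : ℕ) (z : ℕ → 𝕜) {M : ℕ} (hM : 2 * N ≤ M) {q t : Fin M → ℝ}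
    (hq : ∀ k < M, ((k : ℝ) + 1) * ∑ i, q i * t i ^ k = 1) {y : Model n} (hy : y ∈ O)
    (hdγ : d γ y = 0) (hsγ : sgn (γ y) = γ y) (hcγ : ∀ k v w, w * γ y k v = γ y k v * w)
    (hdU : d U y = 0) (hcU : ∀ k v w, w * U y k v = U y k v * w) :
    cwForm f N z (γ y) (U y) (c • curv (fun y => A y + (1 : ℝ) • a y) y)
      - cwForm f N z (γ y) (U y) (c • curv A y) =
    d (fun y => csForm f N z q (γ y) (U y) (c • ofDeg 1 (a y))
      (fun i => c • curv (fun y => A y + t i • a y) y)) y := by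
  have hAt : ∀ s : ℝ, ContDiffOn ℝ ∞ (fun y => A y + s • a y) O := fun s =>
    hA.add (ha.const_smul s)
  have hcomm : SMulCommClass 𝕜 ℝ (Forms n W) := SMulCommClass.symm ℝ 𝕜 (Forms n W)
  have hG : ∀ s : ℝ, Smooth O (fun y => c • curv (fun y => A y + s • a y) y) := fun s =>
    (Smooth.curv hO (hAt s)).const_smul c
  have hsa := Smooth.ofDeg ha
  have hb : Smooth O (fun y => c • ofDeg 1 (a y)) := hsa.const_smul c
  let B : Forms n W := c • (d (fun y => ofDeg 1 (a y)) y + ofDeg 1 (A y) * ofDeg 1 (a y)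
        + ofDeg 1 (a y) * ofDeg 1 (A y))
  let C : Forms n W := c • (ofDeg 1 (a y) * ofDeg 1 (a y))
  have hF : ∀ s : ℝ, c • curv (fun y => A y + s • a y) y = c • curv A y + s • B + s ^ 2 • C := by
    intro s
    rw [curv_add_smul hO hA ha hy s, smul_add, smul_add, smul_comm c s, smul_comm c (s ^ 2)]
  have hF1 : c • curv (fun y => A y + (1 : ℝ) • a y) y = c • curv A y + B + C := by
    rw [hF 1, one_pow, one_smul, one_smul]
  rw [hF1, cwForm_sub_cwForm f N z hM hq (γ y) (U y) (c • curv A y) B C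
    (fun i => c • curv (fun y => A y + t i • a y) y) (fun i => B + (2 * t i) • C)
    (fun i => hF (t i)) (fun i => rfl)]
  unfold csForm
  have hins : ∀ i j l k, Smooth O (fun y => insertForm f (γ y) (U y)
      (c • curv (fun y => A y + t i • a y) y) (z j • c • ofDeg 1 (a y)) l k) := fun i j l k =>
    hγ.insertForm hU (hG (t i)) (hb.const_smul (z j)) f l k
  rw [d_sum _ fun i _ => ((Smooth.sum _ fun j _ => Smooth.sum _ fun l _ =>
    hins i j l (j - 1 - l)).const_smul (q i)).diffAt hO hy]
  refine Finset.sum_congr rfl fun i _ => ?_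
  rw [d_const_smul ((Smooth.sum _ fun j _ => Smooth.sum _ fun l _ =>
    hins i j l (j - 1 - l)).diffAt hO hy)]
  congr 1
  rw [d_sum _ fun j _ => (Smooth.sum _ fun l _ => hins i j l (j - 1 - l)).diffAt hO hy]
  refine Finset.sum_congr rfl fun j _ => ?_
  rw [d_sum _ fun l _ => (hins i j l (j - 1 - l)).diffAt hO hy]
  refine Finset.sum_congr rfl fun l _ => ?_
  symm
  have hat : ofDeg 1 (A y + t i • a y) = ofDeg 1 (A y) + t i • ofDeg 1 (a y) := by
    rw [ofDeg, Pi.single_add, Pi.single_smul]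
  refine d_insertForm f hf hO hγ hU (hG (t i)) (hb.const_smul (z j)) hy (A y + t i • a y)
    hdγ hsγ hcγ hdU hcU ?_ ?_ ?_ ?_ l (j - 1 - l)
  · rw [sgn_smul, curv_eq_ofDeg, sgn_ofDeg_two]
  · rw [d_const_smul ((Smooth.curv hO (hAt (t i))).diffAt hO hy), d_curv hO (hAt (t i)) hy,
      smul_mul_assoc, mul_smul_comm, smul_sub]
  · rw [sgn_smul, sgn_smul, sgn_ofDeg_one, smul_neg, smul_neg]
  -- With A_t = A + ta, the form da + A_t ∧ a + a ∧ A_t contains t a ∧ a twice; this is the factor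
  -- 2t in front of C.
  · rw [d_const_smul (hb.diffAt hO hy), d_const_smul (hsa.diffAt hO hy), hat]
    simp only [B, C]
    generalize d (fun y => ofDeg 1 (a y)) y = D
    generalize ofDeg 1 (a y) = β
    generalize ofDeg 1 (A y) = α
    have e : ∀ (s : ℝ) (x : Forms n W), s • c • x = c • s • x := fun s x => smul_comm s c x
    simp only [mul_smul_comm, smul_mul_assoc, e, ← smul_add, ← smul_sub]
    congr 2
    simp only [add_mul, mul_add, smul_mul_assoc, mul_smul_comm, two_mul, add_smul]
    abel

/-- Conjugation invariance of the transgression form. -/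
theorem csForm_of_semiconj (f : W →L[ℝ] V) (hf : ∀ w z, f (w * z) = f (z * w)) {g g' : W}
    (hg : g * g' = 1) (hg' : g' * g = 1) {γ U b b' : Forms n W} {M : ℕ} {G G' : Fin M → Forms n W}
    (hcγ : ∀ k v w, w * γ k v = γ k v * w) (hcU : ∀ k v w, w * U k v = U k v * w)
    (hb : SemiconjBy (ofConst n g) b b') (hG : ∀ i, SemiconjBy (ofConst n g) (G i) (G' i))
    (N : ℕ) (z : ℕ → 𝕜) (q : Fin M → ℝ) :
    csForm f N z q γ U b' G' = csForm f N z q γ U b G := by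
  have hγ : SemiconjBy (ofConst n g) γ γ := ofConst_mul_of_central g γ hcγ
  have hU : SemiconjBy (ofConst n g) U U := ofConst_mul_of_central g U hcU
  unfold csForm insertForm
  refine Finset.sum_congr rfl fun i _ => congrArg _ <| Finset.sum_congr rfl fun j _ =>
    Finset.sum_congr rfl fun l _ => mapL_eq_of_semiconj f hf hg hg' ?_
  refine (hγ.mul_right ((((hG i).pow_right l).mul_right ?_).mul_right ((hG i).pow_right _))).mul_right
    hU
  unfold SemiconjBy
  rw [mul_smul_comm, smul_mul_assoc, hb.eq]

/-- Conjugation of Chern--Weil integrands. -/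
theorem semiconj_cw {g : W} {γ U G G' : Forms n W}
    (hcγ : ∀ k v w, w * γ k v = γ k v * w) (hcU : ∀ k v w, w * U k v = U k v * w)
    (hG : SemiconjBy (ofConst n g) G G') (N : ℕ) (z : ℕ → 𝕜) :
    SemiconjBy (ofConst n g) (γ * (∑ j ∈ Finset.range N, z j • G ^ j) * U)
      (γ * (∑ j ∈ Finset.range N, z j • G' ^ j) * U) := by
  have hγ : SemiconjBy (ofConst n g) γ γ := ofConst_mul_of_central g γ hcγ
  have hU : SemiconjBy (ofConst n g) U U := ofConst_mul_of_central g U hcU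
  refine (hγ.mul_right ?_).mul_right hU
  unfold SemiconjBy
  rw [Finset.mul_sum, Finset.sum_mul]
  refine Finset.sum_congr rfl fun j _ => ?_
  rw [mul_smul_comm, smul_mul_assoc, (hG.pow_right j).eq]

end Forms


/-! ### Central forms -/

namespace Forms

variable {n : ℕ} {W : Type*} [NormedRing W] [NormedAlgebra ℝ W]

/-- Forms with central coefficients. -/
def IsCentral (a : Forms n W) : Prop :=
  ∀ k v w, w * a k v = a k v * w

theorem isCentral_iff {a : Forms n W} :
    IsCentral a ↔ ∀ w, ofConst n w * a = a * ofConst n w := by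
  constructor
  · intro h w
    exact ofConst_mul_of_central w a h
  · intro h k v w
    have h1 := congrArg (fun b : Forms n W => b k v) (h w)
    simp only [ofConst_mul_apply, mul_ofConst_apply] at h1
    exact h1

theorem IsCentral.pow {a : Forms n W} (ha : IsCentral a) (k : ℕ) : IsCentral (a ^ k) := by
  rw [isCentral_iff] at *
  intro w
  exact (Commute.pow_right (ha w) k)

theorem IsCentral.sum {κ : Type*} (s : Finset κ) {a : κ → Forms n W}
    (h : ∀ i ∈ s, IsCentral (a i)) : IsCentral (∑ i ∈ s, a i) := by
  rw [isCentral_iff]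
  intro w
  rw [Finset.mul_sum, Finset.sum_mul]
  exact Finset.sum_congr rfl fun i hi => isCentral_iff.1 (h i hi) w

theorem IsCentral.smul {𝕜 : Type*} [NormedField 𝕜] [NormedSpace 𝕜 W] [SMulCommClass ℝ 𝕜 W]
    [IsScalarTower 𝕜 W W] [SMulCommClass 𝕜 W W] {a : Forms n W} (ha : IsCentral a) (c : 𝕜) :
    IsCentral (c • a) := by
  rw [isCentral_iff] at *
  intro w
  rw [mul_smul_comm, smul_mul_assoc, ha]

variable (W) in
/-- Multiples of the identity, as a real-linear map. -/
def scalarL : ℝ →L[ℝ] W := (ContinuousLinearMap.id ℝ ℝ).smulRight (1 : W)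

theorem scalarL_apply (t : ℝ) : scalarL W t = t • (1 : W) := rfl

theorem isCentral_mapL_scalarL (a : Forms n ℝ) : IsCentral (mapL (scalarL W) a) := by
  intro k v w
  rw [mapL_apply, scalarL_apply, mul_smul_comm, smul_mul_assoc, mul_one, one_mul]

theorem mapL_ofDeg {V V' : Type*} [NormedAddCommGroup V] [NormedSpace ℝ V]
    [NormedAddCommGroup V'] [NormedSpace ℝ V'] (f : V →L[ℝ] V') (k : ℕ) (a : Alt n k V) :
    mapL f (ofDeg k a) = ofDeg k (f.compContinuousAlternatingMap a) := by
  funext j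
  by_cases h : j = k
  · subst h
    rw [ofDeg_same]; ext1 v; rw [mapL_apply, ofDeg_same]; rfl
  · rw [ofDeg_of_ne h]; ext1 v; rw [mapL_apply, ofDeg_of_ne h]; simp

variable {V : Type*} [NormedAddCommGroup V] [NormedSpace ℝ V]
  {𝕜 : Type*} [NormedField 𝕜] [NormedSpace 𝕜 W] [SMulCommClass ℝ 𝕜 W]

theorem pull_smul (L : Model n →L[ℝ] Model n) (c : 𝕜) (a : Forms n W) :
    pull L (c • a) = c • pull L a := rfl

/-- Pullback of inhomogeneous forms under a linear map, as a linear map. -/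
def pullL (L : Model n →L[ℝ] Model n) : Forms n V →ₗ[ℝ] Forms n V where
  toFun a := fun k => (a k).compContinuousLinearMap L
  map_add' _ _ := rfl
  map_smul' _ _ := rfl

theorem pullL_mapL (L : Model n →L[ℝ] Model n) (f : W →L[ℝ] V) (a : Forms n W) :
    pullL L (mapL f a) = mapL f (pull L a) := rfl

/-- Naturality of the transgression form. -/
theorem pullL_csForm (L : Model n →L[ℝ] Model n) (f : W →L[ℝ] V) (N : ℕ) (z : ℕ → 𝕜) {M : ℕ}
    (q : Fin M → ℝ) (γ U b : Forms n W) (G : Fin M → Forms n W) :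
    pullL L (csForm f N z q γ U b G) =
      csForm f N z q (pull L γ) (pull L U) (pull L b) (fun i => pull L (G i)) := by
  unfold csForm insertForm
  simp only [map_sum, map_smul, pullL_mapL, map_mul, map_pow, pull_smul]

theorem pullL_cwForm (L : Model n →L[ℝ] Model n) (f : W →L[ℝ] V) (N : ℕ) (z : ℕ → 𝕜)
    (γ U G : Forms n W) :
    pullL L (cwForm f N z γ U G) = cwForm f N z (pull L γ) (pull L U) (pull L G) := by
  unfold cwForm
  simp only [pullL_mapL, map_mul, map_sum, map_pow, pull_smul]

end Forms

/-! ### Connections in local frames -/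

section Frames

variable {n : ℕ} {X : Type*} [TopologicalSpace X] [ChartedSpace (Model n) X]
  {W : Type*} [NormedRing W] [NormedAlgebra ℝ W] {ι : Type*}

variable (n X W ι) in
/-- Local frames of a bundle whose endomorphisms are modelled on the algebra `W`, with invertible
smooth transition functions. -/
structure LocalFrames where
  baseSet : ι → Set X
  isOpen_baseSet : ∀ i, IsOpen (baseSet i)
  indexAt : X → ι
  mem_baseSet_at : ∀ x, x ∈ baseSet (indexAt x)
  g : ι → ι → X → W
  g_mul : ∀ i j, ∀ x ∈ baseSet i ∩ baseSet j, g i j x * g j i x = 1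
  smooth_g : ∀ i j, ContMDiffOn 𝓘(ℝ, Model n) 𝓘(ℝ, W) ∞ (g i j) (baseSet i ∩ baseSet j)

/-- Connection forms in local frames. -/
structure LocalConnection (F : LocalFrames n X W ι) where
  form : ι → DForm n X 1 W
  smooth : ∀ i, SmoothOn (form i) (F.baseSet i)
  gauge : ∀ i j, ∀ x ∈ F.baseSet i ∩ F.baseSet j, ∀ v : Model n,
    let dg : Model n →L[ℝ] W := mfderiv 𝓘(ℝ, Model n) 𝓘(ℝ, W) (F.g i j) x
    form j x (fun _ => v) * F.g i j x + dg v = F.g i j x * form i x (fun _ => v)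

/-- The curvature `dA + A ∧ A` of a connection form. -/
def curvOf (A : DForm n X 1 W) : DForm n X 2 W := fun x => dForm A x + wedge (A x) (A x) rfl

/-- The affine path between two connections. -/
def LocalConnection.path {F : LocalFrames n X W ι} (D₀ D₁ : LocalConnection F) (t : ℝ) :
    LocalConnection F where
  form i x := D₀.form i x + t • (D₁.form i x - D₀.form i x)
  smooth i x₀ := by
    have h := ((D₀.smooth i) x₀).add ((((D₁.smooth i) x₀).sub ((D₀.smooth i) x₀)).const_smul t)
    exact h
  gauge i j x hx v := by
    intro dg
    have h0 := D₀.gauge i j x hx v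
    have h1 := D₁.gauge i j x hx v
    simp only at h0 h1
    change _ + dg v = _ at h0
    change _ + dg v = _ at h1
    have h0' := eq_sub_of_add_eq h0
    have h1' := eq_sub_of_add_eq h1
    change (D₀.form j x _ + t • (D₁.form j x _ - D₀.form j x _)) * _ + dg v =
      _ * (D₀.form i x _ + t • (D₁.form i x _ - D₀.form i x _))
    rw [add_mul, mul_add, smul_mul_assoc, mul_smul_comm, sub_mul, mul_sub, h0', h1',
      sub_sub_sub_cancel_right]
    abel

/-- The difference of two connections. -/
def LocalConnection.diff {F : LocalFrames n X W ι} (D₀ D₁ : LocalConnection F) (i : ι) :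
    DForm n X 1 W := fun x => D₁.form i x - D₀.form i x

theorem SmoothOn.mono {V : Type*} [NormedAddCommGroup V] [NormedSpace ℝ V] {k : ℕ}
    {η : DForm n X k V} {S T : Set X} (h : SmoothOn η S) (hT : T ⊆ S) : SmoothOn η T :=
  fun x₀ => (h x₀).mono fun _ hy => ⟨hy.1, hT hy.2⟩

theorem LocalConnection.smooth_diff {F : LocalFrames n X W ι} (D₀ D₁ : LocalConnection F) (i : ι) :
    SmoothOn (D₀.diff D₁ i) (F.baseSet i) := fun x₀ =>
  ((D₁.smooth i) x₀).sub ((D₀.smooth i) x₀)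

/-- The inhomogeneous term dg of the gauge relation is the same for both connections and cancels. So
the difference is an endomorphism-valued form, though the connection forms are not. -/
theorem LocalConnection.semiconj_diff {F : LocalFrames n X W ι} (D₀ D₁ : LocalConnection F)
    {i j : ι} {x : X} (hx : x ∈ F.baseSet i ∩ F.baseSet j) :
    SemiconjBy (Forms.ofConst n (F.g i j x)) (Forms.ofDeg 1 (D₀.diff D₁ i x))
      (Forms.ofDeg 1 (D₀.diff D₁ j x)) := by
  funext k
  ext v
  rw [Forms.ofConst_mul_apply, Forms.mul_ofConst_apply]
  by_cases hk : k = 1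
  · subst hk
    rw [Forms.ofDeg_same, Forms.ofDeg_same]
    have hv : v = fun _ => v 0 := by funext a; rw [Subsingleton.elim a 0]
    rw [hv]
    have h0 := D₀.gauge i j x hx (v 0)
    have h1 := D₁.gauge i j x hx (v 0)
    simp only at h0 h1
    change F.g i j x * (D₁.form i x _ - D₀.form i x _) = (D₁.form j x _ - D₀.form j x _) * F.g i j x
    rw [mul_sub, ← h0, ← h1, sub_mul]
    abel
  · rw [Forms.ofDeg_of_ne hk, Forms.ofDeg_of_ne hk]
    simp

variable [IsManifold 𝓘(ℝ, Model n) ∞ X]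

theorem ofDeg_curvOf_inChart {A : DForm n X 1 W} {S : Set X} (hA : SmoothOn A S) (hS : IsOpen S)
    {x₀ : X} {y : Model n} (hy : y ∈ chartSet n x₀ S) :
    inCh x₀ (fun x => Forms.ofDeg 2 (curvOf A x)) y = Forms.curv (inChart x₀ A) y := by
  rw [inCh_ofDeg, Forms.curv_eq_ofDeg, extDeriv_inChart hA hS hy]
  congr 1
  rw [inChart_apply, inChart_apply, inChart_apply, ← wedge_compContinuousLinearMap]
  rfl

/-- The transition functions in a chart are smooth. -/
theorem LocalFrames.contDiffOn_g (F : LocalFrames n X W ι) (i j : ι) (x₀ : X) :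
    ContDiffOn ℝ ∞ (fun y => F.g i j ((chartAt (Model n) x₀).symm y))
      (chartSet n x₀ (F.baseSet i ∩ F.baseSet j)) := by
  rw [← contMDiffOn_iff_contDiffOn]
  refine (F.smooth_g i j).comp (t := F.baseSet i ∩ F.baseSet j) ?_ fun y hy => hy.2
  exact (contMDiffOn_chart_symm (I := 𝓘(ℝ, Model n))).mono fun y hy => hy.1

theorem LocalConnection.gauge_inChart {F : LocalFrames n X W ι} (D : LocalConnection F) (i j : ι)
    {x₀ : X} {y : Model n} (hy : y ∈ chartSet n x₀ (F.baseSet i ∩ F.baseSet j)) (v : Model n) :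
    inChart x₀ (D.form j) y (fun _ => v) * F.g i j ((chartAt (Model n) x₀).symm y)
      + fderiv ℝ (fun y => F.g i j ((chartAt (Model n) x₀).symm y)) y v =
    F.g i j ((chartAt (Model n) x₀).symm y) * inChart x₀ (D.form i) y (fun _ => v) := by
  have h := D.gauge i j _ hy.2 (chartD x₀ y v)
  simp only at h
  have hS := (F.isOpen_baseSet i).inter (F.isOpen_baseSet j)
  have hg : MDifferentiableAt 𝓘(ℝ, Model n) 𝓘(ℝ, W) (F.g i j) ((chartAt (Model n) x₀).symm y) :=
    ((F.smooth_g i j).contMDiffAt (hS.mem_nhds hy.2)).mdifferentiableAt (by simp)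
  have hc : fderiv ℝ (fun y => F.g i j ((chartAt (Model n) x₀).symm y)) y v =
      (mfderiv 𝓘(ℝ, Model n) 𝓘(ℝ, W) (F.g i j) ((chartAt (Model n) x₀).symm y) :
        Model n →L[ℝ] W) (chartD x₀ y v) := by
    rw [← mfderiv_eq_fderiv]
    have := mfderiv_comp y hg (mdifferentiableAt_chart_symm hy.1)
    exact congrArg (fun L : Model n →L[ℝ] W => L v) this
  rw [hc]
  exact h

/-- Gauge covariance of the curvature. -/
theorem LocalConnection.semiconj_curvOf {F : LocalFrames n X W ι} (D : LocalConnection F)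
    {i j : ι} {x : X} (hx : x ∈ F.baseSet i ∩ F.baseSet j) :
    SemiconjBy (Forms.ofConst n (F.g i j x)) (Forms.ofDeg 2 (curvOf (D.form i) x))
      (Forms.ofDeg 2 (curvOf (D.form j) x)) := by
  have hS := (F.isOpen_baseSet i).inter (F.isOpen_baseSet j)
  have hy := mem_chartSet_self (n := n) x hx
  have hi := ((D.smooth i).mono (T := F.baseSet i ∩ F.baseSet j) Set.inter_subset_left)
  have hj := ((D.smooth j).mono (T := F.baseSet i ∩ F.baseSet j) Set.inter_subset_right)
  have h := Forms.curv_gauge (isOpen_chartSet x hS) (hi.contDiffOn x) (hj.contDiffOn x)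
    (F.contDiffOn_g i j x) (fun y hy v => D.gauge_inChart i j hy v) hy
  rw [← ofDeg_curvOf_inChart hi hS hy, ← ofDeg_curvOf_inChart hj hS hy, inCh_ofDeg, inCh_ofDeg,
    inChart_self, inChart_self, (chartAt (Model n) x).left_inv (mem_chart_source _ x)] at h
  exact h

end Frames


/-! ### Global transgression -/

section Transgression

variable {n : ℕ} {X : Type*} [TopologicalSpace X] [ChartedSpace (Model n) X]
  {W V : Type*} [NormedRing W] [NormedAlgebra ℝ W] [NormedAddCommGroup V] [NormedSpace ℝ V]

/-- Smoothness of a field of inhomogeneous forms. -/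
def FormsSmooth (Φ : X → Forms n V) : Prop := ∀ k, SmoothOn (fun x => Φ x k) Set.univ

theorem FormsSmooth.inCh {Φ : X → Forms n V} (h : FormsSmooth Φ) (x₀ : X) :
    Forms.Smooth (chartSet n x₀ Set.univ) (inCh x₀ Φ) := fun k => (h k).contDiffOn x₀

/-- A global field of forms that is locally given by smooth expressions is smooth. -/
theorem formsSmooth_of_local {ι : Type*} {F : LocalFrames n X W ι} {Φ : X → Forms n V} {Ψ : ι → X → Forms n V}
    (hΨ : ∀ i, ∀ x ∈ F.baseSet i, Φ x = Ψ i x)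
    (hs : ∀ j x₀, Forms.Smooth (chartSet n x₀ (F.baseSet j)) (inCh x₀ (Ψ j))) : FormsSmooth Φ := by
  intro k x₀ y hy
  set i := F.indexAt ((chartAt (Model n) x₀).symm y)
  have hyi : y ∈ chartSet n x₀ (F.baseSet i) := ⟨hy.1, F.mem_baseSet_at _⟩
  have hmem := (isOpen_chartSet (n := n) x₀ (F.isOpen_baseSet i)).mem_nhds hyi
  have h1 := (hs i x₀ k).contDiffAt hmem
  refine (h1.congr_of_eventuallyEq ?_).contDiffWithinAt
  filter_upwards [hmem] with w hw
  change inChart x₀ (fun x => Φ x k) w = inChart x₀ (fun x => Ψ i x k) w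
  rw [inChart_apply, inChart_apply, hΨ i _ hw.2]

variable [IsManifold 𝓘(ℝ, Model n) ∞ X]

theorem inCh_self (Φ : X → Forms n V) (x : X) : inCh x Φ (chartAt (Model n) x x) = Φ x := by
  funext k
  exact inChart_self (fun x => Φ x k) x

/-- A smooth closed field of forms with central coefficients. -/
structure CentralClosed (Φ : X → Forms n W) : Prop where
  smooth : FormsSmooth Φ
  closed : ∀ k, dForm (fun x => Φ x k) = 0
  central : ∀ x, (Φ x).IsCentral

theorem d_inCh {Φ : X → Forms n V} (h : FormsSmooth Φ) {S : Set X} (hc : ∀ k, dForm (fun x => Φ x k) = 0)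
    {x₀ : X} {y : Model n} (hy : y ∈ chartSet n x₀ S) : Forms.d (inCh x₀ Φ) y = 0 := by
  have hy' : y ∈ chartSet n x₀ Set.univ := ⟨hy.1, trivial⟩
  funext k
  cases k with
  | zero => rfl
  | succ k =>
    refine (extDeriv_inChart (h k) isOpen_univ hy').trans ?_
    rw [hc]; rfl

variable {ι : Type*} {F : LocalFrames n X W ι} {𝕜 : Type*} [NormedField 𝕜] [NormedSpace 𝕜 W]
  [SMulCommClass ℝ 𝕜 W]

/-- The Chern--Weil form in the local frame with index `i`. -/
def LocalConnection.cw (D : LocalConnection F) (f : W →L[ℝ] V) (N : ℕ) (z : ℕ → 𝕜) (c : 𝕜)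
    (γ U : X → Forms n W) (i : ι) (x : X) : Forms n V :=
  Forms.cwForm f N z (γ x) (U x) (c • Forms.ofDeg 2 (curvOf (D.form i) x))

/-- The Chern--Simons form in the local frame with index `i`. -/
def LocalConnection.cs (D₀ D₁ : LocalConnection F) (f : W →L[ℝ] V) (N : ℕ) (z : ℕ → 𝕜) (c : 𝕜)
    (γ U : X → Forms n W) {M : ℕ} (q t : Fin M → ℝ) (i : ι) (x : X) : Forms n V :=
  Forms.csForm f N z q (γ x) (U x) (c • Forms.ofDeg 1 (D₀.diff D₁ i x))
    (fun k => c • Forms.ofDeg 2 (curvOf ((D₀.path D₁ (t k)).form i) x))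

variable (f : W →L[ℝ] V) (N : ℕ) (z : ℕ → 𝕜) (c : 𝕜) {γ U : X → Forms n W}

/-- Pullback is a ring homomorphism on inhomogeneous forms and commutes with the formation of
curvature, so a Chern–Weil form in a chart is built from the chart expressions of its ingredients.
-/
theorem LocalConnection.inCh_cw (D : LocalConnection F) (i : ι) {x₀ : X} {y : Model n}
    (hy : y ∈ chartSet n x₀ (F.baseSet i)) :
    inCh x₀ (D.cw f N z c γ U i) y = Forms.cwForm f N z (inCh x₀ γ y) (inCh x₀ U y)
      (c • Forms.curv (inChart x₀ (D.form i)) y) := by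
  rw [← ofDeg_curvOf_inChart (D.smooth i) (F.isOpen_baseSet i) hy, inCh_eq_pull, inCh_eq_pull,
    inCh_eq_pull, ← Forms.pull_smul]
  exact Forms.pullL_cwForm _ _ _ _ _ _ _

theorem LocalConnection.inCh_cs (D₀ D₁ : LocalConnection F) {M : ℕ} (q t : Fin M → ℝ) (i : ι)
    {x₀ : X} {y : Model n} (hy : y ∈ chartSet n x₀ (F.baseSet i)) :
    inCh x₀ (D₀.cs D₁ f N z c γ U q t i) y = Forms.csForm f N z q (inCh x₀ γ y) (inCh x₀ U y)
      (c • Forms.ofDeg 1 (inChart x₀ (D₀.diff D₁ i) y))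
      (fun k => c • Forms.curv (fun y => inChart x₀ (D₀.form i) y
        + t k • inChart x₀ (D₀.diff D₁ i) y) y) := by
  have h : ∀ k, Forms.curv (fun y => inChart x₀ (D₀.form i) y
      + t k • inChart x₀ (D₀.diff D₁ i) y) y = _ := fun k =>
    (ofDeg_curvOf_inChart ((D₀.path D₁ (t k)).smooth i) (F.isOpen_baseSet i) hy).symm
  simp only [h, ← inCh_ofDeg, inCh_eq_pull, ← Forms.pull_smul]
  exact Forms.pullL_csForm _ _ _ _ _ _ _ _ _

theorem LocalConnection.smooth_cw (hγ : FormsSmooth γ) (hU : FormsSmooth U)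
    (D : LocalConnection F) (i : ι) (x₀ : X) :
    Forms.Smooth (chartSet n x₀ (F.baseSet i)) (inCh x₀ (D.cw f N z c γ U i)) := by
  have hO := isOpen_chartSet (n := n) x₀ (F.isOpen_baseSet i)
  have hsub : chartSet n x₀ (F.baseSet i) ⊆ chartSet n x₀ Set.univ := fun y hy => ⟨hy.1, trivial⟩
  have hG := (Forms.Smooth.curv hO ((D.smooth i).contDiffOn x₀)).const_smul c
  exact ((((hγ.inCh x₀).mono hsub).mul (Forms.Smooth.sum _ fun j _ =>
    (hG.pow j).const_smul (z j))).mul ((hU.inCh x₀).mono hsub)).mapL f |>.congr fun y hy =>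
      D.inCh_cw f N z c i hy

variable [IsScalarTower 𝕜 W W] [SMulCommClass 𝕜 W W] {f}

theorem semiconj_smul {g : W} {a b : Forms n W} (h : SemiconjBy (Forms.ofConst n g) a b) :
    SemiconjBy (Forms.ofConst n g) (c • a) (c • b) := by
  unfold SemiconjBy
  rw [mul_smul_comm, smul_mul_assoc, h.eq]

/-- A change of frame conjugates the curvature and leaves the central forms γ and U alone; the
trace-like map f does not see conjugation. -/
theorem LocalConnection.cw_eq (hf : ∀ w z, f (w * z) = f (z * w)) (hγ : ∀ x, (γ x).IsCentral)
    (hU : ∀ x, (U x).IsCentral) (D : LocalConnection F) {i j : ι} {x : X}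
    (hx : x ∈ F.baseSet i ∩ F.baseSet j) : D.cw f N z c γ U j x = D.cw f N z c γ U i x :=
  Forms.mapL_eq_of_semiconj f hf (F.g_mul i j x hx) (F.g_mul j i x hx.symm)
    (Forms.semiconj_cw (hγ x) (hU x) (semiconj_smul c (D.semiconj_curvOf hx)) N z)

theorem LocalConnection.cs_eq (hf : ∀ w z, f (w * z) = f (z * w)) (hγ : ∀ x, (γ x).IsCentral)
    (hU : ∀ x, (U x).IsCentral) (D₀ D₁ : LocalConnection F) {M : ℕ} (q t : Fin M → ℝ) {i j : ι}
    {x : X} (hx : x ∈ F.baseSet i ∩ F.baseSet j) :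
    D₀.cs D₁ f N z c γ U q t j x = D₀.cs D₁ f N z c γ U q t i x :=
  Forms.csForm_of_semiconj f hf (F.g_mul i j x hx) (F.g_mul j i x hx.symm) (hγ x) (hU x)
    (semiconj_smul c (D₀.semiconj_diff D₁ hx))
    (fun k => semiconj_smul c ((D₀.path D₁ (t k)).semiconj_curvOf hx)) N z q

theorem LocalConnection.formsSmooth_cw (hf : ∀ w z, f (w * z) = f (z * w))
    (hγ : CentralClosed γ) (hU : CentralClosed U) (D : LocalConnection F) :
    FormsSmooth fun x => D.cw f N z c γ U (F.indexAt x) x :=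
  formsSmooth_of_local (F := F) (Ψ := D.cw f N z c γ U) (fun _ x hx =>
    D.cw_eq N z c hf hγ.central hU.central ⟨hx, F.mem_baseSet_at x⟩) fun i x₀ =>
      D.smooth_cw f N z c hγ.smooth hU.smooth i x₀

theorem LocalConnection.formsSmooth_cs (hf : ∀ w z, f (w * z) = f (z * w))
    (hγ : CentralClosed γ) (hU : CentralClosed U) (D₀ D₁ : LocalConnection F) {M : ℕ}
    (q t : Fin M → ℝ) :
    FormsSmooth fun x => D₀.cs D₁ f N z c γ U q t (F.indexAt x) x := by
  refine formsSmooth_of_local (F := F) (Ψ := D₀.cs D₁ f N z c γ U q t) (fun _ x hx =>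
    D₀.cs_eq N z c hf hγ.central hU.central D₁ q t ⟨hx, F.mem_baseSet_at x⟩) fun i x₀ => ?_
  have hO := isOpen_chartSet (n := n) x₀ (F.isOpen_baseSet i)
  have hsub : chartSet n x₀ (F.baseSet i) ⊆ chartSet n x₀ Set.univ := fun y hy => ⟨hy.1, trivial⟩
  have ha := (D₀.smooth_diff D₁ i).contDiffOn x₀
  exact (Forms.Smooth.csForm ((hγ.smooth.inCh x₀).mono hsub) ((hU.smooth.inCh x₀).mono hsub)
    (fun k => (Forms.Smooth.curv hO (((D₀.smooth i).contDiffOn x₀).add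
      (ha.const_smul (t k)))).const_smul c) ((Forms.Smooth.ofDeg ha).const_smul c) f N z q).congr
      fun y hy => D₀.inCh_cs f N z c D₁ q t i hy

/-- The difference of the Chern--Weil forms of two connections is exact. -/
theorem LocalConnection.exists_transgression (hf : ∀ w z, f (w * z) = f (z * w))
    (hγ : CentralClosed γ) (hγs : ∀ x, Forms.sgn (γ x) = γ x) (hU : CentralClosed U)
    (D₀ D₁ : LocalConnection F) :
    ∃ Θ : X → Forms n V, FormsSmooth Θ ∧ ∀ x,
      D₁.cw f N z c γ U (F.indexAt x) x - D₀.cw f N z c γ U (F.indexAt x) x =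
        Forms.d (inCh x Θ) (chartAt (Model n) x x) := by
  -- The powers j < N of the curvature have degree at most 2N − 2 in the path parameter, so 2N nodes
  -- suffice.
  obtain ⟨q, t, hq⟩ := exists_quadrature (2 * N)
  refine ⟨_, D₀.formsSmooth_cs N z c hf hγ hU D₁ q t, fun x => ?_⟩
  set i := F.indexAt x
  have hi : x ∈ F.baseSet i := F.mem_baseSet_at x
  have hO := isOpen_chartSet (n := n) x (F.isOpen_baseSet i)
  have hsub : chartSet n x (F.baseSet i) ⊆ chartSet n x Set.univ := fun y hy => ⟨hy.1, trivial⟩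
  have hy := mem_chartSet_self (n := n) x hi
  have h := Forms.cwForm_sub_eq_d_csForm f hf hO ((hγ.smooth.inCh x).mono hsub)
    ((hU.smooth.inCh x).mono hsub) ((D₀.smooth i).contDiffOn x) ((D₀.smooth_diff D₁ i).contDiffOn x)
    c N z le_rfl hq hy (d_inCh hγ.smooth hγ.closed hy) (by rw [inCh_self, hγs])
    (by rw [inCh_self]; exact hγ.central x) (d_inCh hU.smooth hU.closed hy)
    (by rw [inCh_self]; exact hU.central x)
  have h1 : (fun y => inChart x (D₀.form i) y + (1 : ℝ) • inChart x (D₀.diff D₁ i) y) =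
      inChart x (D₁.form i) := by
    funext y
    rw [one_smul]
    ext v
    exact add_sub_cancel (inChart x (D₀.form i) y v) (inChart x (D₁.form i) y v)
  rw [h1, ← D₁.inCh_cw f N z c i hy, ← D₀.inCh_cw f N z c i hy, inCh_self, inCh_self] at h
  rw [h]
  refine Forms.d_congr ?_
  filter_upwards [hO.mem_nhds hy] with w hw
  rw [← D₀.inCh_cs f N z c D₁ q t i hw]
  funext k
  -- Near x the global form uses the frames of the nearby points, while the local formula keeps the
  -- frame of x. Frame independence makes the two agree.
  have := D₀.cs_eq N z c hf hγ.central hU.central D₁ q t ⟨hw.2, F.mem_baseSet_at _⟩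
  change inChart x _ w = inChart x _ w
  exact congrArg (fun a : Forms n V => (a k).compContinuousLinearMap (chartD x w)) this.symm

end Transgression


/-! ### The forms of a central charge -/

section ChargeForms

variable {n : ℕ} {X : Type*} {W : Type*} [NormedRing W] [NormedAlgebra ℝ W] {𝕜 : Type*} [NormedField 𝕜] [NormedSpace 𝕜 W]
  [SMulCommClass ℝ 𝕜 W]

variable (W) in
/-- The inhomogeneous form `∑ ρ_d ω^d`, with values in an algebra. -/
def gammaForm (rho : Fin (n + 1) → 𝕜) (η : DForm n X 2 ℝ) (x : X) : Forms n W :=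
  ∑ d : Fin (n + 1), rho d •
    Forms.ofDeg 2 ((Forms.scalarL W).compContinuousAlternatingMap (η x)) ^ (d : ℕ)

variable (W) in
/-- An inhomogeneous real form, with values in the multiples of the identity of an algebra. -/
def scalarForm (U : ∀ k, DForm n X k ℝ) (x : X) : Forms n W :=
  Forms.mapL (Forms.scalarL W) fun k => U k x

theorem sgn_gammaForm (rho : Fin (n + 1) → 𝕜) (η : DForm n X 2 ℝ) (x : X) :
    Forms.sgn (gammaForm W rho η x) = gammaForm W rho η x := by
  rw [gammaForm, map_sum]
  refine Finset.sum_congr rfl fun d _ => ?_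
  rw [Forms.sgn_smul, Forms.sgn_pow, Forms.sgn_ofDeg_two]

/-- The density `(∑ ρ_d ω^d) ∧ p(c F) ∧ U`, for a polynomial `p` with coefficients `z`. -/
def cwDensity (N : ℕ) (z : ℕ → 𝕜) (c : 𝕜) (rho : Fin (n + 1) → 𝕜) (η : DForm n X 2 ℝ)
    (U : ∀ k, DForm n X k ℝ) (F : DForm n X 2 W) (x : X) : Forms n W :=
  gammaForm W rho η x * (∑ j ∈ Finset.range N, z j • (c • Forms.ofDeg 2 (F x)) ^ j) *
    scalarForm W U x

/-- A dictionary between the recursively defined products and powers and the ring structure, in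
which the Chern–Weil computation takes place. -/
theorem cwDensity_eq (N : ℕ) (z : ℕ → 𝕜) (c : 𝕜) (rho : Fin (n + 1) → 𝕜) (η : DForm n X 2 ℝ)
    (U : ∀ k, DForm n X k ℝ) (F : DForm n X 2 W) (x : X) :
    Forms.mul (Forms.mul
      (∑ d : Fin (n + 1), rho d •
        Forms.pow (ofTwo ((Forms.scalarL W).compContinuousAlternatingMap (η x))) (d : ℕ))
      (∑ j ∈ Finset.range N, z j • Forms.pow (ofTwo (c • F x)) j))
      (fun k => (Forms.scalarL W).compContinuousAlternatingMap (U k x)) =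
    cwDensity N z c rho η U F x := by
  unfold cwDensity gammaForm scalarForm
  simp only [Forms.pow_def, Forms.mul_def, ofTwo, Forms.ofDeg, Pi.single_smul]
  rfl

variable [TopologicalSpace X] [ChartedSpace (Model n) X]

theorem inCh_gammaForm (rho : Fin (n + 1) → 𝕜) (η : DForm n X 2 ℝ) (x₀ : X) (y : Model n) :
    inCh x₀ (gammaForm W rho η) y = ∑ d : Fin (n + 1), rho d •
      Forms.mapL (Forms.scalarL W) (Forms.ofDeg 2 (inChart x₀ η y)) ^ (d : ℕ) := by
  unfold gammaForm
  rw [inCh_sum]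
  refine Finset.sum_congr rfl fun d _ => ?_
  rw [inCh_smul, inCh_pow, inCh_ofDeg, Forms.mapL_ofDeg]
  rfl

theorem smooth_gammaForm (rho : Fin (n + 1) → 𝕜) {η : DForm n X 2 ℝ} (h : SmoothOn η Set.univ)
    (x₀ : X) : Forms.Smooth (chartSet n x₀ Set.univ) (inCh x₀ (gammaForm W rho η)) := by
  rw [show inCh x₀ (gammaForm W rho η) = _ from funext (inCh_gammaForm rho η x₀)]
  exact Forms.Smooth.sum _ fun d _ => Forms.Smooth.const_smul
    (((Forms.Smooth.ofDeg (h.contDiffOn x₀)).mapL _).pow _) _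

variable [IsManifold 𝓘(ℝ, Model n) ∞ X] [IsScalarTower 𝕜 W W] [SMulCommClass 𝕜 W W]

theorem centralClosed_gammaForm (rho : Fin (n + 1) → 𝕜) {η : DForm n X 2 ℝ}
    (h : SmoothOn η Set.univ) (hd : dForm η = 0) : CentralClosed (gammaForm W rho η) where
  smooth k x₀ := smooth_gammaForm rho h x₀ k
  closed k := by
    funext x
    rw [dForm_eq_d]
    have hO := isOpen_chartSet (n := n) x (isOpen_univ (X := X))
    have hy := mem_chartSet_self (n := n) x (Set.mem_univ x)
    have h0 := Forms.Smooth.ofDeg (h.contDiffOn x)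
    have h1 := h0.mapL (Forms.scalarL W)
    have h2 : Forms.d (fun y => Forms.mapL (Forms.scalarL W) (Forms.ofDeg 2 (inChart x η y)))
        (chartAt (Model n) x x) = 0 := by
      rw [Forms.d_mapL (h0.diffAt hO hy), Forms.d_ofDeg, extDeriv_inChart h isOpen_univ hy, hd]
      have : inChart x (0 : DForm n X 3 ℝ) (chartAt (Model n) x x) = 0 := rfl
      rw [this, Forms.ofDeg, Pi.single_zero, map_zero]
    rw [show inCh x (gammaForm W rho η) = _ from funext (inCh_gammaForm rho η x),
      Forms.d_sum _ fun d _ => ((h1.pow _).const_smul _).diffAt hO hy, Finset.sum_eq_zero]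
    · rfl
    intro d _
    -- The connection form is taken to be zero: powers of a closed even form are closed.
    rw [Forms.d_const_smul ((h1.pow _).diffAt hO hy), Forms.d_pow (a := 0) hO h1 hy
      (by rw [Forms.mapL_ofDeg, Forms.sgn_ofDeg_two]) (by rw [h2, mul_zero, zero_mul, sub_zero]),
      mul_zero, zero_mul, sub_zero, smul_zero]
  central x := Forms.IsCentral.sum _ fun d _ => (Forms.IsCentral.pow (by
    rw [← Forms.mapL_ofDeg]; exact Forms.isCentral_mapL_scalarL _) _).smul _

theorem centralClosed_scalarForm {U : ∀ k, DForm n X k ℝ} (h : ∀ k, SmoothOn (U k) Set.univ)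
    (hd : ∀ k, dForm (U k) = 0) : CentralClosed (scalarForm W U) where
  smooth k x₀ := Forms.Smooth.mapL (η := inCh x₀ (fun x k => U k x)) (fun k => h k x₀)
    (Forms.scalarL W) k
  closed k := by
    funext x
    rw [dForm_eq_d]
    have hO := isOpen_chartSet (n := n) x (isOpen_univ (X := X))
    have hy := mem_chartSet_self (n := n) x (Set.mem_univ x)
    have hs : FormsSmooth fun x k => U k x := h
    have h1 := Forms.d_mapL ((hs.inCh x).diffAt hO hy) (Forms.scalarL W)
    rw [d_inCh hs hd hy, map_zero] at h1
    exact congrFun h1 (k + 1)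
  central x := Forms.isCentral_mapL_scalarL _

end ChargeForms

/-! ### Hermitian bundles -/

section Bundle

variable {n r : ℕ} {X : Type*} [TopologicalSpace X] [ChartedSpace (Model n) X] {ι : Type*}

theorem traceL_mul_comm (S T : EndFib r) : traceL r (S * T) = traceL r (T * S) :=
  LinearMap.trace_mul_comm ℂ (S : Fib r →ₗ[ℂ] Fib r) (T : Fib r →ₗ[ℂ] Fib r)

/-- The unitary frames of a Hermitian bundle. -/
def HermitianBundle.frames (E : HermitianBundle n r X ι) : LocalFrames n X (EndFib r) ι where
  baseSet := E.baseSet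
  isOpen_baseSet := E.isOpen_baseSet
  indexAt := E.indexAt
  mem_baseSet_at := E.mem_baseSet_at
  g := E.coordChange
  g_mul i j x hx := by
    ext1 v
    change E.coordChange i j x (E.coordChange j i x v) = v
    rw [E.coordChange_comp j i j x ⟨⟨hx.2, hx.1⟩, hx.2⟩, E.coordChange_self j x hx.2]
  smooth_g := E.smooth_coordChange

/-- The connection forms of a connection in the unitary frames. -/
def Connection.toLocal {E : HermitianBundle n r X ι} (D : Connection E) :
    LocalConnection E.frames where
  form := D.form
  smooth := D.smooth
  gauge := D.gauge

theorem CentralCharge.density_eq (Z : CentralCharge n X) {E : HermitianBundle n r X ι}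
    (D : Connection E) (x : X) :
    Z.density D x = cwDensity (W := EndFib r) (n + 1) (fun j => (j.factorial : ℂ)⁻¹)
      (Complex.I / (2 * (Real.pi : ℂ))) Z.rho Z.omega.form Z.U
      (curvOf (D.toLocal.form (E.indexAt x))) x :=
  cwDensity_eq (W := EndFib r) (n + 1) (fun j => (j.factorial : ℂ)⁻¹)
      (Complex.I / (2 * (Real.pi : ℂ))) Z.rho Z.omega.form Z.U
      (curvOf (D.toLocal.form (E.indexAt x))) x

end Bundle


/-! ### Forms of top degree -/

section TopForms

variable {n : ℕ} {V : Type*} [NormedAddCommGroup V] [NormedSpace ℝ V]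

/-- An alternating form is determined by its values on injective families of basis vectors. In top
degree these are permutations of the whole basis, so a single value suffices. -/
theorem alt_top_apply (η : Alt n (2 * n) V) (v : Fin (2 * n) → Model n) :
    η v = (realBasis n).det v • η (realBasis n) := by
  let g : Model n [⋀^Fin (2 * n)]→ₗ[ℝ] V :=
    (LinearMap.toSpanSingleton ℝ V (η (realBasis n))).compAlternatingMap (realBasis n).det
  have h : η.toAlternatingMap = g := by
    refine Module.Basis.ext_alternating (realBasis n) fun i hi => ?_
    let σ : Equiv.Perm (Fin (2 * n)) := Equiv.ofBijective i (Finite.injective_iff_bijective.1 hi)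
    change η.toAlternatingMap (realBasis n ∘ σ) = g (realBasis n ∘ σ)
    rw [AlternatingMap.map_perm, AlternatingMap.map_perm]
    congr 1
    change η (realBasis n) = (realBasis n).det (realBasis n) • η (realBasis n)
    rw [Module.Basis.det_self, one_smul]
  exact congrArg (fun f => f v) h

theorem alt_top_comp (η : Alt n (2 * n) V) (L : Model n →L[ℝ] Model n)
    (v : Fin (2 * n) → Model n) : η.compContinuousLinearMap L v = L.det • η v := by
  rw [ContinuousAlternatingMap.compContinuousLinearMap_apply, alt_top_apply, alt_top_apply η v,
    smul_smul]
  congr 1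
  exact Module.Basis.det_comp (realBasis n) (L : Model n →ₗ[ℝ] Model n) v

/-- The real determinant is the norm from ℂ to ℝ of the complex one. This is why holomorphic charts
are compatible with one orientation. -/
theorem det_restrictScalars_eq (L : Model n →L[ℂ] Model n) :
    (L.restrictScalars ℝ).det = Complex.normSq L.det := by
  have := LinearMap.det_restrictScalars (R := ℝ) (S := ℂ) (f := (L : Model n →ₗ[ℂ] Model n))
  rw [Algebra.norm_complex_apply] at this
  exact this

end TopForms

/-! ### Orientation of charts -/

section Orientation

variable {n : ℕ} {X : Type*} [TopologicalSpace X] [ChartedSpace (Model n) X]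
  [IsManifold 𝓘(ℂ, Model n) ω X] {x₀ x₁ : X} {y : Model n}

theorem differentiableAt_tau (h : y ∈ chartSet n x₀ (chartAt (Model n) x₁).source) :
    DifferentiableAt ℂ (tau x₀ x₁) y := by
  have h1 : ContDiffOn ℂ ω (𝓘(ℂ, Model n) ∘ ((chartAt (Model n) x₀).symm ≫ₕ
      chartAt (Model n) x₁) ∘ 𝓘(ℂ, Model n).symm) (𝓘(ℂ, Model n).symm ⁻¹'
        ((chartAt (Model n) x₀).symm ≫ₕ chartAt (Model n) x₁).source ∩
          Set.range 𝓘(ℂ, Model n)) :=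
    ((contDiffGroupoid ω 𝓘(ℂ, Model n)).compatible (chart_mem_atlas _ x₀)
      (chart_mem_atlas _ x₁)).1
  have h2 : ContDiffOn ℂ ω (tau x₀ x₁) (chartSet n x₀ (chartAt (Model n) x₁).source) := by
    refine (h1.mono fun z hz => ?_)
    simpa [chartSet] using hz
  exact (h2.contDiffAt ((isOpen_chartSet x₀ (chartAt (Model n) x₁).open_source).mem_nhds
    h)).differentiableAt (by simp)

theorem fderiv_tau_eq (h : y ∈ chartSet n x₀ (chartAt (Model n) x₁).source) :
    fderiv ℝ (tau x₀ x₁) y = (fderiv ℂ (tau x₀ x₁) y).restrictScalars ℝ :=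
  (differentiableAt_tau h).fderiv_restrictScalars ℝ

theorem fderiv_tau_comp (h : y ∈ chartSet n x₀ (chartAt (Model n) x₁).source) :
    (fderiv ℝ (tau x₁ x₀) (tau x₀ x₁ y)).comp (fderiv ℝ (tau x₀ x₁) y) =
      ContinuousLinearMap.id ℝ (Model n) := by
  have h' : tau x₀ x₁ y ∈ chartSet n x₁ (chartAt (Model n) x₀).source :=
    tau_mem_chartSet h ((chartAt (Model n) x₀).map_target h.1)
  rw [← fderiv_comp y ((contDiffAt_tau h').differentiableAt (by simp))
    ((contDiffAt_tau h).differentiableAt (by simp))]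
  have : tau x₁ x₀ ∘ tau x₀ x₁ =ᶠ[nhds y] id := by
    filter_upwards [(isOpen_chartSet x₀ (chartAt (Model n) x₁).open_source).mem_nhds h] with z hz
    change chartAt (Model n) x₀ ((chartAt (Model n) x₁).symm (tau x₀ x₁ z)) = z
    rw [tau_symm hz, (chartAt (Model n) x₀).right_inv hz.1]
  rw [this.fderiv_eq, fderiv_id]

/-- The determinant is a squared modulus, hence nonnegative, and it is nonzero because the inverse
transition map inverts the derivative. -/
theorem det_fderiv_tau_pos (h : y ∈ chartSet n x₀ (chartAt (Model n) x₁).source) :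
    0 < (fderiv ℝ (tau x₀ x₁) y).det := by
  have h1 : 0 ≤ (fderiv ℝ (tau x₀ x₁) y).det := by
    rw [fderiv_tau_eq h, det_restrictScalars_eq]
    exact Complex.normSq_nonneg _
  refine lt_of_le_of_ne h1 fun h0 => ?_
  have h2 := congrArg ContinuousLinearMap.det (fderiv_tau_comp h)
  have h3 : ((fderiv ℝ (tau x₁ x₀) (tau x₀ x₁ y)).comp (fderiv ℝ (tau x₀ x₁) y)).det =
      (fderiv ℝ (tau x₁ x₀) (tau x₀ x₁ y)).det * (fderiv ℝ (tau x₀ x₁) y).det :=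
    LinearMap.det_comp _ _
  rw [h3, ← h0, mul_zero] at h2
  have h4 : (ContinuousLinearMap.id ℝ (Model n)).det = 1 := LinearMap.det_id
  rw [h4] at h2
  exact zero_ne_one h2

end Orientation

/-! ### Integration in a chart -/

section LocalIntegral

variable {n : ℕ} {X : Type*} [TopologicalSpace X] [ChartedSpace (Model n) X]
  {V : Type*} [NormedAddCommGroup V] [NormedSpace ℝ V] {k : ℕ}

/-- Continuity of a form. -/
def ContForm (η : DForm n X k V) : Prop :=
  ∀ x₀ : X, ContinuousOn (inChart x₀ η) (chartAt (Model n) x₀).target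

theorem SmoothOn.contForm {η : DForm n X k V} (h : SmoothOn η Set.univ) : ContForm η := fun x₀ => by
  have := (h.contDiffOn x₀).continuousOn
  rwa [chartSet_univ] at this

theorem ContForm.add {η θ : DForm n X k V} (h : ContForm η) (h' : ContForm θ) :
    ContForm fun x => η x + θ x := fun x₀ => (h x₀).add (h' x₀)

theorem ContForm.smul {h : X → ℝ} (hh : Continuous h) {η : DForm n X k V} (hη : ContForm η) :
    ContForm fun x => h x • η x := fun x₀ =>
  (hh.comp_continuousOn (chartAt (Model n) x₀).continuousOn_symm).smul (hη x₀)

theorem ContForm.map {V' : Type*} [NormedAddCommGroup V'] [NormedSpace ℝ V'] (f : V →L[ℝ] V')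
    {η : DForm n X k V} (h : ContForm η) :
    ContForm fun x => f.compContinuousAlternatingMap (η x) := fun x₀ =>
  (ContinuousLinearMap.continuous (ContinuousLinearMap.compContinuousAlternatingMapCLM ℝ (Model n) V
    V' (Fin k) f)).comp_continuousOn (h x₀)

/-- The form vanishes outside a compact subset of the domain of the chart at `a`. -/
def SuppIn (a : X) (η : DForm n X k V) : Prop :=
  ∃ K : Set X, IsCompact K ∧ K ⊆ (chartAt (Model n) a).source ∧ ∀ x ∉ K, η x = 0

/-- The integral of a form of top degree over the domain of the chart at `a`. -/
def localInt (a : X) (η : DForm n X (2 * n) V) : V :=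
  ∫ y in (chartAt (Model n) a).target, inChart a η y (realBasis n) ∂(realBasis n).addHaar

/-- The coefficient is continuous on the chart target and vanishes off the image of a compact set
contained in it. -/
theorem integrableOn_coef {a : X} {η : DForm n X (2 * n) V} (h : ContForm η) (hs : SuppIn a η) :
    MeasureTheory.IntegrableOn (fun y => inChart a η y (realBasis n)) (chartAt (Model n) a).target
      (realBasis n).addHaar := by
  obtain ⟨K, hK, hKs, h0⟩ := hs
  have hK' : IsCompact (chartAt (Model n) a '' K) :=
    hK.image_of_continuousOn ((chartAt (Model n) a).continuousOn.mono hKs)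
  have hsub : chartAt (Model n) a '' K ⊆ (chartAt (Model n) a).target := by
    rintro _ ⟨x, hx, rfl⟩
    exact (chartAt (Model n) a).map_source (hKs hx)
  have hc : ContinuousOn (fun y => inChart a η y (realBasis n)) (chartAt (Model n) a).target :=
    (ContinuousLinearMap.continuous (ContinuousAlternatingMap.apply ℝ (Model n) V
      (realBasis n : Fin (2 * n) → Model n))).comp_continuousOn (h a)
  refine ((hc.mono hsub).integrableOn_compact hK').of_forall_sdiff_eq_zero
    (chartAt (Model n) a).open_target.measurableSet fun y hy => ?_
  rw [inChart_apply, h0]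
  · rfl
  · intro hx
    exact hy.2 ⟨_, hx, (chartAt (Model n) a).right_inv hy.1⟩

theorem localInt_sum {κ : Type*} (s : Finset κ) {a : X} {η : κ → DForm n X (2 * n) V}
    (h : ∀ i ∈ s, ContForm (η i)) (hs : ∀ i ∈ s, SuppIn a (η i)) :
    localInt a (fun x => ∑ i ∈ s, η i x) = ∑ i ∈ s, localInt a (η i) := by
  unfold localInt
  rw [← MeasureTheory.integral_finsetSum s fun i hi => integrableOn_coef (h i hi) (hs i hi)]
  refine MeasureTheory.integral_congr_ae (Filter.Eventually.of_forall fun y => ?_)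
  simp [inChart_apply]

theorem localInt_map [CompleteSpace V] {V' : Type*} [NormedAddCommGroup V'] [NormedSpace ℝ V']
    [CompleteSpace V'] (f : V →L[ℝ] V')
    {a : X} {η : DForm n X (2 * n) V} (h : ContForm η) (hs : SuppIn a η) :
    localInt a (fun x => f.compContinuousAlternatingMap (η x)) = f (localInt a η) :=
  f.integral_comp_comm (integrableOn_coef h hs)

variable [IsManifold 𝓘(ℂ, Model n) ω X]

/-- Change of charts in an integral. -/
theorem localInt_change {a b : X} {η : DForm n X (2 * n) V}
    (h : ∀ x, x ∉ (chartAt (Model n) a).source ∩ (chartAt (Model n) b).source → η x = 0) :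
    localInt a η = localInt b η := by
  have key : ∀ {a b : X}, (∀ x, x ∉ (chartAt (Model n) a).source ∩ (chartAt (Model n) b).source →
      η x = 0) → localInt a η = ∫ y in chartSet n a (chartAt (Model n) b).source,
        inChart a η y (realBasis n) ∂(realBasis n).addHaar := by
    intro a b h
    refine (MeasureTheory.setIntegral_eq_of_subset_of_forall_sdiff_eq_zero
      (chartAt (Model n) a).open_target.measurableSet Set.inter_subset_left fun y hy => ?_)
    rw [inChart_apply, h]
    · rfl
    · exact fun hx => hy.2 ⟨hy.1, hx.2⟩
  rw [key h, key (a := b) (b := a) fun x hx => h x fun hx' => hx hx'.symm]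
  have himg : chartSet n b (chartAt (Model n) a).source =
      tau a b '' chartSet n a (chartAt (Model n) b).source := by
    ext z
    constructor
    · intro hz
      refine ⟨tau b a z, tau_mem_chartSet hz ((chartAt (Model n) b).map_target hz.1), ?_⟩
      change chartAt (Model n) b ((chartAt (Model n) a).symm (tau b a z)) = z
      rw [tau_symm hz, (chartAt (Model n) b).right_inv hz.1]
    · rintro ⟨y, hy, rfl⟩
      exact tau_mem_chartSet hy ((chartAt (Model n) a).map_target hy.1)
  have hO := isOpen_chartSet (n := n) a (chartAt (Model n) b).open_source
  rw [himg, MeasureTheory.integral_image_eq_integral_abs_det_fderiv_smul _ hO.measurableSet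
    (f' := fderiv ℝ (tau a b))
    (fun y hy => ((contDiffAt_tau hy).differentiableAt (by simp)).hasFDerivAt.hasFDerivWithinAt)]
  · refine MeasureTheory.setIntegral_congr_fun hO.measurableSet fun y hy => ?_
    -- The substitution formula contains |det|, while the pullback of a top form contains det;
    -- positivity of the Jacobian identifies them.
    rw [inChart_eq_pullback η hy, alt_top_comp, abs_of_pos (det_fderiv_tau_pos hy)]
  · intro y hy z hz hyz
    have := congrArg (chartAt (Model n) b).symm hyz
    rw [tau_symm hy, tau_symm hz] at this
    exact (chartAt (Model n) a).symm.injOn hy.1 hz.1 this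

end LocalIntegral


/-! ### Stokes' theorem -/

section LocalStokes

variable {n : ℕ} {V : Type*} [NormedAddCommGroup V] [NormedSpace ℝ V]

/-- Integration by parts against the constant function 1, which is allowed because g has compact
support. -/
theorem integral_fderiv_eq_zero {g : Model n → V} (hg : ContDiff ℝ ∞ g) (hc : HasCompactSupport g)
    (v : Model n) : ∫ y, fderiv ℝ g y v ∂(realBasis n).addHaar = 0 := by
  have h1 : Continuous fun y => fderiv ℝ g y v :=
    (hg.continuous_fderiv (by simp)).clm_apply continuous_const
  have h2 : HasCompactSupport fun y => fderiv ℝ g y v := hc.fderiv_apply (𝕜 := ℝ) v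
  have h := integral_smul_fderiv_eq_neg_fderiv_smul_of_integrable (𝕜 := ℝ)
    (μ := (realBasis n).addHaar) (f := fun _ => (1 : ℝ)) (g := g) (v := v)
    (by simp) (by simpa using h1.integrable_of_hasCompactSupport h2)
    (by simpa using hg.continuous.integrable_of_hasCompactSupport hc)
    (fun _ _ => by fun_prop) (fun y _ => hg.differentiable (by simp) y)
  simpa using h

theorem extDeriv_zero {m : ℕ} (y : Model n) : extDeriv (fun _ : Model n => (0 : Alt n m V)) y = 0 := by
  rw [extDeriv, fderiv_fun_const]
  exact (ContinuousAlternatingMap.alternatizeUncurryFinCLM ℝ (Model n) V).map_zero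

theorem integral_extDeriv_eq_zero {m : ℕ} {G : Model n → Alt n m V} (hG : ContDiff ℝ ∞ G)
    (hc : HasCompactSupport G) (w : Fin (m + 1) → Model n) :
    ∫ y, extDeriv G y w ∂(realBasis n).addHaar = 0 := by
  have hg : ∀ v : Fin m → Model n, ContDiff ℝ ∞ fun y => G y v := fun v =>
    (ContinuousAlternatingMap.apply ℝ (Model n) V v).contDiff.comp hG
  have hgc : ∀ v : Fin m → Model n, HasCompactSupport fun y => G y v := fun v =>
    hc.comp_left (g := fun a : Alt n m V => a v) rfl
  have hd : ∀ y, extDeriv G y w = ∑ i : Fin (m + 1), (((-1) ^ i.val : ℤ) : ℝ) •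
      fderiv ℝ (fun y => G y (i.removeNth w)) y (w i) := fun y => by
    simp only [Int.cast_smul_eq_zsmul]
    exact extDeriv_apply (hG.differentiable (by simp) y) w
  simp only [hd]
  rw [MeasureTheory.integral_finsetSum]
  · refine Finset.sum_eq_zero fun i _ => ?_
    rw [MeasureTheory.integral_smul, integral_fderiv_eq_zero (hg _) (hgc _), smul_zero]
  · intro i _
    exact MeasureTheory.Integrable.smul (_ : ℝ) <| (((hg _).continuous_fderiv (by simp)).clm_apply
      continuous_const).integrable_of_hasCompactSupport ((hgc _).fderiv_apply (𝕜 := ℝ) _)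

variable {X : Type*} [TopologicalSpace X] [ChartedSpace (Model n) X]

theorem SmoothOn.contForm_dForm [IsManifold 𝓘(ℝ, Model n) ∞ X] {m : ℕ} {θ : DForm n X m V}
    (h : SmoothOn θ Set.univ) : ContForm (dForm θ) := fun x₀ => by
  have h1 := h.contDiffOn x₀
  have hO := isOpen_chartSet (n := n) x₀ (isOpen_univ (X := X))
  have h2 : ContinuousOn (extDeriv (inChart x₀ θ)) (chartSet n x₀ Set.univ) :=
    (ContinuousAlternatingMap.alternatizeUncurryFinCLM ℝ (Model n) V).continuous.comp_continuousOn
      (h1.continuousOn_fderiv_of_isOpen hO (by simp))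
  have h3 := h2.congr fun y hy => (extDeriv_inChart h isOpen_univ hy).symm
  rwa [chartSet_univ] at h3

/-- Stokes' theorem for a form supported in one chart. -/
theorem localInt_dForm [IsManifold 𝓘(ℝ, Model n) ∞ X] {m : ℕ} {b : X}
    {θ : DForm n X m V} (h : SmoothOn θ Set.univ) (hs : SuppIn b θ) (w : Fin (m + 1) → Model n) :
    ∫ y in (chartAt (Model n) b).target, inChart b (dForm θ) y w ∂(realBasis n).addHaar = 0 := by
  obtain ⟨K, hK, hKs, h0⟩ := hs
  set K' := chartAt (Model n) b '' K
  set T := (chartAt (Model n) b).target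
  have hT : IsOpen T := (chartAt (Model n) b).open_target
  have hK' : IsCompact K' :=
    hK.image_of_continuousOn ((chartAt (Model n) b).continuousOn.mono hKs)
  have hsub : K' ⊆ T := by
    rintro _ ⟨x, hx, rfl⟩
    exact (chartAt (Model n) b).map_source (hKs hx)
  classical
  -- Extension by zero is smooth on the whole model space: the form vanishes off a compact subset of
  -- the open target.
  let G : Model n → Alt n m V := T.indicator (inChart b θ)
  have hG0 : ∀ y ∉ K', G y = 0 := by
    intro y hy
    by_cases hyT : y ∈ T
    · rw [show G y = inChart b θ y from Set.indicator_of_mem hyT _, inChart_apply, h0]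
      · rfl
      · exact fun hx => hy ⟨_, hx, (chartAt (Model n) b).right_inv hyT⟩
    · exact Set.indicator_of_notMem hyT _
  have hGT : ∀ y ∈ T, G =ᶠ[nhds y] inChart b θ := fun y hy =>
    Filter.eventuallyEq_of_mem (hT.mem_nhds hy) fun z hz => Set.indicator_of_mem hz _
  have hGn : ∀ y ∉ K', G =ᶠ[nhds y] fun _ => 0 := fun y hy =>
    Filter.eventuallyEq_of_mem (hK'.isClosed.isOpen_compl.mem_nhds hy) fun z hz => hG0 z hz
  have hsm : ContDiff ℝ ∞ G := by
    rw [contDiff_iff_contDiffAt]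
    intro y
    by_cases hyT : y ∈ T
    · exact (h.contDiffAt isOpen_univ ⟨hyT, trivial⟩).congr_of_eventuallyEq (hGT y hyT)
    · exact contDiffAt_const.congr_of_eventuallyEq (hGn y fun hy => hyT (hsub hy))
  have hcs : HasCompactSupport G := HasCompactSupport.intro hK' hG0
  rw [← integral_extDeriv_eq_zero hsm hcs w,
    ← MeasureTheory.setIntegral_eq_integral_of_forall_compl_eq_zero (s := T)
      (f := fun y => extDeriv G y w)]
  · refine MeasureTheory.setIntegral_congr_fun hT.measurableSet fun y hy => ?_
    rw [← extDeriv_inChart h isOpen_univ ⟨hy, trivial⟩, (hGT y hy).extDeriv_eq]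
  · intro y hy
    rw [(hGn y fun hy' => hy (hsub hy')).extDeriv_eq]
    rw [extDeriv_zero]
    rfl

theorem dForm_sum {m : ℕ} {κ : Type*} (s : Finset κ) {θ : κ → DForm n X m V}
    (h : ∀ i ∈ s, SmoothOn (θ i) Set.univ) :
    dForm (fun x => ∑ i ∈ s, θ i x) = fun x => ∑ i ∈ s, dForm (θ i) x := by
  funext x
  have hy := mem_chartSet_self (n := n) x (Set.mem_univ x)
  have := Forms.d_sum s (η := fun i y => Forms.ofDeg m (inChart x (θ i) y)) fun i hi =>
    (Forms.Smooth.ofDeg ((h i hi).contDiffOn x)).diffAt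
      (isOpen_chartSet (n := n) x isOpen_univ) hy
  have h2 := congrFun this (m + 1)
  rw [Finset.sum_apply, Forms.d_apply_succ] at h2
  simp only [Forms.d_apply_succ, Forms.ofDeg_same, Finset.sum_apply] at h2
  refine Eq.trans ?_ h2
  change extDeriv (inChart x _) _ = _
  congr 1
  funext y
  ext v
  simp [inChart_apply]

end LocalStokes

/-! ### Partitions of unity and the global Stokes theorem -/

section Partition

variable {n : ℕ} {X : Type*} [TopologicalSpace X] [ChartedSpace (Model n) X]
  [IsManifold 𝓘(ℂ, Model n) ω X] [CompactSpace X] [T2Space X]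

theorem tsupport_chartPartition (a : X) :
    tsupport (chartPartition n X a) ⊆ (chartAt (Model n) a).source :=
  (SmoothPartitionOfUnity.exists_isSubordinate_chartAt_source 𝓘(ℝ, Model n) X).choose_spec a

variable (n X) in
/-- The charts that occur in the partition of unity. -/
def chartFinset : Finset X :=
  ((chartPartition n X).locallyFinite.finite_nonempty_of_compact).toFinset

theorem chartPartition_of_notMem {a : X} (ha : a ∉ chartFinset n X) (x : X) :
    chartPartition n X a x = 0 := by
  by_contra h
  exact ha (by rw [chartFinset, Set.Finite.mem_toFinset]; exact ⟨x, h⟩)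

theorem sum_chartPartition (x : X) : ∑ a ∈ chartFinset n X, chartPartition n X a x = 1 := by
  rw [← (chartPartition n X).sum_eq_one (Set.mem_univ x)]
  refine (finsum_eq_sum_of_support_subset _ fun a ha => ?_).symm
  by_contra h
  exact ha (chartPartition_of_notMem h x)

variable {V : Type*} [NormedAddCommGroup V] [NormedSpace ℝ V] {k : ℕ}

/-- The product of a form with a function of the partition of unity. -/
def cut (a : X) (η : DForm n X k V) : DForm n X k V := fun x => chartPartition n X a x • η x

theorem continuous_chartPartition (a : X) : Continuous (chartPartition n X a) :=
  (chartPartition n X a).contMDiff.continuous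

theorem cut_eq_zero {a x : X} (hx : x ∉ tsupport (chartPartition n X a)) (η : DForm n X k V) :
    cut a η x = 0 := by
  rw [cut, image_eq_zero_of_notMem_tsupport hx, zero_smul]

theorem suppIn_cut (a : X) (η : DForm n X k V) : SuppIn a (cut a η) :=
  ⟨_, (isClosed_tsupport _).isCompact, tsupport_chartPartition a, fun _ hx => cut_eq_zero hx η⟩

theorem ContForm.cut {η : DForm n X k V} (h : ContForm η) (a : X) : ContForm (cut a η) :=
  h.smul (continuous_chartPartition a)

theorem sum_cut (η : DForm n X k V) (x : X) : ∑ a ∈ chartFinset n X, cut a η x = η x := by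
  simp only [cut]
  rw [← Finset.sum_smul, sum_chartPartition, one_smul]

theorem smoothOn_cut {η : DForm n X k V} (h : SmoothOn η Set.univ) (a : X) :
    SmoothOn (cut a η) Set.univ := fun x₀ => by
  have h1 : ContDiffOn ℝ ∞ (fun y => chartPartition n X a ((chartAt (Model n) x₀).symm y))
      (chartSet n x₀ Set.univ) := by
    rw [← contMDiffOn_iff_contDiffOn]
    exact (chartPartition n X a).contMDiff.comp_contMDiffOn
      ((contMDiffOn_chart_symm (I := 𝓘(ℝ, Model n))).mono fun y hy => hy.1)
  exact h1.smul (h x₀)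

theorem integral_eq_sum (η : DForm n X (2 * n) V) :
    integral η = ∑ a ∈ chartFinset n X, localInt a (cut a η) := by
  refine finsum_eq_sum_of_support_subset _ fun a ha => ?_
  by_contra h
  refine ha ?_
  simp only [chartPartition_of_notMem h, zero_smul, MeasureTheory.integral_zero]

theorem integral_add {η θ : DForm n X (2 * n) V} (h : ContForm η) (h' : ContForm θ) :
    integral (fun x => η x + θ x) = integral η + integral θ := by
  simp only [integral_eq_sum, ← Finset.sum_add_distrib]
  refine Finset.sum_congr rfl fun a _ => ?_
  unfold localInt
  rw [← MeasureTheory.integral_add (integrableOn_coef (h.cut a) (suppIn_cut a η))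
    (integrableOn_coef (h'.cut a) (suppIn_cut a θ))]
  refine MeasureTheory.integral_congr_ae (Filter.Eventually.of_forall fun y => ?_)
  simp [inChart_apply, cut]

theorem integral_sum {κ : Type*} (s : Finset κ) {η : κ → DForm n X (2 * n) V}
    (h : ∀ i ∈ s, ContForm (η i)) :
    integral (fun x => ∑ i ∈ s, η i x) = ∑ i ∈ s, integral (η i) := by
  simp only [integral_eq_sum]
  rw [Finset.sum_comm]
  refine Finset.sum_congr rfl fun a _ => ?_
  rw [← localInt_sum s (fun i hi => (h i hi).cut a) fun i _ => suppIn_cut a (η i)]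
  congr 1
  funext x
  exact Finset.smul_sum

theorem integral_map [CompleteSpace V] {V' : Type*} [NormedAddCommGroup V'] [NormedSpace ℝ V']
    [CompleteSpace V'] (f : V →L[ℝ] V') {η : DForm n X (2 * n) V} (h : ContForm η) :
    integral (fun x => f.compContinuousAlternatingMap (η x)) = f (integral η) := by
  rw [integral_eq_sum, integral_eq_sum, map_sum]
  refine Finset.sum_congr rfl fun a _ => ?_
  rw [← localInt_map f (h.cut a) (suppIn_cut a η)]
  congr 1
  funext x
  ext v
  exact (f.map_smul _ _).symm

/-- The integral of a form that is supported in a chart. -/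
theorem integral_eq_localInt {b : X} {η : DForm n X (2 * n) V} (h : ContForm η)
    (hs : SuppIn b η) : integral η = localInt b η := by
  have h1 : η = fun x => ∑ a ∈ chartFinset n X, cut a η x := funext fun x => (sum_cut η x).symm
  obtain ⟨K, hK, hKs, h0⟩ := hs
  have hsc : ∀ a, SuppIn b (cut a η) := fun a =>
    ⟨K, hK, hKs, fun x hx => by rw [cut, h0 x hx, smul_zero]⟩
  rw [integral_eq_sum]
  conv_rhs => rw [h1]
  rw [localInt_sum _ (fun a _ => h.cut a) fun a _ => hsc a]
  -- Each piece is supported in both the chart at a, by the partition of unity, and the chart at b,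
  -- by hypothesis.
  refine Finset.sum_congr rfl fun a _ => localInt_change fun x hx => ?_
  by_cases hxa : x ∈ tsupport (chartPartition n X a)
  · have : x ∉ K := fun hxK => hx ⟨tsupport_chartPartition a hxa, hKs hxK⟩
    rw [cut, h0 x this, smul_zero]
  · exact cut_eq_zero hxa η

/-- **Stokes' theorem** on a compact complex manifold. -/
theorem integral_dForm {m : ℕ} (hn : n = m + 1) {θ : DForm n X (2 * m + 1) V}
    (h : SmoothOn θ Set.univ) {η : DForm n X (2 * n) V}
    (hη : ∀ x v, η x v = dForm θ x fun i => v (Fin.cast (by omega) i)) : integral η = 0 := by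
  subst hn
  have hη' : η = dForm (n := m + 1) θ := funext fun x => by ext v; exact hη x v
  have hsm := fun b => smoothOn_cut h b
  -- The cut-off is applied to the primitive θ, not to its differential. Each piece is then itself
  -- exact with support in one chart, and the derivatives of the partition functions need no
  -- separate treatment.
  have hsum : η = fun x => ∑ b ∈ chartFinset (m + 1) X, dForm (cut b θ) x := by
    rw [hη', ← dForm_sum _ fun b _ => hsm b]
    congr 1
    exact funext fun x => (sum_cut θ x).symm
  rw [hsum, integral_sum (η := fun b => dForm (cut b θ)) _ fun b _ => (hsm b).contForm_dForm]
  refine Finset.sum_eq_zero fun b _ => ?_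
  rw [integral_eq_localInt (b := b) (η := dForm (cut b θ)) (hsm b).contForm_dForm]
  · exact localInt_dForm (hsm b) (suppIn_cut b θ) _
  · refine ⟨_, (isClosed_tsupport (chartPartition (m + 1) X b)).isCompact,
      tsupport_chartPartition b, fun x hx => ?_⟩
    have hx' : chartAt (Model (m + 1)) x x ∈ chartSet (m + 1) x
        (tsupport (chartPartition (m + 1) X b))ᶜ := mem_chartSet_self x hx
    have hev : inChart x (cut b θ) =ᶠ[nhds (chartAt (Model (m + 1)) x x)] fun _ => 0 := by
      filter_upwards [(isOpen_chartSet x (isClosed_tsupport _).isOpen_compl).mem_nhds hx'] with z hz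
      rw [inChart_apply, cut_eq_zero hz.2]
      rfl
    change extDeriv _ _ = _
    rw [hev.extDeriv_eq, extDeriv_zero]

end Partition


/-! ### Positivity of the volume form -/

section Positivity

variable {n : ℕ}

namespace Forms

theorem ofDeg_one_mul_apply_eq_zero (α : Alt n 1 ℝ) (x : Forms n ℝ) {k : ℕ}
    {v : Fin k → Model n} (h : ∀ i, α (fun _ => v i) = 0) : (ofDeg 1 α * x) k v = 0 := by
  induction k generalizing x with
  | zero => rw [mul_apply_zero, ofDeg_of_ne (by omega)]; simp
  | succ k ih =>
    rw [apply_succ, contract_mul, contract_ofDeg_one, h 0, sgn_ofDeg_one, neg_mul]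
    have h0 : ofConst n (0 : ℝ) = 0 := by
      funext k; ext v; have := ofConst_mul_apply (0 : ℝ) (1 : Forms n ℝ) k v
      rw [mul_one, zero_mul] at this; exact this
    have := ih (contract (v 0) x) (v := Fin.tail v) fun i => h i.succ
    rw [h0, zero_mul, zero_add]
    change -((ofDeg 1 α * contract (v 0) x) k (Fin.tail v)) = 0
    rw [this, neg_zero]

theorem isCentral_real (a : Forms n ℝ) : a.IsCentral := fun _ _ _ => mul_comm _ _

/-- A two-form is even, so contraction acts on its powers as an ordinary derivation, and the
one-form can be moved to the front. -/
theorem contract_ofDeg_two_pow (η : Alt n 2 ℝ) (u : Model n) (m : ℕ) :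
    contract u (ofDeg 2 η ^ (m + 1)) =
      ((m + 1 : ℕ) : ℝ) • (ofDeg 1 (η.curryLeft u) * ofDeg 2 η ^ m) := by
  induction m with
  | zero => simp [contract_ofDeg_succ]
  | succ m ih =>
    have hc : ofDeg 2 η * ofDeg 1 (η.curryLeft u) = ofDeg 1 (η.curryLeft u) * ofDeg 2 η := by
      rw [ofDeg_one_mul_of_central _ _ (isCentral_real _), sgn_ofDeg_two]
    rw [pow_succ' _ (m + 1), contract_mul, ih, sgn_ofDeg_two, mul_smul_comm, ← mul_assoc, hc,
      mul_assoc, ← pow_succ', contract_ofDeg_succ]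
    push_cast
    module

/-- The vectors come in mutually orthogonal pairs. Contraction with the first pair leaves its value
times the next lower power; the other term has a factor ι_{v₀}η, which vanishes on all remaining
vectors. Indexing by ℕ makes removal of a pair a shift by two. -/
theorem pow_apply_pos (η : Alt n 2 ℝ) (m : ℕ) (v : ℕ → Model n)
    (hpos : ∀ j < m, 0 < η ![v (2 * j), v (2 * j + 1)])
    (h0 : ∀ i j, i < j → i / 2 ≠ j / 2 → j < 2 * m → η ![v i, v j] = 0) :
    0 < (ofDeg 2 η ^ m) (2 * m) (fun i => v i) := by
  induction m generalizing v with
  | zero =>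
    change 0 < (ofDeg 2 η ^ 0) 0 _
    rw [pow_zero, ← one_def, Forms.one, Pi.single_eq_same]
    exact one_pos
  | succ m ih =>
    have hα : ∀ w, η.curryLeft (v 0) (fun _ => w) = η ![v 0, w] := fun w => by
      rw [ContinuousAlternatingMap.curryLeft_apply_apply]
      congr 1
      funext i; fin_cases i <;> rfl
    have hvan : ∀ i : Fin (2 * m), η.curryLeft (v 0) (fun _ => v (i + 2)) = 0 := fun i => by
      rw [hα]
      exact h0 0 (i + 2) (by omega) (by omega) (by omega)
    have h1 : (ofDeg 2 η ^ (m + 1)) (2 * (m + 1)) (fun i => v i) =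
        contract (v 1) (contract (v 0) (ofDeg 2 η ^ (m + 1))) (2 * m) (fun i => v (i + 2)) := by
      refine (apply_succ (ofDeg 2 η ^ (m + 1)) (2 * m + 1) (fun i => v i)).trans ?_
      exact apply_succ _ (2 * m) _
    rw [h1, contract_ofDeg_two_pow, map_smul, contract_mul, contract_ofDeg_one, sgn_ofDeg_one,
      neg_mul, hα]
    change 0 < ((m + 1 : ℕ) : ℝ) • (((ofConst n (η ![v 0, v 1]) * ofDeg 2 η ^ m) (2 * m)
      fun i => v (i + 2)) + -((ofDeg 1 (η.curryLeft (v 0)) * contract (v 1) (ofDeg 2 η ^ m)) (2 * m)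
      fun i => v (i + 2)))
    rw [ofDeg_one_mul_apply_eq_zero _ _ hvan, ofConst_mul_apply, neg_zero, add_zero, smul_eq_mul]
    refine mul_pos (by positivity) (mul_pos (hpos 0 (by omega)) ?_)
    refine ih (fun i => v (i + 2)) (fun j hj => ?_) fun i j hij hne hj => ?_
    · exact hpos (j + 1) (by omega)
    · exact h0 (i + 2) (j + 2) (by omega) (by omega) (by omega)

end Forms

/-- Orthogonality to m vectors and their multiples by i imposes 2m real conditions in a space of
real dimension 2n > 2m. -/
theorem exists_orthogonal_ne_zero (η : Alt n 2 ℝ) {m : ℕ} (hm : m < n) (b : ℕ → Model n) :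
    ∃ u : Model n, u ≠ 0 ∧ ∀ i < m, η ![u, b i] = 0 ∧ η ![u, Complex.I • b i] = 0 := by
  let φ : Model n →ₗ[ℝ] (Fin m × Fin 2 → ℝ) := LinearMap.pi fun p =>
    ((ContinuousAlternatingMap.apply ℝ (Model n) ℝ
      ![if p.2 = 0 then b p.1 else Complex.I • b p.1]).comp η.curryLeft : Model n →L[ℝ] ℝ)
  have hr : Module.finrank ℝ (Model n) = 2 * n := by
    rw [Module.finrank_eq_card_basis (realBasis n), Fintype.card_fin]
  have hk : LinearMap.ker φ ≠ ⊥ := LinearMap.ker_ne_bot_of_finrank_lt (by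
    rw [hr, Module.finrank_fintype_fun_eq_card, Fintype.card_prod, Fintype.card_fin,
      Fintype.card_fin]; omega)
  obtain ⟨u, hu, hu0⟩ := Submodule.exists_mem_ne_zero_of_ne_bot hk
  refine ⟨u, hu0, fun i hi => ⟨?_, ?_⟩⟩
  · exact congrFun (LinearMap.mem_ker.1 hu) (⟨i, hi⟩, 0)
  · exact congrFun (LinearMap.mem_ker.1 hu) (⟨i, hi⟩, 1)

theorem exists_orthogonal_family (η : Alt n 2 ℝ) {m : ℕ} (hm : m ≤ n) :
    ∃ b : ℕ → Model n, (∀ j < m, b j ≠ 0) ∧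
      ∀ i j, i < j → j < m → η ![b j, b i] = 0 ∧ η ![b j, Complex.I • b i] = 0 := by
  induction m with
  | zero => exact ⟨0, by simp, by simp⟩
  | succ m ih =>
    obtain ⟨b, hb, hb'⟩ := ih (by omega)
    obtain ⟨u, hu, hu'⟩ := exists_orthogonal_ne_zero η (show m < n by omega) b
    refine ⟨Function.update b m u, fun j hj => ?_, fun i j hij hj => ?_⟩
    · rcases Nat.lt_succ_iff_lt_or_eq.1 hj with h | rfl
      · rw [Function.update_of_ne h.ne]; exact hb j h
      · rwa [Function.update_self]
    · rcases Nat.lt_succ_iff_lt_or_eq.1 hj with h | rfl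
      · rw [Function.update_of_ne h.ne, Function.update_of_ne (hij.trans h).ne]
        exact hb' i j hij h
      · rw [Function.update_self, Function.update_of_ne hij.ne]
        exact hu' i hij

theorem alt_two_swap (η : Alt n 2 ℝ) (u v : Model n) : η ![u, v] = -η ![v, u] := by
  have := η.toAlternatingMap.map_swap ![v, u] (i := 0) (j := 1) (by decide)
  refine Eq.trans ?_ this
  change η _ = η _
  congr 1
  funext i
  fin_cases i <;> rfl

theorem realBasis_apply (i : Fin (2 * n)) :
    realBasis n i = Complex.basisOneI ⟨i % 2, Nat.mod_lt _ two_pos⟩ •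
      EuclideanSpace.basisFun (Fin n) ℂ ⟨i / 2, by omega⟩ := by
  rw [realBasis, Module.Basis.reindex_apply, Module.Basis.smulTower'_apply]
  rfl

/-- The top power of a positive real `(1,1)`-form is positive. -/
theorem kahler_pow_pos (η : Alt n 2 ℝ)
    (h11 : ∀ u v : Model n, η ![Complex.I • u, Complex.I • v] = η ![u, v])
    (hpos : ∀ u : Model n, u ≠ 0 → 0 < η ![u, Complex.I • u]) :
    0 < (Forms.ofDeg 2 η ^ n) (2 * n) (realBasis n) := by
  obtain ⟨b, hb, hb'⟩ := exists_orthogonal_family η le_rfl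
  let v : ℕ → Model n := fun i => if i % 2 = 0 then b (i / 2) else Complex.I • b (i / 2)
  have hneg : ∀ u w : Model n, η ![Complex.I • u, w] = -η ![u, Complex.I • w] := by
    intro u w
    rw [← h11, smul_smul, Complex.I_mul_I, neg_smul, one_smul]
    have := η.map_update_neg ![u, Complex.I • w] 0 u
    have e1 : Function.update ![u, Complex.I • w] 0 (-u) = ![-u, Complex.I • w] := by
      funext i; fin_cases i <;> rfl
    have e2 : Function.update ![u, Complex.I • w] 0 u = ![u, Complex.I • w] := by
      funext i; fin_cases i <;> rfl
    rw [e1, e2] at this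
    exact this
  have h := Forms.pow_apply_pos η n v (fun j hj => ?_) fun i j hij hne hj => ?_
  -- L is the complex-linear map taking the standard basis to b, so the positive value already found
  -- is |det L|² times the value on the standard basis. As |det L|² ≥ 0, positivity passes to that
  -- value, and the independence of b need not be proved.
  · let L : Model n →L[ℂ] Model n := LinearMap.toContinuousLinearMap
      ((EuclideanSpace.basisFun (Fin n) ℂ).toBasis.constr ℂ fun j => b j)
    have hL : ∀ j : Fin n, L (EuclideanSpace.basisFun (Fin n) ℂ j) = b j := fun j => by
      have := (EuclideanSpace.basisFun (Fin n) ℂ).toBasis.constr_basis ℂ (fun j : Fin n => b j) j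
      rwa [OrthonormalBasis.coe_toBasis] at this
    have hv : (fun i : Fin (2 * n) => v i) = L.restrictScalars ℝ ∘ realBasis n := by
      funext i
      rw [Function.comp_apply, realBasis_apply]
      change _ = L _
      rw [Complex.coe_basisOneI]
      rcases Nat.mod_two_eq_zero_or_one i with hi | hi
      · simp only [v, hi, if_true]
        change _ = L ((1 : ℂ) • _)
        rw [one_smul, hL]
      · simp only [v, hi, one_ne_zero, if_false]
        change _ = L (Complex.I • _)
        rw [map_smul, hL]
    rw [hv, ← ContinuousAlternatingMap.compContinuousLinearMap_apply, alt_top_comp,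
      det_restrictScalars_eq, smul_eq_mul] at h
    exact pos_of_mul_pos_right h (Complex.normSq_nonneg _)
  · have e1 : (2 * j) % 2 = 0 := by omega
    have e2 : (2 * j + 1) % 2 = 1 := by omega
    have e3 : (2 * j) / 2 = j := by omega
    have e4 : (2 * j + 1) / 2 = j := by omega
    simp only [v, e1, e2, e3, e4, if_true, one_ne_zero, if_false]
    exact hpos _ (hb j hj)
  · obtain ⟨h1, h2⟩ := hb' (i / 2) (j / 2) (by omega) (by omega)
    have h3 : η ![b (i / 2), b (j / 2)] = 0 := by rw [alt_two_swap, h1, neg_zero]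
    have h4 : η ![Complex.I • b (i / 2), b (j / 2)] = 0 := by rw [alt_two_swap, h2, neg_zero]
    simp only [v]
    split_ifs
    · exact h3
    · rw [← neg_eq_zero, ← hneg]; exact h4
    · exact h4
    · rw [h11]; exact h3

end Positivity


/-! ### Integration against the volume form -/

section Volume

variable {n : ℕ} {X : Type*} [TopologicalSpace X] [ChartedSpace (Model n) X]

theorem KahlerForm.pow_eq (K : KahlerForm n X) (k : ℕ) (x : X) :
    K.pow k x = (Forms.ofDeg 2 (K.form x) ^ k) (2 * k) := by
  rw [← Forms.pow_def]; rfl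

theorem KahlerForm.pow_pos (K : KahlerForm n X) (x : X) : 0 < K.pow n x (realBasis n) := by
  rw [K.pow_eq]
  exact kahler_pow_pos _ (K.type_one_one x) (K.pos x)

theorem KahlerForm.volForm_apply (K : KahlerForm n X) (x : X) (v : Fin (2 * n) → Model n) :
    K.volForm x v = (n.factorial : ℝ)⁻¹ * K.pow n x v := rfl

theorem KahlerForm.volForm_pos (K : KahlerForm n X) (x : X) : 0 < K.volForm x (realBasis n) := by
  rw [K.volForm_apply]
  exact mul_pos (by positivity) (K.pow_pos x)

theorem KahlerForm.contForm_volForm (K : KahlerForm n X) : ContForm K.volForm := fun x₀ => by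
  have h : Forms.Smooth (chartSet n x₀ Set.univ) (inCh x₀ fun x => Forms.ofDeg 2 (K.form x) ^ n) := by
    rw [show inCh x₀ (fun x => Forms.ofDeg 2 (K.form x) ^ n) =
      fun y => Forms.ofDeg 2 (inChart x₀ K.form y) ^ n from
        funext fun y => by rw [inCh_pow, inCh_ofDeg]]
    exact (Forms.Smooth.ofDeg (K.smooth.contDiffOn x₀)).pow n
  have h1 := ((h (2 * n)).const_smul (n.factorial : ℝ)⁻¹).continuousOn
  rw [chartSet_univ] at h1
  refine h1.congr fun y _ => ?_
  rw [inChart_apply, KahlerForm.volForm, K.pow_eq]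
  rfl

theorem continuous_of_inChart {Y : Type*} [TopologicalSpace Y] {h : X → Y}
    (H : ∀ x₀ : X, ∃ S : Set X, IsOpen S ∧ x₀ ∈ S ∧
      ContinuousOn (fun y => h ((chartAt (Model n) x₀).symm y)) (chartSet n x₀ S)) :
    Continuous h := by
  rw [continuous_iff_continuousAt]
  intro x₀
  obtain ⟨S, hS, hx, hc⟩ := H x₀
  have h1 : ContinuousAt (fun y => h ((chartAt (Model n) x₀).symm y)) (chartAt (Model n) x₀ x₀) :=
    hc.continuousAt ((isOpen_chartSet x₀ hS).mem_nhds (mem_chartSet_self x₀ hx))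
  have h2 : ContinuousAt (chartAt (Model n) x₀) x₀ :=
    (chartAt (Model n) x₀).continuousAt (mem_chart_source _ x₀)
  refine (ContinuousAt.comp (f := chartAt (Model n) x₀) h1 h2).congr ?_
  filter_upwards [(chartAt (Model n) x₀).open_source.mem_nhds (mem_chart_source _ x₀)] with x hx
  exact congrArg h ((chartAt (Model n) x₀).left_inv hx)

theorem contForm_smul_volForm (K : KahlerForm n X) {h : X → ℝ} (hc : Continuous h) :
    ContForm fun x => h x • K.volForm x := K.contForm_volForm.smul hc

variable [IsManifold 𝓘(ℂ, Model n) ω X]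

theorem KahlerForm.inChart_volForm_pos (K : KahlerForm n X) (x₀ : X) {y : Model n}
    (hy : y ∈ (chartAt (Model n) x₀).target) : 0 < inChart x₀ K.volForm y (realBasis n) := by
  rw [inChart_apply, alt_top_comp, chartD_eq_fderiv hy]
  exact mul_pos (det_fderiv_tau_pos ⟨hy, mem_chart_source _ _⟩) (K.volForm_pos _)

variable [CompactSpace X] [T2Space X]

theorem localInt_smul_volForm_nonneg (K : KahlerForm n X) {h : X → ℝ} (h0 : ∀ x, 0 ≤ h x) (a : X) :
    0 ≤ localInt a (cut a fun x => h x • K.volForm x) :=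
  MeasureTheory.setIntegral_nonneg (chartAt (Model n) a).open_target.measurableSet fun _ hy =>
    mul_nonneg ((chartPartition n X).nonneg _ _) (mul_nonneg (h0 _) (K.inChart_volForm_pos a hy).le)

theorem integral_smul_volForm_nonneg (K : KahlerForm n X) {h : X → ℝ} (h0 : ∀ x, 0 ≤ h x) :
    0 ≤ integral (fun x => h x • K.volForm x) := by
  rw [integral_eq_sum]
  exact Finset.sum_nonneg fun a _ => localInt_smul_volForm_nonneg K h0 a

/-- All chart contributions are nonnegative, so each of them vanishes. In a chart whose partition
function is positive at x, the integrand is zero almost everywhere, hence everywhere by continuity,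
and the positive factors can be cancelled. -/
theorem eq_zero_of_integral_smul_volForm (K : KahlerForm n X) {h : X → ℝ} (hc : Continuous h)
    (h0 : ∀ x, 0 ≤ h x) (hi : integral (fun x => h x • K.volForm x) = 0) (x : X) : h x = 0 := by
  obtain ⟨a, ha⟩ := (chartPartition n X).exists_pos_of_mem (Set.mem_univ x)
  have hmem : a ∈ chartFinset n X := by
    by_contra hn
    exact ha.ne' (chartPartition_of_notMem hn x)
  rw [integral_eq_sum, Finset.sum_eq_zero_iff_of_nonneg
    fun a _ => localInt_smul_volForm_nonneg K h0 a] at hi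
  have hia := hi a hmem
  have hT := (chartAt (Model n) a).open_target
  have hcont := (contForm_smul_volForm K hc).cut a
  have hco : ContinuousOn (fun y => inChart a (cut a fun x => h x • K.volForm x) y (realBasis n))
      (chartAt (Model n) a).target :=
    (ContinuousLinearMap.continuous (ContinuousAlternatingMap.apply ℝ (Model n) ℝ
      (realBasis n : Fin (2 * n) → Model n))).comp_continuousOn (hcont a)
  have hae := (MeasureTheory.setIntegral_eq_zero_iff_of_nonneg_ae
    ((MeasureTheory.ae_restrict_iff' hT.measurableSet).2 (Filter.Eventually.of_forall fun y hy =>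
      mul_nonneg ((chartPartition n X).nonneg _ _) (mul_nonneg (h0 _)
        (K.inChart_volForm_pos a hy).le))) (integrableOn_coef hcont (suppIn_cut a _))).1 hia
  have heq := MeasureTheory.Measure.eqOn_open_of_ae_eq hae hT hco continuousOn_const
  have hxs : x ∈ (chartAt (Model n) a).source :=
    tsupport_chartPartition a (subset_tsupport _ ha.ne')
  have hy := (chartAt (Model n) a).map_source hxs
  have h1 : chartPartition n X a ((chartAt (Model n) a).symm (chartAt (Model n) a x)) *
      (h ((chartAt (Model n) a).symm (chartAt (Model n) a x)) *
        inChart a K.volForm (chartAt (Model n) a x) (realBasis n)) = 0 := heq hy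
  rw [(chartAt (Model n) a).left_inv hxs] at h1
  have h2 := (mul_eq_zero.1 h1).resolve_left ha.ne'
  exact (mul_eq_zero.1 h2).resolve_right (K.inChart_volForm_pos a hy).ne'

theorem KahlerForm.vol_pos [Nonempty X] (K : KahlerForm n X) : 0 < K.vol := by
  have e : (fun x => (1 : ℝ) • K.volForm x) = K.volForm := funext fun x => one_smul _ _
  have h1 := integral_smul_volForm_nonneg K (h := fun _ => 1) fun _ => zero_le_one
  refine lt_of_le_of_ne (by rwa [e] at h1) fun h => ?_
  exact one_ne_zero (eq_zero_of_integral_smul_volForm K (h := fun _ => 1) continuous_const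
    (fun _ => zero_le_one) (by rw [e]; exact h.symm) (Classical.arbitrary X))

end Volume


/-! ### Endomorphisms -/

section Endomorphisms

variable {r : ℕ}

open CentralCharge

theorem real_smul_end (c : ℝ) (T : EndFib r) : c • T = (c : ℂ) • T := by
  ext1 v
  rfl

theorem traceL_smul (c : ℂ) (T : EndFib r) : traceL r (c • T) = c * traceL r T := by
  change LinearMap.trace ℂ (Fib r) (c • (T : Fib r →ₗ[ℂ] Fib r)) = _
  rw [map_smul]
  rfl

theorem traceL_one : traceL r 1 = r := by
  change LinearMap.trace ℂ (Fib r) (1 : Fib r →ₗ[ℂ] Fib r) = _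
  rw [LinearMap.trace_one]
  simp

theorem traceL_eq_sum (T : EndFib r) : traceL r T =
    ∑ i, inner ℂ (EuclideanSpace.basisFun (Fin r) ℂ i) (T (EuclideanSpace.basisFun (Fin r) ℂ i)) :=
  LinearMap.trace_eq_sum_inner (T : Fib r →ₗ[ℂ] Fib r) (EuclideanSpace.basisFun (Fin r) ℂ)

theorem traceL_star (T : EndFib r) : traceL r (star T) = star (traceL r T) := by
  rw [traceL_eq_sum, traceL_eq_sum, star_sum]
  refine Finset.sum_congr rfl fun i _ => ?_
  rw [ContinuousLinearMap.star_eq_adjoint, ContinuousLinearMap.adjoint_inner_right]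
  exact (inner_conj_symm _ _).symm

theorem traceL_mul_star (T : EndFib r) : traceL r (T * star T) =
    ((∑ i, ‖star T (EuclideanSpace.basisFun (Fin r) ℂ i)‖ ^ 2 : ℝ) : ℂ) := by
  rw [traceL_eq_sum, Complex.ofReal_sum]
  refine Finset.sum_congr rfl fun i _ => ?_
  rw [mul_apply_eq_comp, ContinuousLinearMap.star_eq_adjoint,
    ← ContinuousLinearMap.adjoint_inner_left, inner_self_eq_norm_sq_to_K]
  push_cast
  rfl

theorem normSqEnd_eq_sum (T : EndFib r) :
    normSqEnd T = ∑ i, ‖star T (EuclideanSpace.basisFun (Fin r) ℂ i)‖ ^ 2 := by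
  rw [normSqEnd, traceL_mul_star, Complex.ofReal_re]

theorem normSqEnd_nonneg (T : EndFib r) : 0 ≤ normSqEnd T := by
  rw [normSqEnd_eq_sum]
  exact Finset.sum_nonneg fun i _ => sq_nonneg _

theorem eq_zero_of_normSqEnd (T : EndFib r) (h : normSqEnd T = 0) : T = 0 := by
  rw [normSqEnd_eq_sum, Finset.sum_eq_zero_iff_of_nonneg fun i _ => sq_nonneg _] at h
  have h1 : ((star T : EndFib r) : Fib r →ₗ[ℂ] Fib r) = 0 := by
    refine (EuclideanSpace.basisFun (Fin r) ℂ).toBasis.ext fun i => ?_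
    have := h i (Finset.mem_univ i)
    rw [OrthonormalBasis.coe_toBasis]
    simpa using this
  have h2 : star T = 0 := ContinuousLinearMap.coe_injective h1
  rw [← star_star T, h2]
  exact map_zero ContinuousLinearMap.adjoint

theorem normSqEnd_smul (c : ℂ) (T : EndFib r) : normSqEnd (c • T) = Complex.normSq c * normSqEnd T := by
  rw [normSqEnd, star_smul, smul_mul_assoc, mul_smul_comm, traceL_smul, traceL_smul, ← mul_assoc]
  change (c * (starRingEnd ℂ) c * _).re = _
  rw [Complex.mul_conj, Complex.re_ofReal_mul]
  rfl

/-- The pointwise completion of the square. The cross term sees T only through the real part of its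
trace, and that is what makes its integral topological. -/
theorem normSqEnd_sub_smul_one (c : ℝ) (T : EndFib r) : normSqEnd (T - (c : ℂ) • 1) =
    normSqEnd T - 2 * c * (traceL r T).re + c ^ 2 * r := by
  have h : (T - (c : ℂ) • 1) * star (T - (c : ℂ) • 1) =
      T * star T - (c : ℂ) • T - (c : ℂ) • star T + ((c : ℂ) * c) • (1 : EndFib r) := by
    have hs : star (T - (c : ℂ) • 1) = star T - star ((c : ℂ) • (1 : EndFib r)) :=
      map_sub ContinuousLinearMap.adjoint _ _
    rw [hs, star_smul, star_one, Complex.star_def, Complex.conj_ofReal]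
    simp only [mul_sub, sub_mul, smul_mul_assoc, mul_smul_comm, one_mul, mul_one, smul_sub, smul_smul]
    abel
  rw [normSqEnd, h, map_add, map_sub, map_sub, traceL_smul, traceL_smul, traceL_smul, traceL_star,
    traceL_one, normSqEnd]
  simp
  ring

theorem normSqEnd_zero : normSqEnd (0 : EndFib r) = 0 := by
  rw [normSqEnd, zero_mul, map_zero, Complex.zero_re]

theorem normSqEnd_conj {g T T' : EndFib r} (hg : star g * g = 1) (hg' : g * star g = 1)
    (h : g * T = T' * g) : normSqEnd T' = normSqEnd T := by
  have h1 : T' = g * T * star g := by rw [h, mul_assoc, hg', mul_one]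
  have h2 : T' * star T' = g * (T * star T * star g) := by
    rw [h1, star_mul, star_mul, star_star]
    calc g * T * star g * (g * (star T * star g)) = g * T * (star g * g) * (star T * star g) := by
          simp only [mul_assoc]
      _ = _ := by rw [hg, mul_one]; simp only [mul_assoc]
  rw [normSqEnd, h2, traceL_mul_comm, mul_assoc, hg, mul_one, normSqEnd]

theorem continuous_normSqEnd : Continuous (normSqEnd : EndFib r → ℝ) := by
  unfold normSqEnd
  exact Complex.continuous_re.comp ((traceL r).continuous.comp (continuous_id.mul
    (ContinuousLinearMap.adjoint (𝕜 := ℂ) (E := Fib r) (F := Fib r)).continuous))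

theorem realPart_imaginaryPart_of_smul_one {T : EndFib r} {c : ℝ} (h : T = c • 1) :
    (ℑ T = 0) ∧ (ℜ T : EndFib r) = c • 1 := by
  have hs : IsSelfAdjoint T := by
    rw [h, real_smul_end, IsSelfAdjoint, star_smul, star_one, Complex.star_def, Complex.conj_ofReal]
  refine ⟨hs.imaginaryPart, ?_⟩
  rw [hs.coe_realPart, h]

theorem eq_of_realPart_imaginaryPart {T : EndFib r} {c : ℝ} (h : ℑ T = 0)
    (h' : (ℜ T : EndFib r) = c • 1) : T = c • 1 := by
  have := realPart_add_I_smul_imaginaryPart T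
  rw [h, h'] at this
  rw [← this]
  simp

/-- The traces of T and of its adjoint are complex conjugates, so the skew part of T has purely
imaginary trace. -/
theorem re_traceL (T : EndFib r) : (traceL r T).re = (traceL r (ℜ T : EndFib r)).re := by
  rw [realPart_apply_coe, real_smul_end, traceL_smul, map_add, traceL_star]
  simp
  ring

end Endomorphisms


/-! ### The Yang--Mills bound -/

section Main

variable {n r : ℕ} {X : Type*} [TopologicalSpace X] [ChartedSpace (Model n) X] {ι : Type*}
  {E : HermitianBundle n r X ι} (Z : CentralCharge n X)

namespace CentralCharge

theorem trTilde_eq (D : Connection E) (x : X) :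
    Z.trTilde D x = D.toLocal.cw (traceL r) (n + 1) (fun j => (j.factorial : ℂ)⁻¹)
      (Complex.I / (2 * (Real.pi : ℂ))) (gammaForm (EndFib r) Z.rho Z.omega.form)
      (scalarForm (EndFib r) Z.U) (E.indexAt x) x (2 * n) := by
  rw [trTilde, tilde, density_eq]
  rfl

theorem tilde_apply (D : Connection E) (x : X) (v : Fin (2 * n) → Model n) :
    Z.tilde D x v = (Z.omega.volForm x v : ℂ) • Z.zeta D x := by
  have h0 := (Z.omega.volForm_pos x).ne'
  have h1 : (Z.omega.volForm x (realBasis n) : ℂ) • Z.zeta D x = Z.tilde D x (realBasis n) := by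
    rw [zeta, real_smul_end, smul_smul, ← Complex.ofReal_mul, mul_inv_cancel₀ h0,
      Complex.ofReal_one, one_smul]
  rw [alt_top_apply, alt_top_apply (Z.omega.volForm x), ← h1, real_smul_end, smul_smul,
    smul_eq_mul, Complex.ofReal_mul]

theorem trTilde_apply (D : Connection E) (x : X) (v : Fin (2 * n) → Model n) :
    Z.trTilde D x v = (Z.omega.volForm x v : ℂ) * traceL r (Z.zeta D x) := by
  rw [← traceL_smul, ← tilde_apply]
  rfl

/-- The form `Z̃(∇)` in the local frame with index `i`. -/
def tildeIn (D : Connection E) (i : ι) : DForm n X (2 * n) (EndFib r) := fun x =>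
  cwDensity (W := EndFib r) (n + 1) (fun j => (j.factorial : ℂ)⁻¹)
    (Complex.I / (2 * (Real.pi : ℂ))) Z.rho Z.omega.form Z.U (curvOf (D.toLocal.form i)) x (2 * n)

theorem tilde_eq_tildeIn (D : Connection E) (x : X) :
    Z.tilde D x = Z.tildeIn D (E.indexAt x) x := by
  rw [tilde, density_eq]
  rfl

variable [IsManifold 𝓘(ℂ, Model n) ω X]

theorem contForm_trTilde (D : Connection E) : ContForm (Z.trTilde D) := by
  have h := D.toLocal.formsSmooth_cw (f := traceL r) (n + 1) (fun j => (j.factorial : ℂ)⁻¹)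
    (Complex.I / (2 * (Real.pi : ℂ))) traceL_mul_comm
    (centralClosed_gammaForm Z.rho Z.omega.smooth Z.omega.closed)
    (centralClosed_scalarForm Z.U_smooth Z.U_closed)
  have h1 : Z.trTilde D = _ := funext (Z.trTilde_eq D)
  rw [h1]
  exact (h (2 * n)).contForm

theorem continuous_traceL_zeta (D : Connection E) :
    Continuous fun x => traceL r (Z.zeta D x) := by
  refine continuous_of_inChart (n := n) fun x₀ => ⟨Set.univ, isOpen_univ, trivial, ?_⟩
  rw [chartSet_univ]
  have h1 := (ContinuousLinearMap.continuous (ContinuousAlternatingMap.apply ℝ (Model n) ℂ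
      (realBasis n : Fin (2 * n) → Model n))).comp_continuousOn (Z.contForm_trTilde D x₀)
  have h2 := (ContinuousLinearMap.continuous (ContinuousAlternatingMap.apply ℝ (Model n) ℝ
      (realBasis n : Fin (2 * n) → Model n))).comp_continuousOn (Z.omega.contForm_volForm x₀)
  have hpos : ∀ y ∈ (chartAt (Model n) x₀).target, inChart x₀ Z.omega.volForm y (realBasis n) ≠ 0 :=
    fun y hy => (Z.omega.inChart_volForm_pos x₀ hy).ne'
  refine ((h2.inv₀ hpos).smul h1).congr fun y hy => ?_
  have h3 : inChart x₀ (Z.trTilde D) y (realBasis n) =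
      (inChart x₀ Z.omega.volForm y (realBasis n) : ℂ) *
        traceL r (Z.zeta D ((chartAt (Model n) x₀).symm y)) := Z.trTilde_apply D _ _
  change _ = (inChart x₀ Z.omega.volForm y (realBasis n))⁻¹ •
    inChart x₀ (Z.trTilde D) y (realBasis n)
  rw [h3, Complex.real_smul, Complex.ofReal_inv, inv_mul_cancel_left₀]
  exact_mod_cast hpos y hy

theorem coordChange_mul_tildeIn (D : Connection E) {i j : ι} {x : X}
    (hx : x ∈ E.baseSet i ∩ E.baseSet j) (v : Fin (2 * n) → Model n) :
    E.coordChange i j x * Z.tildeIn D i x v = Z.tildeIn D j x v * E.coordChange i j x := by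
  have h := Forms.semiconj_cw (W := EndFib r) (g := E.coordChange i j x)
    ((centralClosed_gammaForm (W := EndFib r) Z.rho Z.omega.smooth Z.omega.closed).central x)
    ((centralClosed_scalarForm (W := EndFib r) Z.U_smooth Z.U_closed).central x)
    (semiconj_smul (Complex.I / (2 * (Real.pi : ℂ))) (D.toLocal.semiconj_curvOf hx))
    (n + 1) (fun j => (j.factorial : ℂ)⁻¹)
  have h1 := congrArg (fun a : Forms n (EndFib r) => a (2 * n) v) h.eq
  simp only [Forms.ofConst_mul_apply, Forms.mul_ofConst_apply] at h1
  exact h1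

theorem contDiffOn_tildeIn (D : Connection E) (i : ι) (x₀ : X) :
    ContDiffOn ℝ ∞ (inChart x₀ (Z.tildeIn D i)) (chartSet n x₀ (E.baseSet i)) :=
  D.toLocal.smooth_cw (ContinuousLinearMap.id ℝ (EndFib r)) (n + 1) (fun j => (j.factorial : ℂ)⁻¹)
    (Complex.I / (2 * (Real.pi : ℂ)))
    (centralClosed_gammaForm (W := EndFib r) Z.rho Z.omega.smooth Z.omega.closed).smooth
    (centralClosed_scalarForm (W := EndFib r) Z.U_smooth Z.U_closed).smooth i x₀ (2 * n)

theorem normSqEnd_tildeIn (D : Connection E) {i j : ι} {x : X}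
    (hx : x ∈ E.baseSet i ∩ E.baseSet j) (v : Fin (2 * n) → Model n) :
    normSqEnd (Z.tildeIn D j x v) = normSqEnd (Z.tildeIn D i x v) := by
  have hu := E.unitary_coordChange i j x hx
  exact normSqEnd_conj (Unitary.mem_iff.1 hu).1 (Unitary.mem_iff.1 hu).2
    (Z.coordChange_mul_tildeIn D hx v)

/-- The endomorphism ζ is expressed in the frame chosen at each point, which may jump. Its norm is
invariant under the unitary transition functions, so near a given point it can be computed in one
fixed frame, where everything is smooth. -/
theorem continuous_normSqEnd_zeta (D : Connection E) :
    Continuous fun x => normSqEnd (Z.zeta D x) := by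
  refine continuous_of_inChart (n := n) fun x₀ => ⟨E.baseSet (E.indexAt x₀), E.isOpen_baseSet _,
    E.mem_baseSet_at x₀, ?_⟩
  set i := E.indexAt x₀
  have h1 := (continuous_normSqEnd (r := r)).comp_continuousOn ((ContinuousLinearMap.continuous
    (ContinuousAlternatingMap.apply ℝ (Model n) (EndFib r)
      (realBasis n : Fin (2 * n) → Model n))).comp_continuousOn
        (Z.contDiffOn_tildeIn D i x₀).continuousOn)
  have h2 := ((ContinuousLinearMap.continuous (ContinuousAlternatingMap.apply ℝ (Model n) ℝ
      (realBasis n : Fin (2 * n) → Model n))).comp_continuousOn (Z.omega.contForm_volForm x₀)).mono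
        fun y (hy : y ∈ chartSet n x₀ (E.baseSet i)) => hy.1
  have hpos : ∀ y ∈ chartSet n x₀ (E.baseSet i),
      inChart x₀ Z.omega.volForm y (realBasis n) ≠ 0 :=
    fun y hy => (Z.omega.inChart_volForm_pos x₀ hy.1).ne'
  refine (((h2.inv₀ hpos).pow 2).mul h1).congr fun y hy => ?_
  set x := (chartAt (Model n) x₀).symm y
  have h3 : inChart x₀ (Z.tilde D) y (realBasis n) =
      (inChart x₀ Z.omega.volForm y (realBasis n) : ℂ) • Z.zeta D x := Z.tilde_apply D _ _
  have h4 : normSqEnd (inChart x₀ (Z.tilde D) y (realBasis n)) =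
      normSqEnd (inChart x₀ (Z.tildeIn D i) y (realBasis n)) := by
    rw [inChart_apply, inChart_apply, tilde_eq_tildeIn]
    exact Z.normSqEnd_tildeIn D ⟨hy.2, E.mem_baseSet_at x⟩ _
  rw [h3, normSqEnd_smul, Complex.normSq_ofReal] at h4
  change normSqEnd (Z.zeta D x) = (inChart x₀ Z.omega.volForm y (realBasis n))⁻¹ ^ 2 *
    normSqEnd (inChart x₀ (Z.tildeIn D i) y (realBasis n))
  rw [← h4]
  have := hpos y hy
  field_simp

variable [CompactSpace X] [T2Space X]

/-- Transgression exhibits the difference as an exact form, and Stokes' theorem annihilates its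
integral. Hence the choice of connection in `charge` is immaterial. -/
theorem integral_trTilde_eq (D₀ D₁ : Connection E) :
    integral (Z.trTilde D₁) = integral (Z.trTilde D₀) := by
  obtain ⟨Θ, hΘ, h⟩ := D₀.toLocal.exists_transgression (f := traceL r) (n + 1)
    (fun j => (j.factorial : ℂ)⁻¹) (Complex.I / (2 * (Real.pi : ℂ))) traceL_mul_comm
    (centralClosed_gammaForm Z.rho Z.omega.smooth Z.omega.closed) (sgn_gammaForm _ _)
    (centralClosed_scalarForm Z.U_smooth Z.U_closed) D₁.toLocal
  have hdiff : ∀ x, Z.trTilde D₁ x =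
      Z.trTilde D₀ x + Forms.d (inCh x Θ) (chartAt (Model n) x x) (2 * n) := fun x => by
    rw [Z.trTilde_eq, Z.trTilde_eq, ← h x]
    exact (add_sub_cancel _ _).symm
  rw [funext hdiff]
  obtain rfl | ⟨m, rfl⟩ : n = 0 ∨ ∃ m, n = m + 1 := by
    cases n with
    | zero => exact Or.inl rfl
    | succ m => exact Or.inr ⟨m, rfl⟩
  -- For n = 0 the top degree is zero, where the exterior derivative has no component, so the two
  -- forms agree.
  · congr 1
    funext x
    exact add_zero _
  · have hθ := hΘ (2 * m + 1)
    have hz : integral (fun x =>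
        Forms.d (inCh x Θ) (chartAt (Model (m + 1)) x x) (2 * (m + 1))) = 0 :=
      integral_dForm rfl hθ fun _ _ => rfl
    rw [integral_add (Z.contForm_trTilde D₀)
      (θ := fun x => Forms.d (inCh x Θ) (chartAt (Model (m + 1)) x x) (2 * (m + 1)))
      hθ.contForm_dForm, hz, add_zero]

theorem integral_trTilde (D : Connection E) : integral (Z.trTilde D) = Z.charge E := by
  have hne : Nonempty (Connection E) := ⟨D⟩
  rw [charge, dif_pos hne]
  exact Z.integral_trTilde_eq _ _

theorem normSq_rot (E : HermitianBundle n r X ι) : Complex.normSq (Z.rot E) = 1 := by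
  rw [rot, Complex.normSq_eq_norm_sq, Complex.norm_exp]
  simp

/-- The difference of the Yang--Mills functional and its bound is the integral of a square. -/
theorem integral_sq_eq (A : ChernConnection E) [Nonempty X] :
    integral (fun x => normSqEnd (Z.rot E • Z.zeta A.toConnection x -
      (((Z.rot E * Z.charge E).re / (r * Z.omega.vol) : ℝ) : ℂ) • 1) • Z.omega.volForm x) =
    Z.yangMills A - Z.bound E := by
  -- This constant minimises −2c Re(e^{-iφ}Z(E)) + c² rk E · vol X, and the minimum is minus the
  -- bound.
  set c : ℝ := (Z.rot E * Z.charge E).re / (r * Z.omega.vol)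
  have hc1 := contForm_smul_volForm Z.omega (Z.continuous_normSqEnd_zeta A.toConnection)
  let f : ℂ →L[ℝ] ℝ := (-(2 * c)) • Complex.reCLM.comp (ContinuousLinearMap.mul ℝ ℂ (Z.rot E))
  have hc2 := (Z.contForm_trTilde A.toConnection).map f
  have hc3 := contForm_smul_volForm Z.omega (continuous_const (y := c ^ 2 * r))
  let g : ℝ →L[ℝ] ℝ := (c ^ 2 * r) • ContinuousLinearMap.id ℝ ℝ
  have hexp : (fun x => normSqEnd (Z.rot E • Z.zeta A.toConnection x - (c : ℂ) • 1) •
      Z.omega.volForm x) = fun x => (normSqEnd (Z.zeta A.toConnection x) • Z.omega.volForm x +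
        f.compContinuousAlternatingMap (Z.trTilde A.toConnection x)) +
          g.compContinuousAlternatingMap (Z.omega.volForm x) := by
    funext x
    ext v
    change _ * Z.omega.volForm x v = normSqEnd _ * Z.omega.volForm x v +
      (-(2 * c)) * (Z.rot E * Z.trTilde A.toConnection x v).re + (c ^ 2 * r) * Z.omega.volForm x v
    rw [normSqEnd_sub_smul_one, normSqEnd_smul, normSq_rot, traceL_smul, trTilde_apply,
      mul_left_comm, Complex.re_ofReal_mul]
    ring
  rw [hexp, integral_add (hc1.add hc2) (Z.omega.contForm_volForm.map g), integral_add hc1 hc2,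
    integral_map f (Z.contForm_trTilde A.toConnection), integral_map g Z.omega.contForm_volForm,
    Z.integral_trTilde]
  change Z.yangMills A + (-(2 * c)) * (Z.rot E * Z.charge E).re + (c ^ 2 * r) * Z.omega.vol = _
  rw [bound]
  have hv := Z.omega.vol_pos.ne'
  -- In rank zero division by zero makes both c and the bound zero, and the identity is trivial.
  rcases eq_or_ne (r : ℝ) 0 with hr | hr
  · simp [c, hr]
  · simp only [c]
    field_simp
    ring

theorem bound_le_yangMills [Nonempty X] (A : ChernConnection E) : Z.bound E ≤ Z.yangMills A := by
  have h := integral_smul_volForm_nonneg Z.omega (fun x => normSqEnd_nonneg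
    (Z.rot E • Z.zeta A.toConnection x -
      (((Z.rot E * Z.charge E).re / (r * Z.omega.vol) : ℝ) : ℂ) • (1 : EndFib r)))
  rw [integral_sq_eq] at h
  linarith

theorem rot_smul_tilde (A : ChernConnection E) (x : X) (v : Fin (2 * n) → Model n) :
    Z.rot E • Z.tilde A.toConnection x v =
      (Z.omega.volForm x v : ℂ) • (Z.rot E • Z.zeta A.toConnection x) := by
  rw [tilde_apply, smul_comm]

/-- The bound is attained exactly where the rescaled endomorphism is a constant multiple of the
identity. -/
theorem yangMills_eq_bound_iff [Nonempty X] (A : ChernConnection E) :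
    Z.yangMills A = Z.bound E ↔ ∀ x, Z.rot E • Z.zeta A.toConnection x =
      (((Z.rot E * Z.charge E).re / (r * Z.omega.vol) : ℝ) : ℂ) • (1 : EndFib r) := by
  have h := Z.integral_sq_eq A
  set c : ℝ := (Z.rot E * Z.charge E).re / (r * Z.omega.vol)
  constructor
  · intro heq x
    rw [heq, sub_self] at h
    have hcont : Continuous fun x =>
        normSqEnd (Z.rot E • Z.zeta A.toConnection x - (c : ℂ) • (1 : EndFib r)) := by
      -- After expansion only |ζ|² and tr ζ remain. Both are independent of the frame, so their
      -- continuity is available although ζ itself may jump.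
      simp only [normSqEnd_sub_smul_one, normSqEnd_smul, traceL_smul]
      have h1 := Z.continuous_normSqEnd_zeta A.toConnection
      have h2 := Z.continuous_traceL_zeta A.toConnection
      fun_prop
    have h0 := eq_zero_of_integral_smul_volForm Z.omega hcont (fun _ => normSqEnd_nonneg _) h x
    exact sub_eq_zero.1 (eq_zero_of_normSqEnd _ h0)
  · intro hx
    have h0 : (fun x => normSqEnd (Z.rot E • Z.zeta A.toConnection x - (c : ℂ) • 1) •
        Z.omega.volForm x) = fun x =>
          (0 : ℝ →L[ℝ] ℝ).compContinuousAlternatingMap (Z.omega.volForm x) := by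
      funext x
      rw [hx x, sub_self, normSqEnd_zero, zero_smul]
      rfl
    rw [h0, integral_map _ Z.omega.contForm_volForm] at h
    exact (sub_eq_zero.1 h.symm)

/-- Taking traces and integrating leaves no freedom for the constant: the left side becomes the
topological charge and the right side a multiple of the volume. -/
theorem eq_of_rot_smul_zeta [Nonempty X] (A : ChernConnection E) {c : ℝ}
    (h : ∀ x, Z.rot E • Z.zeta A.toConnection x = (c : ℂ) • (1 : EndFib r)) :
    (Z.rot E * Z.charge E).re = c * (r * Z.omega.vol) := by
  let f : ℂ →L[ℝ] ℝ := Complex.reCLM.comp (ContinuousLinearMap.mul ℝ ℂ (Z.rot E))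
  let g : ℝ →L[ℝ] ℝ := (c * r) • ContinuousLinearMap.id ℝ ℝ
  have h1 := integral_map f (Z.contForm_trTilde A.toConnection)
  have h2 := integral_map g Z.omega.contForm_volForm
  have h3 : (fun x => f.compContinuousAlternatingMap (Z.trTilde A.toConnection x)) =
      fun x => g.compContinuousAlternatingMap (Z.omega.volForm x) := by
    funext x
    ext v
    change (Z.rot E * Z.trTilde A.toConnection x v).re = (c * r) * Z.omega.volForm x v
    rw [trTilde_apply, mul_left_comm, ← traceL_smul, h x, traceL_smul, traceL_one,
      Complex.re_ofReal_mul, Complex.re_ofReal_mul, Complex.natCast_re]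
    ring
  rw [h3, h2, Z.integral_trTilde] at h1
  change (c * r) * Z.omega.vol = (Z.rot E * Z.charge E).re at h1
  rw [← h1, mul_assoc]

theorem isCritical_and_realPartEq_iff [Nonempty X] (A : ChernConnection E) :
    (Z.IsCritical A ∧ ∃ lam : ℝ, Z.RealPartEq A lam) ↔ Z.yangMills A = Z.bound E := by
  have hfac : (n.factorial : ℝ) ≠ 0 := by positivity
  rw [yangMills_eq_bound_iff]
  constructor
  · rintro ⟨hc, lam, hl⟩
    -- The equation is normalised by ω^n and ζ by ω^n/n!, so the constant for ζ is n! times λ.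
    have hz : ∀ x, Z.rot E • Z.zeta A.toConnection x =
        ((lam * n.factorial : ℝ) : ℂ) • (1 : EndFib r) := fun x => by
      have h1 := eq_of_realPart_imaginaryPart (hc x (realBasis n)) (hl x (realBasis n))
      have h2 : lam * Z.omega.pow n x (realBasis n) =
          Z.omega.volForm x (realBasis n) * (lam * n.factorial) := by
        rw [Z.omega.volForm_apply]
        field_simp
      have h3 : (Z.omega.volForm x (realBasis n) : ℂ) ≠ 0 :=
        Complex.ofReal_ne_zero.2 (Z.omega.volForm_pos x).ne'
      rw [rot_smul_tilde, h2, real_smul_end, Complex.ofReal_mul, ← smul_smul] at h1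
      exact smul_right_injective _ h3 h1
    intro x
    rw [hz x]
    -- In rank zero the constant is not determined, but all endomorphisms are equal.
    rcases Nat.eq_zero_or_pos r with rfl | hr
    · exact Subsingleton.elim _ _
    · have hr' : (r : ℝ) ≠ 0 := by positivity
      rw [Z.eq_of_rot_smul_zeta A hz, mul_div_cancel_right₀ _ (mul_ne_zero hr' Z.omega.vol_pos.ne')]
  · intro h
    set c : ℝ := (Z.rot E * Z.charge E).re / (r * Z.omega.vol)
    have h1 : ∀ x v, Z.rot E • Z.tilde A.toConnection x v =
        (c / n.factorial * Z.omega.pow n x v) • (1 : EndFib r) := fun x v => by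
      rw [rot_smul_tilde, h x, smul_smul, ← Complex.ofReal_mul, ← real_smul_end,
        Z.omega.volForm_apply]
      congr 1
      field_simp
    exact ⟨fun x v => (realPart_imaginaryPart_of_smul_one (h1 x v)).1, c / n.factorial,
      fun x v => (realPart_imaginaryPart_of_smul_one (h1 x v)).2⟩

/-- At any one point the real part of the trace is λ · r times the value of ω^n on the oriented
basis. That value is positive and r ≥ 0, so λ ≤ 0 would make the trace nonpositive. -/
theorem pos_of_isAlmostCalibrated [Nonempty X] (A : ChernConnection E) (lam : ℝ)
    (h : Z.IsAlmostCalibrated A) (h' : Z.RealPartEq A lam) : 0 < lam := by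
  obtain ⟨x⟩ := ‹Nonempty X›
  have h1 := h x
  have h2 : Z.rot E * Z.trTilde A.toConnection x (realBasis n) =
      traceL r (Z.rot E • Z.tilde A.toConnection x (realBasis n)) := (traceL_smul _ _).symm
  rw [h2, re_traceL, h' x, real_smul_end, traceL_smul, traceL_one, Complex.re_ofReal_mul,
    Complex.natCast_re] at h1
  by_contra hl
  have h3 := Z.omega.pow_pos x
  have h4 : lam * Z.omega.pow n x (realBasis n) * r ≤ 0 :=
    mul_nonpos_of_nonpos_of_nonneg (mul_nonpos_of_nonpos_of_nonneg (not_lt.1 hl) h3.le)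
      (Nat.cast_nonneg r)
  linarith

end CentralCharge

end Main

end ZYM

end

/-! ### The theorem -/

open ZYM in
theorem mainTheorem10 {n r : ℕ} {X : Type*} [TopologicalSpace X] [ChartedSpace (Model n) X]
    [IsManifold 𝓘(ℂ, Model n) ω X] [CompactSpace X] [T2Space X] [Nonempty X] {ι : Type*}
    (E : HermitianBundle n r X ι) (Z : CentralCharge n X) :
    (∀ D : Connection E, integral (Z.trTilde D) = Z.charge E) ∧
    (∀ A : ChernConnection E, Z.bound E ≤ Z.yangMills A) ∧
    (∀ A : ChernConnection E,
      (Z.IsMinimum A ∧ Z.yangMills A = Z.bound E) ↔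
        (Z.IsCritical A ∧ ∃ lam : ℝ, Z.RealPartEq A lam)) ∧
    ((∃ B : ChernConnection E, Z.yangMills B = Z.bound E) → ∀ A : ChernConnection E,
      Z.IsMinimum A ↔ (Z.IsCritical A ∧ ∃ lam : ℝ, Z.RealPartEq A lam)) ∧
    (∀ (A : ChernConnection E) (lam : ℝ),
      Z.IsAlmostCalibrated A → Z.RealPartEq A lam → 0 < lam) := by
  have hiff := fun A : ChernConnection E => Z.isCritical_and_realPartEq_iff A
  have hmin : ∀ A : ChernConnection E, Z.yangMills A = Z.bound E → Z.IsMinimum A := fun A h B => by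
    rw [h]
    exact Z.bound_le_yangMills B
  refine ⟨Z.integral_trTilde, Z.bound_le_yangMills, fun A => ?_, fun ⟨B, hB⟩ A => ?_,
    fun A lam h h' => Z.pos_of_isAlmostCalibrated A lam h h'⟩
  · rw [hiff]
    exact ⟨fun h => h.2, fun h => ⟨hmin A h, h⟩⟩
  · rw [hiff]
    -- If B attains the bound, a minimum A has value at most that of B, which the general bound then
    -- turns into equality.
    exact ⟨fun h => le_antisymm ((h B).trans hB.le) (Z.bound_le_yangMills A), hmin A⟩
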